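/- Let $X$ be a Fano manifold, that is, a compact connected complex manifold with ample $-K_X$, of complex dimension $n\ge 1$; let $D\subset X$ be a smooth divisor in $|-K_X|$, and let $\omega_0$ be a smooth Kähler form in $2\pi c_1(X)$. Fix a defining section $S\in H^0(X,-K_X)$ of $D$ (so $D$ is the zero set of $S$ and $S$ vanishes to first order along it) and a smooth Hermitian metric $h$ on $-K_X$ with curvature form $-\sqrt{-1}\,\partial\bar\partial\log h=\omega_0$. Let $$\mathcal H=\{\varphi\in C^\infty(X;\mathbb R):\ \omega_0+\sqrt{-1}\,\partial\bar\partial\varphi>0\},\qquad \chi_\epsilon=\sqrt{-1}\,\partial\bar\partial\log(|S|_h^2+\epsilon)+\omega_0\quad(\epsilon>0).$$ For $\varphi\in\mathcal H$ choose any family $\varphi(t)\in\mathcal H$, $t\in[0,1]$, smooth on $[0,1]\times X$, with $\varphi(0)=0$ and $\varphi(1)=\varphi$; put $\omega_t=\omega_0+\sqrt{-1}\,\partial\bar\partial\varphi(t)$, $\dot\varphi=\partial\varphi/\partial t$, and define, with this family, $$J_{\chi_\epsilon}(\varphi)=n\int_0^1\!dt\int_X\dot\varphi(t)\,(\chi_\epsilon-\omega_t)\wedge\omega_t^{n-1},$$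 $$J_\chi(\varphi)=2\pi n\int_0^1\!dt\int_D\dot\varphi(t)\,\omega_t^{n-1}-n\int_0^1\!dt\int_X\dot\varphi(t)\,\omega_t^{n},$$ $$E(\varphi)=-n\int_0^1\!dt\int_X\dot\varphi(t)\,(\mathrm{Ric}(\omega_t)-\omega_t)\wedge\omega_t^{n-1},$$ and, for $\beta\in(0,1]$, $$E_{\epsilon,(1-\beta)D}(\varphi)=E(\varphi)+(1-\beta)J_{\chi_\epsilon}(\varphi),\qquad E_{(1-\beta)D}(\varphi)=E(\varphi)+(1-\beta)J_\chi(\varphi).$$ Then there is a constant $C_3>0$, depending only on $X$, $D$, $\omega_0$ (with the fixed choices of $S$ and $h$), such that for all $\epsilon\in(0,1]$, all $\varphi\in\mathcal H$ and every choice of the family $\varphi(t)$, $$J_{\chi_\epsilon}(\varphi)\ \ge\ J_\chi(\varphi)-C_3,$$ and consequently, with the same $C_3$, for all $\beta\in(0,1]$, $$E_{\epsilon,(1-\beta)D}(\varphi)\ \ge\ E_{(1-\beta)D}(\varphi)-C_3 .$$ -/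

import Mathlib

open scoped Manifold ContDiff Matrix ComplexOrder

namespace TwistedEnergy

/-! ### Local calculus on `ℂⁿ` -/

/-- The coordinate space `ℂⁿ`. -/
abbrev Cn (n : ℕ) : Type := Fin n → ℂ

/-- The Wirtinger derivative `∂f/∂z_j = (∂f/∂x_j - i ∂f/∂y_j) / 2`. -/
noncomputable def dz {n : ℕ} (j : Fin n) (f : Cn n → ℂ) (z : Cn n) : ℂ :=
  (1 / 2) * (fderiv ℝ f z (Pi.single j 1) - Complex.I * fderiv ℝ f z (Pi.single j Complex.I))

/-- The Wirtinger derivative `∂f/∂z̄_j = (∂f/∂x_j + i ∂f/∂y_j) / 2`. -/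
noncomputable def dzbar {n : ℕ} (j : Fin n) (f : Cn n → ℂ) (z : Cn n) : ℂ :=
  (1 / 2) * (fderiv ℝ f z (Pi.single j 1) + Complex.I * fderiv ℝ f z (Pi.single j Complex.I))

/-- The complex Hessian `(∂²u / ∂z_j ∂z̄_k)` of a real function, that is, the coefficient matrix of
`√-1 ∂∂̄ u`. -/
noncomputable def complexHessian {n : ℕ} (u : Cn n → ℝ) (z : Cn n) : Matrix (Fin n) (Fin n) ℂ :=
  Matrix.of fun j k => dz j (fun w => dzbar k (fun v => (u v : ℂ)) w) z

/-- The matrix `(∂F_k / ∂z_a)` of complex partial derivatives of a holomorphic map. -/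
noncomputable def holJacobian {m n : ℕ} (F : Cn m → Cn n) (z : Cn m) :
    Matrix (Fin n) (Fin m) ℂ :=
  Matrix.of fun k a => fderiv ℂ F z (Pi.single a 1) k

/-- For `(1,1)`-forms `α_i = √-1 ∑ (A i)_{jk} dz_j ∧ dz̄_k`, `i = 1, …, n`, on `ℂⁿ`, the coefficient
`c` in `α_1 ∧ ⋯ ∧ α_n = c · (√-1 dz_1 ∧ dz̄_1) ∧ ⋯ ∧ (√-1 dz_n ∧ dz̄_n)`. It is `n! det A` if all
the matrices `A i` are equal to `A`, and `1` if `n = 0`. -/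
noncomputable def wedgeCoeff {n : ℕ} (A : Fin n → Matrix (Fin n) (Fin n) ℂ) : ℂ :=
  ∑ σ : Equiv.Perm (Fin n), ∑ τ : Equiv.Perm (Fin n),
    ((Equiv.Perm.sign σ : ℤ) : ℂ) * ((Equiv.Perm.sign τ : ℤ) : ℂ) * ∏ i, A i (σ i) (τ i)

/-! ### Forms on a complex manifold -/

/-- Charts of an `n`-dimensional complex manifold. -/
abbrev Chart (n : ℕ) (X : Type*) [TopologicalSpace X] := OpenPartialHomeomorph X (Cn n)

/-- A `(1,1)`-form `√-1 ∑ α_{jk} dz_j ∧ dz̄_k` written in local coordinates: to a chart `e` and a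
point `z` of its target it assigns the coefficient matrix `(α_{jk})`. Only the charts of the
atlas and the points of their targets matter. -/
abbrev LocalForm (n : ℕ) (X : Type*) [TopologicalSpace X] :=
  Chart n X → Cn n → Matrix (Fin n) (Fin n) ℂ

section Forms

variable {n : ℕ} {X : Type*} [TopologicalSpace X]

/-- The form `√-1 ∂∂̄ u`. -/
noncomputable def ddbar (u : X → ℝ) : LocalForm n X :=
  fun e z => complexHessian (fun w => u (e.symm w)) z

/-- The Ricci form `Ric(ω) = -√-1 ∂∂̄ log det (g_{jk})` of `ω = √-1 ∑ g_{jk} dz_j ∧ dz̄_k`. -/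
noncomputable def ricci (g : LocalForm n X) : LocalForm n X :=
  fun e z => -complexHessian (fun w => Real.log (g e w).det.re) z

/-- `g` is a smooth Kähler form: in each chart its coefficients are smooth, its matrix is Hermitian
positive definite and it is closed, and in different charts the matrices represent the same form. -/
structure IsKahlerForm [ChartedSpace (Cn n) X] (g : LocalForm n X) : Prop where
  smooth : ∀ e ∈ atlas (Cn n) X, ∀ j k, ContDiffOn ℝ ∞ (fun z => g e z j k) e.target
  pos : ∀ e ∈ atlas (Cn n) X, ∀ z ∈ e.target, (g e z).PosDef
  closed : ∀ e ∈ atlas (Cn n) X, ∀ z ∈ e.target, ∀ j k l,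
    dz l (fun w => g e w j k) z = dz j (fun w => g e w l k) z
  compatible : ∀ e ∈ atlas (Cn n) X, ∀ e' ∈ atlas (Cn n) X, ∀ x ∈ e.source ∩ e'.source,
    g e (e x) = (holJacobian (e' ∘ e.symm) (e x))ᵀ * g e' (e' x) *
      (holJacobian (e' ∘ e.symm) (e x)).map (starRingEnd ℂ)

/-- The pull-back of a `(1,1)`-form under a map `ι : Y → X`. -/
noncomputable def pullback {m : ℕ} [ChartedSpace (Cn n) X] {Y : Type*} [TopologicalSpace Y]
    (ι : Y → X) (g : LocalForm n X) : LocalForm m Y := fun e z =>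
  let e' : Chart n X := chartAt (Cn n) (ι (e.symm z))
  let J : Matrix (Fin n) (Fin m) ℂ := holJacobian (fun w => e' (ι (e.symm w))) z
  Jᵀ * g e' (e' (ι (e.symm z))) * J.map (starRingEnd ℂ)

/-! ### Integration -/

/-- The form `u · α_1 ∧ ⋯ ∧ α_n` of top degree: its density in each chart with respect to
Lebesgue measure on `ℂⁿ`. The factor `2ⁿ` comes from `√-1 dz ∧ dz̄ = 2 dx ∧ dy`. -/
noncomputable def topForm (u : X → ℝ) (α : Fin n → LocalForm n X) : Chart n X → Cn n → ℝ :=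
  fun e z => u (e.symm z) * (2 ^ n * (wedgeCoeff fun i => α i e z).re)

variable (n X) in
theorem exists_chartPartition [ChartedSpace (Cn n) X] [T2Space X] [CompactSpace X] :
    ∃ ρ : PartitionOfUnity X X Set.univ,
      ρ.IsSubordinate fun x => (chartAt (Cn n) x).source :=
  PartitionOfUnity.exists_isSubordinate isClosed_univ _
    (fun x => (chartAt (Cn n) x).open_source)
    (fun x _ => Set.mem_iUnion.2 ⟨x, mem_chart_source (Cn n) x⟩)

variable (n X) in
/-- A partition of unity subordinate to the cover by coordinate charts. -/
noncomputable def chartPartition [ChartedSpace (Cn n) X] [T2Space X] [CompactSpace X] :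
    PartitionOfUnity X X Set.univ :=
  (exists_chartPartition n X).choose

/-- The integral over a compact complex manifold of a form of top degree with local densities
`η`, by means of a partition of unity. -/
noncomputable def integral [ChartedSpace (Cn n) X] [T2Space X] [CompactSpace X]
    (η : Chart n X → Cn n → ℝ) : ℝ :=
  ∑ᶠ x : X, ∫ z in (chartAt (Cn n) x).target,
    chartPartition n X x ((chartAt (Cn n) x).symm z) * η (chartAt (Cn n) x) z

/-! ### The anticanonical bundle -/

variable (n X) in
/-- A holomorphic section of `-K_X = Λⁿ T^{1,0} X`: its coefficient with respect to the frame
`∂/∂z_1 ∧ ⋯ ∧ ∂/∂z_n` of each chart. -/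
structure AnticanonicalSection [ChartedSpace (Cn n) X] where
  coeff : Chart n X → Cn n → ℂ
  holomorphic : ∀ e ∈ atlas (Cn n) X, DifferentiableOn ℂ (coeff e) e.target
  compatible : ∀ e ∈ atlas (Cn n) X, ∀ e' ∈ atlas (Cn n) X, ∀ x ∈ e.source ∩ e'.source,
    coeff e' (e' x) = (holJacobian (e' ∘ e.symm) (e x)).det * coeff e (e x)

variable (n X) in
/-- A smooth Hermitian metric on `-K_X`: the squared norm of the frame
`∂/∂z_1 ∧ ⋯ ∧ ∂/∂z_n` of each chart. -/
structure AnticanonicalMetric [ChartedSpace (Cn n) X] where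
  weight : Chart n X → Cn n → ℝ
  pos : ∀ e ∈ atlas (Cn n) X, ∀ z ∈ e.target, 0 < weight e z
  smooth : ∀ e ∈ atlas (Cn n) X, ContDiffOn ℝ ∞ (weight e) e.target
  compatible : ∀ e ∈ atlas (Cn n) X, ∀ e' ∈ atlas (Cn n) X, ∀ x ∈ e.source ∩ e'.source,
    weight e (e x) = ‖(holJacobian (e' ∘ e.symm) (e x)).det‖ ^ 2 * weight e' (e' x)

/-- The curvature form `-√-1 ∂∂̄ log h` of the metric is `g`. A Kähler form lies in `2π c₁(X)` if and
only if it is the curvature form of some metric on `-K_X`. -/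
def AnticanonicalMetric.HasCurvature [ChartedSpace (Cn n) X] (h : AnticanonicalMetric n X)
    (g : LocalForm n X) : Prop :=
  ∀ e ∈ atlas (Cn n) X, ∀ z ∈ e.target,
    g e z = -complexHessian (fun w => Real.log (h.weight e w)) z

/-- The function `|S|²_h` on `X`. -/
noncomputable def normSq [ChartedSpace (Cn n) X] (h : AnticanonicalMetric n X)
    (S : AnticanonicalSection n X) (x : X) : ℝ :=
  h.weight (chartAt (Cn n) x) (chartAt (Cn n) x x) *
    ‖S.coeff (chartAt (Cn n) x) (chartAt (Cn n) x x)‖ ^ 2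

/-- `ι : Y → X` is a holomorphic embedding of a compact complex manifold of dimension `m` whose
image is the smooth divisor `D` defined by `S`: the image is the zero set of `S`, and `S` vanishes
to first order along it. -/
structure IsSmoothDivisor {m : ℕ} [ChartedSpace (Cn n) X] {Y : Type*} [TopologicalSpace Y]
    [ChartedSpace (Cn m) Y] (S : AnticanonicalSection n X) (ι : Y → X) : Prop where
  holomorphic : ContMDiff 𝓘(ℂ, Cn m) 𝓘(ℂ, Cn n) ω ι
  injective : Function.Injective ι
  immersion : ∀ y, Function.Injective (mfderiv 𝓘(ℂ, Cn m) 𝓘(ℂ, Cn n) ι y)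
  range_eq : Set.range ι =
    {x | S.coeff (chartAt (Cn n) x) (chartAt (Cn n) x x) = 0}
  transversal : ∀ y,
    fderiv ℂ (S.coeff (chartAt (Cn n) (ι y))) (chartAt (Cn n) (ι y) (ι y)) ≠ 0

/-! ### Kähler potentials and paths of potentials -/

/-- The space `𝓗` of smooth Kähler potentials with respect to `ω₀`. -/
def kahlerPotentials [ChartedSpace (Cn n) X] (ω₀ : LocalForm n X) : Set (X → ℝ) :=
  {φ | ContMDiff 𝓘(ℝ, Cn n) 𝓘(ℝ, ℝ) ∞ φ ∧
    ∀ e ∈ atlas (Cn n) X, ∀ z ∈ e.target, (ω₀ e z + ddbar φ e z).PosDef}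

/-- `γ t`, `t ∈ [0,1]`, is a smooth family of potentials in `𝓗` from `0` to `φ`. -/
structure IsPotentialPath [ChartedSpace (Cn n) X] (ω₀ : LocalForm n X) (φ : X → ℝ)
    (γ : ℝ → X → ℝ) : Prop where
  smooth : ContMDiffOn (𝓘(ℝ, ℝ).prod 𝓘(ℝ, Cn n)) 𝓘(ℝ, ℝ) ∞
    (fun p : ℝ × X => γ p.1 p.2) (Set.Icc 0 1 ×ˢ Set.univ)
  mem : ∀ t ∈ Set.Icc (0 : ℝ) 1, γ t ∈ kahlerPotentials ω₀
  zero : γ 0 = 0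
  one : γ 1 = φ

/-- The time derivative of a family of functions defined for `t ∈ [0,1]`. -/
noncomputable def velocity (γ : ℝ → X → ℝ) (t : ℝ) (x : X) : ℝ :=
  derivWithin (fun s => γ s x) (Set.Icc 0 1) t

/-- The form `ω_t = ω₀ + √-1 ∂∂̄ γ(t)`. -/
noncomputable def formAt (ω₀ : LocalForm n X) (γ : ℝ → X → ℝ) (t : ℝ) : LocalForm n X :=
  ω₀ + ddbar (γ t)

/-- The form `χ_ε = √-1 ∂∂̄ log (|S|²_h + ε) + ω₀`. -/
noncomputable def chiEps [ChartedSpace (Cn n) X] (ω₀ : LocalForm n X)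
    (h : AnticanonicalMetric n X) (S : AnticanonicalSection n X) (ε : ℝ) : LocalForm n X :=
  ddbar (fun x => Real.log (normSq h S x + ε)) + ω₀

end Forms

/-! ### The functionals

The manifold `X` has dimension `n = m + 1` and `D` has dimension `m`. -/

section Functionals

variable {m : ℕ} {X : Type*} [TopologicalSpace X] [ChartedSpace (Cn (m + 1)) X] [T2Space X]
  [CompactSpace X]

/-- `J_{χ_ε} = n ∫₀¹ dt ∫_X γ̇(t) (χ_ε - ω_t) ∧ ω_t^{n-1}`, computed along the path `γ`. -/
noncomputable def JEps (ω₀ : LocalForm (m + 1) X) (h : AnticanonicalMetric (m + 1) X)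
    (S : AnticanonicalSection (m + 1) X) (ε : ℝ) (γ : ℝ → X → ℝ) : ℝ :=
  ((m + 1 : ℕ) : ℝ) * ∫ t in (0 : ℝ)..1, integral (topForm (velocity γ t)
    (Fin.cons (chiEps ω₀ h S ε - formAt ω₀ γ t) fun _ : Fin m => formAt ω₀ γ t))

/-- `J_χ = 2π n ∫₀¹ dt ∫_D γ̇(t) ω_t^{n-1} - n ∫₀¹ dt ∫_X γ̇(t) ω_t^n`, computed along the path
`γ`, where `D` is the image of `ι : Y → X`. -/
noncomputable def JChi {Y : Type*} [TopologicalSpace Y] [ChartedSpace (Cn m) Y] [T2Space Y]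
    [CompactSpace Y] (ι : Y → X) (ω₀ : LocalForm (m + 1) X) (γ : ℝ → X → ℝ) : ℝ :=
  2 * Real.pi * ((m + 1 : ℕ) : ℝ) * (∫ t in (0 : ℝ)..1, integral (topForm
      (fun y => velocity γ t (ι y)) fun _ : Fin m => pullback ι (formAt ω₀ γ t))) -
    ((m + 1 : ℕ) : ℝ) * ∫ t in (0 : ℝ)..1, integral (topForm (velocity γ t)
      fun _ : Fin (m + 1) => formAt ω₀ γ t)

/-- The K-energy `E = -n ∫₀¹ dt ∫_X γ̇(t) (Ric(ω_t) - ω_t) ∧ ω_t^{n-1}`, computed along `γ`. -/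
noncomputable def KEnergy (ω₀ : LocalForm (m + 1) X) (γ : ℝ → X → ℝ) : ℝ :=
  -((m + 1 : ℕ) : ℝ) * ∫ t in (0 : ℝ)..1, integral (topForm (velocity γ t)
    (Fin.cons (ricci (formAt ω₀ γ t) - formAt ω₀ γ t) fun _ : Fin m => formAt ω₀ γ t))

/-- The regularized twisted K-energy `E_{ε,(1-β)D} = E + (1-β) J_{χ_ε}`. -/
noncomputable def twistedKEnergyEps (ω₀ : LocalForm (m + 1) X) (h : AnticanonicalMetric (m + 1) X)
    (S : AnticanonicalSection (m + 1) X) (β ε : ℝ) (γ : ℝ → X → ℝ) : ℝ :=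
  KEnergy ω₀ γ + (1 - β) * JEps ω₀ h S ε γ

/-- The twisted K-energy `E_{(1-β)D} = E + (1-β) J_χ`. -/
noncomputable def twistedKEnergy {Y : Type*} [TopologicalSpace Y] [ChartedSpace (Cn m) Y]
    [T2Space Y] [CompactSpace Y] (ι : Y → X) (ω₀ : LocalForm (m + 1) X) (β : ℝ)
    (γ : ℝ → X → ℝ) : ℝ :=
  KEnergy ω₀ γ + (1 - β) * JChi ι ω₀ γ

end Functionals

end TwistedEnergy

open TwistedEnergy

/-!
The difference of the two functionals is governed by the function
`f_ε = log (|S|² + ε) - log |S|² ≥ 0` (`logDefect`), which satisfies the Poincaré–Lelong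
equation `√-1 ∂∂̄ f_ε = χ_ε - 2π [D]` (`integral_logDefect_ddbar`). Tested against
`γ̇(t) ω_t^{n-1}`, it turns `J_{χ_ε} - J_χ` into the time integral of
`n ∫_X f_ε √-1 ∂∂̄ γ̇(t) ∧ ω_t^{n-1}` (`JEps_sub_JChi`). This integrand is the time derivative of
`∫_X f_ε ω_t^n`, so that `J_{χ_ε} - J_χ = ∫_X f_ε ω_1^n - ∫_X f_ε ω_0^n`, whatever the path. The
first term is nonnegative, and the second is at most `∫_X f_1 ω_0^n`, since `f_ε` increases with `ε`
(`neg_integral_le_integral_logDefect`); this integral is finite because the singularity of `f_1`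
is logarithmic. So `C₃ = ∫_X f_1 ω_0^n + 1` will do.

The Poincaré–Lelong equation is reduced by a smooth partition of unity to test functions supported
in one chart. All forms involved have local potentials there, and the divisor is empty or a
coordinate hyperplane `w_{j₀} = 0` (`exists_adaptedChart`), off which `f_ε` is the difference of a
smooth potential of `χ_ε` and `log |w_{j₀}|²`. For a potential `P` of `ω`, the form
`(√-1 ∂∂̄ P)^{n-1}` has the adjugate of the complex Hessian of `P` as coefficients. Their
divergences vanish (`sum_dz_adjugate`), so integration by parts on `ℂⁿ` moves the derivatives off
the test function (`integral_mul_trace_complexHessian`), and the logarithm contributes the integral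
of a principal minor over the hyperplane (`integral_log_mul_trace_complexHessian`), as the limit of
the contributions of `log (|w_{j₀}|² + δ)`.

The passage between integrals over the manifolds and over `ℂⁿ` is the change of variables
`integral_topForm_eq_setIntegral`: it applies to any injective holomorphic map to `ℂⁿ` on an open
set, in particular to charts outside the given atlas, and to the coordinates that an adapted chart
induces on the divisor.
-/

namespace TwistedEnergy

open Filter Topology MeasureTheory

open scoped ComplexConjugate

/-! ### Smoothness of holomorphic functions of several variables -/

section Holomorphic

variable {E : Type*} [NormedAddCommGroup E] [NormedSpace ℂ E]

/-- Cauchy's estimate, applied on the complex line through `w` in each direction. -/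
lemma norm_fderiv_le_of_ball {f : E → ℂ} {w : E} {δ M : ℝ} (hδ : 0 < δ)
    (hd : DifferentiableOn ℂ f (Metric.ball w (2 * δ)))
    (hM : ∀ x ∈ Metric.ball w (2 * δ), ‖f x‖ ≤ M) : ‖fderiv ℂ f w‖ ≤ M / δ := by
  have hM0 : 0 ≤ M := (norm_nonneg _).trans (hM w (Metric.mem_ball_self (by positivity)))
  refine ContinuousLinearMap.opNorm_le_bound _ (by positivity) fun u => ?_
  rcases eq_or_ne u 0 with rfl | hu
  · simp
  have hu' : 0 < ‖u‖ := norm_pos_iff.2 hu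
  have hmem : ∀ ζ ∈ Metric.closedBall (0 : ℂ) (δ / ‖u‖), w + ζ • u ∈ Metric.ball w (2 * δ) := by
    intro ζ hζ
    rw [mem_closedBall_zero_iff, le_div_iff₀ hu'] at hζ
    simp only [Metric.mem_ball, dist_self_add_left, norm_smul]
    linarith
  have hg : ∀ ζ ∈ Metric.closedBall (0 : ℂ) (δ / ‖u‖),
      DifferentiableAt ℂ (fun ζ : ℂ => f (w + ζ • u)) ζ := by
    intro ζ hζ
    have h1 := hd.differentiableAt (Metric.isOpen_ball.mem_nhds (hmem ζ hζ))
    exact h1.comp ζ (by fun_prop)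
  have hr : 0 < δ / ‖u‖ := by positivity
  have h2 : ‖deriv (fun ζ : ℂ => f (w + ζ • u)) 0‖ ≤ M / (δ / ‖u‖) := by
    refine Complex.norm_deriv_le_of_forall_mem_sphere_norm_le hr ?_ ?_
    · refine ⟨fun ζ hζ => (hg ζ (Metric.ball_subset_closedBall hζ)).differentiableWithinAt, ?_⟩
      intro ζ hζ
      exact (hg ζ (Metric.closure_ball_subset_closedBall hζ)).continuousAt.continuousWithinAt
    · intro ζ hζ
      exact hM _ (hmem ζ (Metric.sphere_subset_closedBall hζ))
  have h3 : deriv (fun ζ : ℂ => f (w + ζ • u)) 0 = fderiv ℂ f w u := by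
    have h4 : HasFDerivAt f (fderiv ℂ f w) (w + (0 : ℂ) • u) := by
      simpa using (hd.differentiableAt (Metric.isOpen_ball.mem_nhds
        (Metric.mem_ball_self (by positivity)))).hasFDerivAt
    have h5 : HasDerivAt (fun ζ : ℂ => w + ζ • u) u 0 := by
      simpa using ((hasDerivAt_id (0 : ℂ)).smul_const u).const_add w
    exact (h4.comp_hasDerivAt 0 h5).deriv
  rw [h3] at h2
  calc _ ≤ _ := h2
    _ = _ := by field_simp

/-- A directional derivative of a holomorphic function is holomorphic: differentiate Cauchy's
formula `∂_v f(w) = (2πi)⁻¹ ∮ ζ⁻² f(w + ζ v) dζ` under the integral sign. -/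
lemma differentiableAt_fderiv_apply [FiniteDimensional ℂ E] {f : E → ℂ} {U : Set E}
    (hU : IsOpen U) (hf : DifferentiableOn ℂ f U) {z : E} (hz : z ∈ U) (v : E) :
    DifferentiableAt ℂ (fun w => fderiv ℂ f w v) z := by
  obtain ⟨δ, hδ, M, hball, hM⟩ : ∃ δ > 0, ∃ M : ℝ, Metric.ball z (4 * δ) ⊆ U ∧
      ∀ x ∈ Metric.ball z (4 * δ), ‖f x‖ ≤ M := by
    have hc : ContinuousAt f z := (hf.differentiableAt (hU.mem_nhds hz)).continuousAt
    have h1 : ∀ᶠ x in 𝓝 z, x ∈ U ∧ ‖f x‖ < ‖f z‖ + 1 :=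
      (hU.eventually_mem hz).and (hc.norm.eventually_lt continuousAt_const (by simp))
    obtain ⟨r, hr, h2⟩ := Metric.eventually_nhds_iff_ball.1 h1
    refine ⟨r / 4, by positivity, ‖f z‖ + 1, fun x hx => (h2 x ?_).1, fun x hx => (h2 x ?_).2.le⟩
    all_goals simpa [mul_div_cancel₀] using hx
  obtain ⟨r, hr, hrv⟩ : ∃ r > 0, r * ‖v‖ ≤ δ := by
    refine ⟨δ / (‖v‖ + 1), by positivity, ?_⟩
    rw [div_mul_eq_mul_div, div_le_iff₀ (by positivity)]
    nlinarith [norm_nonneg v]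
  have hmem : ∀ w ∈ Metric.ball z δ, ∀ ζ ∈ Metric.closedBall (0 : ℂ) r,
      w + ζ • v ∈ Metric.ball z (2 * δ) := by
    intro w hw ζ hζ
    rw [mem_closedBall_zero_iff] at hζ
    rw [Metric.mem_ball, dist_eq_norm] at *
    calc ‖w + ζ • v - z‖ = ‖(w - z) + ζ • v‖ := by congr 1; abel
      _ ≤ ‖w - z‖ + ‖ζ‖ * ‖v‖ := (norm_add_le _ _).trans_eq (by rw [norm_smul])
      _ < 2 * δ := by nlinarith [norm_nonneg v]
  have hdiff : ∀ x ∈ Metric.ball z (4 * δ), DifferentiableAt ℂ f x := fun x hx =>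
    (hf.mono hball).differentiableAt (Metric.isOpen_ball.mem_nhds hx)
  have hbd : ∀ x ∈ Metric.ball z (2 * δ), ‖fderiv ℂ f x‖ ≤ M / δ := by
    intro x hx
    have hsub : Metric.ball x (2 * δ) ⊆ Metric.ball z (4 * δ) :=
      Metric.ball_subset_ball' (by rw [Metric.mem_ball] at hx; linarith)
    exact norm_fderiv_le_of_ball hδ (fun y hy => (hdiff y (hsub hy)).differentiableWithinAt)
      fun y hy => hM y (hsub hy)
  have h24 : Metric.ball z (2 * δ) ⊆ Metric.ball z (4 * δ) :=
    Metric.ball_subset_ball (by linarith)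
  -- Cauchy's formula on the circle of radius `r` in the complex line through `w` along `v`
  have key : ∀ w ∈ Metric.ball z δ, fderiv ℂ f w v =
      (2 * Real.pi * Complex.I : ℂ)⁻¹ • ∫ θ in (0 : ℝ)..(2 * Real.pi),
        deriv (circleMap 0 r) θ • ((circleMap 0 r θ ^ 2)⁻¹ • f (w + circleMap 0 r θ • v)) := by
    intro w hw
    have hV : ∀ ζ ∈ Metric.closedBall (0 : ℂ) r, DifferentiableAt ℂ
        (fun ζ : ℂ => f (w + ζ • v)) ζ := fun ζ hζ =>
      (hdiff _ (h24 (hmem w hw ζ hζ))).comp ζ (by fun_prop)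
    have hop : IsOpen {ζ : ℂ | w + ζ • v ∈ Metric.ball z (4 * δ)} :=
      Metric.isOpen_ball.preimage (by fun_prop)
    have h1 := Complex.cderiv_eq_deriv (f := fun ζ : ℂ => f (w + ζ • v)) (z := 0) hop
      (fun ζ hζ => ((hdiff _ hζ).comp ζ (by fun_prop)).differentiableWithinAt) hr
      (fun ζ hζ => h24 (hmem w hw ζ hζ))
    have h3 : deriv (fun ζ : ℂ => f (w + ζ • v)) 0 = fderiv ℂ f w v := by
      have hw' : w ∈ Metric.ball z (4 * δ) := Metric.ball_subset_ball (by linarith) hw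
      have h4 : HasFDerivAt f (fderiv ℂ f w) (w + (0 : ℂ) • v) := by
        simpa using (hdiff w hw').hasFDerivAt
      have h5 : HasDerivAt (fun ζ : ℂ => w + ζ • v) v 0 := by
        simpa using ((hasDerivAt_id (0 : ℂ)).smul_const v).const_add w
      exact (h4.comp_hasDerivAt 0 h5).deriv
    rw [← h3, ← h1, Complex.cderiv, circleIntegral]
    simp
  have hev : (fun w => fderiv ℂ f w v) =ᶠ[𝓝 z] fun w =>
      (2 * Real.pi * Complex.I : ℂ)⁻¹ • ∫ θ in (0 : ℝ)..(2 * Real.pi),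
        deriv (circleMap 0 r) θ • ((circleMap 0 r θ ^ 2)⁻¹ • f (w + circleMap 0 r θ • v)) := by
    filter_upwards [Metric.ball_mem_nhds z hδ] with w hw using key w hw
  refine DifferentiableAt.congr_of_eventuallyEq ?_ hev
  refine DifferentiableAt.fun_const_smul ?_ _
  have hcm : ∀ θ, circleMap 0 r θ ∈ Metric.closedBall (0 : ℂ) r := fun θ =>
    circleMap_mem_closedBall 0 hr.le θ
  have hne : ∀ θ, circleMap 0 r θ ^ 2 ≠ 0 := fun θ =>
    pow_ne_zero _ (circleMap_ne_center hr.ne')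
  have hcont : ∀ w ∈ Metric.ball z δ, Continuous fun θ =>
      deriv (circleMap 0 r) θ • ((circleMap 0 r θ ^ 2)⁻¹ • f (w + circleMap 0 r θ • v)) := by
    intro w hw
    have h1 : Continuous fun θ => f (w + circleMap 0 r θ • v) := by
      refine continuous_iff_continuousAt.2 fun θ => ?_
      exact ContinuousAt.comp (f := fun θ => w + circleMap 0 r θ • v)
        (hdiff _ (h24 (hmem w hw _ (hcm θ)))).continuousAt
        (by have := (continuous_circleMap 0 r).continuousAt (x := θ); fun_prop)
    simp only [deriv_circleMap]
    have h2 := continuous_circleMap 0 r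
    exact (h2.mul continuous_const).smul (((h2.pow 2).inv₀ hne).smul h1)
  let _ : MeasurableSpace E := borel E
  have : BorelSpace E := ⟨rfl⟩
  have h := intervalIntegral.hasFDerivAt_integral_of_dominated_of_fderiv_le (𝕜 := ℂ)
    (μ := volume) (a := 0) (b := 2 * Real.pi)
    (F := fun w θ => deriv (circleMap 0 r) θ •
      ((circleMap 0 r θ ^ 2)⁻¹ • f (w + circleMap 0 r θ • v)))
    (F' := fun w θ => deriv (circleMap 0 r) θ •
      ((circleMap 0 r θ ^ 2)⁻¹ • fderiv ℂ f (w + circleMap 0 r θ • v)))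
    (x₀ := z) (s := Metric.ball z δ) (bound := fun _ => r * ((r ^ 2)⁻¹ * (M / δ)))
    (Metric.ball_mem_nhds z hδ) ?_ ?_ ?_ ?_ ?_ ?_
  · exact h.differentiableAt
  · filter_upwards [Metric.ball_mem_nhds z hδ] with w hw
    exact (hcont w hw).aestronglyMeasurable
  · exact (hcont z (Metric.mem_ball_self hδ)).intervalIntegrable _ _
  · have h2 := continuous_circleMap 0 r
    have h1 : StronglyMeasurable fun θ : ℝ => fderiv ℂ f (z + circleMap 0 r θ • v) :=
      (measurable_fderiv ℂ f).stronglyMeasurable.comp_measurable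
        (Continuous.measurable (by fun_prop))
    simp only [deriv_circleMap]
    exact ((h2.mul continuous_const).stronglyMeasurable.smul
      (((h2.pow 2).inv₀ hne).stronglyMeasurable.smul h1)).aestronglyMeasurable
  · refine Eventually.of_forall fun θ _ w hw => ?_
    rw [norm_smul, norm_smul, norm_inv, norm_pow, deriv_circleMap, norm_mul, Complex.norm_I,
      norm_circleMap_zero, abs_of_pos hr, mul_one]
    gcongr
    exact hbd _ (hmem w hw _ (hcm θ))
  · exact intervalIntegrable_const
  · refine Eventually.of_forall fun θ _ w hw => ?_
    refine HasFDerivAt.fun_const_smul (HasFDerivAt.fun_const_smul ?_ _) _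
    have h1 := (hdiff _ (h24 (hmem w hw _ (hcm θ)))).hasFDerivAt
    simpa [Function.comp_def] using h1.comp w ((hasFDerivAt_id w).add_const _)

/-- A holomorphic function of several variables is smooth. -/
lemma contDiffOn_of_differentiableOn [FiniteDimensional ℂ E] {f : E → ℂ} {U : Set E}
    (hU : IsOpen U) (hf : DifferentiableOn ℂ f U) : ContDiffOn ℂ ∞ f U := by
  rw [contDiffOn_infty]
  intro k
  induction k generalizing f with
  | zero => exact contDiffOn_zero.2 hf.continuousOn
  | succ k ih =>
    rw [Nat.cast_succ, contDiffOn_succ_iff_fderiv_of_isOpen hU]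
    refine ⟨hf, by simp, ?_⟩
    rw [contDiffOn_clm_apply]
    intro v
    exact ih fun z hz => (differentiableAt_fderiv_apply hU hf hz v).differentiableWithinAt

end Holomorphic

/-! ### Wirtinger calculus -/

section Wirtinger

variable {m n : ℕ} {f g : Cn n → ℂ} {z : Cn n} {j k : Fin n}

lemma dz_congr (h : f =ᶠ[𝓝 z] g) : dz j f z = dz j g z := by simp [dz, h.fderiv_eq]

lemma dzbar_congr (h : f =ᶠ[𝓝 z] g) : dzbar j f z = dzbar j g z := by simp [dzbar, h.fderiv_eq]

lemma dzbar_eventuallyEq (h : f =ᶠ[𝓝 z] g) : dzbar j f =ᶠ[𝓝 z] dzbar j g :=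
  h.eventuallyEq_nhds.mono fun _ hw => dzbar_congr hw

lemma apply_eq_sum_wirtinger (L : Cn n →L[ℝ] ℂ) (v : Cn n) :
    L v = ∑ a, ((1 / 2) * (L (Pi.single a 1) - Complex.I * L (Pi.single a Complex.I)) * v a +
      (1 / 2) * (L (Pi.single a 1) + Complex.I * L (Pi.single a Complex.I)) * conj (v a)) := by
  have h1 : ∀ (a : Fin n) (c : ℂ), (Pi.single a c : Cn n) =
      c.re • (Pi.single a 1 : Cn n) + c.im • (Pi.single a Complex.I : Cn n) := by
    intro a c
    rw [← Pi.single_smul, ← Pi.single_smul, ← Pi.single_add]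
    congr 1
    simp [Complex.re_add_im]
  conv_lhs => rw [← Finset.univ_sum_single v, map_sum]
  refine Finset.sum_congr rfl fun a _ => ?_
  rw [h1 a (v a), map_add, map_smul, map_smul, Complex.real_smul, Complex.real_smul]
  have h2 := Complex.re_add_im (v a)
  have h3 : conj (v a) = (v a).re - (v a).im * Complex.I := by
    conv_lhs => rw [← h2]
    simp only [map_add, map_mul, Complex.conj_ofReal, Complex.conj_I]
    ring
  rw [h3]
  conv_rhs => enter [1, 2]; rw [← h2]
  linear_combination ((v a).im * L (Pi.single a Complex.I)) * Complex.I_sq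

lemma fderiv_eq_sum_wirtinger (f : Cn n → ℂ) (z v : Cn n) :
    fderiv ℝ f z v = ∑ a, (dz a f z * v a + dzbar a f z * conj (v a)) :=
  apply_eq_sum_wirtinger _ _

lemma dz_add (hf : DifferentiableAt ℝ f z) (hg : DifferentiableAt ℝ g z) :
    dz j (fun w => f w + g w) z = dz j f z + dz j g z := by
  simp only [dz, fderiv_fun_add hf hg, _root_.add_apply]; ring

lemma dzbar_add (hf : DifferentiableAt ℝ f z) (hg : DifferentiableAt ℝ g z) :
    dzbar j (fun w => f w + g w) z = dzbar j f z + dzbar j g z := by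
  simp only [dzbar, fderiv_fun_add hf hg, _root_.add_apply]; ring

lemma dz_neg : dz j (fun w => -f w) z = -dz j f z := by
  simp only [dz, fderiv_fun_neg, _root_.neg_apply]; ring

lemma dzbar_neg : dzbar j (fun w => -f w) z = -dzbar j f z := by
  simp only [dzbar, fderiv_fun_neg, _root_.neg_apply]; ring

lemma dz_mul (hf : DifferentiableAt ℝ f z) (hg : DifferentiableAt ℝ g z) :
    dz j (fun w => f w * g w) z = dz j f z * g z + f z * dz j g z := by
  simp only [dz, fderiv_fun_mul hf hg, _root_.add_apply,
    _root_.smul_apply, smul_eq_mul]; ring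

lemma dzbar_mul (hf : DifferentiableAt ℝ f z) (hg : DifferentiableAt ℝ g z) :
    dzbar j (fun w => f w * g w) z = dzbar j f z * g z + f z * dzbar j g z := by
  simp only [dzbar, fderiv_fun_mul hf hg, _root_.add_apply,
    _root_.smul_apply, smul_eq_mul]; ring

lemma dz_sum {ι : Type*} {s : Finset ι} {f : ι → Cn n → ℂ}
    (hf : ∀ i ∈ s, DifferentiableAt ℝ (f i) z) :
    dz j (fun w => ∑ i ∈ s, f i w) z = ∑ i ∈ s, dz j (f i) z := by
  simp only [dz, fderiv_fun_sum hf, _root_.sum_apply, Finset.mul_sum,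
    ← Finset.sum_sub_distrib, mul_sub]

lemma fderiv_conj_apply (f : Cn n → ℂ) (z v : Cn n) :
    fderiv ℝ (fun w => conj (f w)) z v = conj (fderiv ℝ f z v) := by
  have := Complex.conjCLE.comp_fderiv (f := f) (x := z)
  have h2 : (⇑Complex.conjCLE ∘ f) = fun w => conj (f w) := by ext; simp
  rw [h2] at this
  rw [this]
  simp

lemma dz_conj (f : Cn n → ℂ) (z : Cn n) : dz j (fun w => conj (f w)) z = conj (dzbar j f z) := by
  simp only [dz, dzbar, fderiv_conj_apply, map_mul, map_add, Complex.conj_I, map_div₀, map_one,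
    map_ofNat]
  ring

lemma dzbar_conj (f : Cn n → ℂ) (z : Cn n) : dzbar j (fun w => conj (f w)) z = conj (dz j f z) := by
  simp only [dz, dzbar, fderiv_conj_apply, map_mul, map_sub, Complex.conj_I, map_div₀, map_one,
    map_ofNat]
  ring

lemma single_I (j : Fin n) : (Pi.single j Complex.I : Cn n) = Complex.I • Pi.single j 1 := by
  rw [← Pi.single_smul]; simp

lemma fderiv_real_apply (hf : DifferentiableAt ℂ f z) (v : Cn n) :
    fderiv ℝ f z v = fderiv ℂ f z v := by
  rw [hf.fderiv_restrictScalars ℝ]; rfl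

lemma dzbar_of_holomorphic (hf : DifferentiableAt ℂ f z) : dzbar j f z = 0 := by
  simp only [dzbar, fderiv_real_apply hf, single_I, map_smul, smul_eq_mul, ← mul_assoc,
    Complex.I_mul_I]
  ring

lemma dz_of_holomorphic (hf : DifferentiableAt ℂ f z) :
    dz j f z = fderiv ℂ f z (Pi.single j 1) := by
  simp only [dz, fderiv_real_apply hf, single_I, map_smul, smul_eq_mul, ← mul_assoc,
    Complex.I_mul_I]
  ring

lemma fderiv_comp_holomorphic {F : Cn m → Cn n} {z : Cn m} (hF : DifferentiableAt ℂ F z)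
    (hf : DifferentiableAt ℝ f (F z)) (v : Cn m) :
    fderiv ℝ (fun w => f (F w)) z v = fderiv ℝ f (F z) (fderiv ℂ F z v) := by
  have h1 : HasFDerivAt F ((fderiv ℂ F z).restrictScalars ℝ) z :=
    hF.hasFDerivAt.restrictScalars ℝ
  have h2 := (hf.hasFDerivAt.comp z h1).fderiv
  have h3 : (fun w => f (F w)) = f ∘ F := rfl
  rw [h3, h2]; rfl

lemma dz_comp_holomorphic {F : Cn m → Cn n} {z : Cn m} (hF : DifferentiableAt ℂ F z)
    (hf : DifferentiableAt ℝ f (F z)) (j : Fin m) :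
    dz j (fun w => f (F w)) z = ∑ a, dz a f (F z) * holJacobian F z a j := by
  rw [dz]
  simp only [fderiv_comp_holomorphic hF hf, single_I, map_smul, fderiv_eq_sum_wirtinger,
    holJacobian, Matrix.of_apply, Pi.smul_apply, smul_eq_mul, map_mul, Complex.conj_I,
    Finset.mul_sum, ← Finset.sum_sub_distrib]
  refine Finset.sum_congr rfl fun a _ => ?_
  linear_combination (-(1 / 2) * dz a f (F z) * fderiv ℂ F z (Pi.single j 1) a +
    (1 / 2) * dzbar a f (F z) * conj (fderiv ℂ F z (Pi.single j 1) a)) * Complex.I_sq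

lemma dzbar_comp_holomorphic {F : Cn m → Cn n} {z : Cn m} (hF : DifferentiableAt ℂ F z)
    (hf : DifferentiableAt ℝ f (F z)) (j : Fin m) :
    dzbar j (fun w => f (F w)) z = ∑ a, dzbar a f (F z) * conj (holJacobian F z a j) := by
  rw [dzbar]
  simp only [fderiv_comp_holomorphic hF hf, single_I, map_smul, fderiv_eq_sum_wirtinger,
    holJacobian, Matrix.of_apply, Pi.smul_apply, smul_eq_mul, map_mul, Complex.conj_I,
    Finset.mul_sum, ← Finset.sum_add_distrib]
  refine Finset.sum_congr rfl fun a _ => ?_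
  linear_combination ((1 / 2) * dz a f (F z) * fderiv ℂ F z (Pi.single j 1) a -
    (1 / 2) * dzbar a f (F z) * conj (fderiv ℂ F z (Pi.single j 1) a)) * Complex.I_sq

lemma contDiffAt_fderiv_apply (hf : ContDiffAt ℝ ∞ f z) (v : Cn n) :
    ContDiffAt ℝ ∞ (fun w => fderiv ℝ f w v) z :=
  (hf.fderiv_right (m := ∞) (by simp)).clm_apply contDiffAt_const

lemma contDiffAt_dz (hf : ContDiffAt ℝ ∞ f z) : ContDiffAt ℝ ∞ (dz j f) z :=
  contDiffAt_const.mul ((contDiffAt_fderiv_apply hf _).sub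
    (contDiffAt_const.mul (contDiffAt_fderiv_apply hf _)))

lemma contDiffAt_dzbar (hf : ContDiffAt ℝ ∞ f z) : ContDiffAt ℝ ∞ (dzbar j f) z :=
  contDiffAt_const.mul ((contDiffAt_fderiv_apply hf _).add
    (contDiffAt_const.mul (contDiffAt_fderiv_apply hf _)))

lemma fderiv_fderiv_comm (hf : ContDiffAt ℝ ∞ f z) (u v : Cn n) :
    fderiv ℝ (fun w => fderiv ℝ f w u) z v = fderiv ℝ (fun w => fderiv ℝ f w v) z u := by
  have h1 : DifferentiableAt ℝ (fderiv ℝ f) z :=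
    (hf.fderiv_right (m := ∞) (by simp)).differentiableAt (by simp)
  have h2 : IsSymmSndFDerivAt ℝ f z := hf.isSymmSndFDerivAt (by simpa using ENat.LEInfty.out)
  have h3 : ∀ u v, fderiv ℝ (fun w => fderiv ℝ f w u) z v = fderiv ℝ (fderiv ℝ f) z v u := by
    intro u v
    rw [fderiv_clm_apply h1 (differentiableAt_const u)]
    simp
  rw [h3, h3, h2.eq]

lemma differentiableAt_fderiv_real_apply (hf : ContDiffAt ℝ ∞ f z) (v : Cn n) :
    DifferentiableAt ℝ (fun w => fderiv ℝ f w v) z :=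
  (contDiffAt_fderiv_apply hf v).differentiableAt (by simp)

lemma fderiv_dz (hf : ContDiffAt ℝ ∞ f z) (v : Cn n) :
    fderiv ℝ (dz j f) z v = (1 / 2) * (fderiv ℝ (fun w => fderiv ℝ f w (Pi.single j 1)) z v -
      Complex.I * fderiv ℝ (fun w => fderiv ℝ f w (Pi.single j Complex.I)) z v) := by
  have h1 := differentiableAt_fderiv_real_apply hf (Pi.single j 1)
  have h2 := differentiableAt_fderiv_real_apply hf (Pi.single j Complex.I)
  unfold dz
  rw [fderiv_const_mul (h1.fun_sub (h2.const_mul _)), fderiv_fun_sub h1 (h2.const_mul _),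
    fderiv_const_mul h2]
  simp

lemma fderiv_dzbar (hf : ContDiffAt ℝ ∞ f z) (v : Cn n) :
    fderiv ℝ (dzbar j f) z v = (1 / 2) * (fderiv ℝ (fun w => fderiv ℝ f w (Pi.single j 1)) z v +
      Complex.I * fderiv ℝ (fun w => fderiv ℝ f w (Pi.single j Complex.I)) z v) := by
  have h1 := differentiableAt_fderiv_real_apply hf (Pi.single j 1)
  have h2 := differentiableAt_fderiv_real_apply hf (Pi.single j Complex.I)
  unfold dzbar
  rw [fderiv_const_mul (h1.fun_add (h2.const_mul _)), fderiv_fun_add h1 (h2.const_mul _),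
    fderiv_const_mul h2]
  simp only [smul_apply, add_apply, smul_eq_mul]

lemma dz_dz_comm (hf : ContDiffAt ℝ ∞ f z) : dz j (dz k f) z = dz k (dz j f) z := by
  rw [dz, dz, fderiv_dz hf, fderiv_dz hf, fderiv_dz hf, fderiv_dz hf,
    fderiv_fderiv_comm hf (Pi.single k 1) (Pi.single j 1),
    fderiv_fderiv_comm hf (Pi.single k 1) (Pi.single j Complex.I),
    fderiv_fderiv_comm hf (Pi.single k Complex.I) (Pi.single j 1),
    fderiv_fderiv_comm hf (Pi.single k Complex.I) (Pi.single j Complex.I)]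
  ring

lemma dz_dzbar_comm (hf : ContDiffAt ℝ ∞ f z) : dz j (dzbar k f) z = dzbar k (dz j f) z := by
  rw [dz, dzbar, fderiv_dz hf, fderiv_dz hf, fderiv_dzbar hf, fderiv_dzbar hf,
    fderiv_fderiv_comm hf (Pi.single k 1) (Pi.single j 1),
    fderiv_fderiv_comm hf (Pi.single k 1) (Pi.single j Complex.I),
    fderiv_fderiv_comm hf (Pi.single k Complex.I) (Pi.single j 1),
    fderiv_fderiv_comm hf (Pi.single k Complex.I) (Pi.single j Complex.I)]
  ring

end Wirtinger

/-! ### The complex Hessian -/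

section Hessian

variable {m n : ℕ} {u v : Cn n → ℝ} {z : Cn n}

lemma contDiffAt_ofReal_comp {E : Type*} [NormedAddCommGroup E] [NormedSpace ℝ E] {u : E → ℝ}
    {z : E} (hu : ContDiffAt ℝ ∞ u z) : ContDiffAt ℝ ∞ (fun w => (u w : ℂ)) z :=
  Complex.ofRealCLM.contDiff.contDiffAt.comp z hu

lemma complexHessian_apply (u : Cn n → ℝ) (z : Cn n) (j k : Fin n) :
    complexHessian u z j k = dz j (dzbar k fun v => (u v : ℂ)) z := rfl

lemma complexHessian_congr (h : u =ᶠ[𝓝 z] v) : complexHessian u z = complexHessian v z := by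
  ext j k
  exact dz_congr (dzbar_eventuallyEq (h.mono fun w hw => by simp [hw]))

lemma eventually_differentiableAt {𝕜 E F : Type*} [NontriviallyNormedField 𝕜]
    [NormedAddCommGroup E] [NormedSpace 𝕜 E] [NormedAddCommGroup F] [NormedSpace 𝕜 F] {f : E → F}
    {x : E} (hf : ContDiffAt 𝕜 ∞ f x) : ∀ᶠ y in 𝓝 x, DifferentiableAt 𝕜 f y :=
  ((hf.of_le (m := 1) (mod_cast le_top)).eventually (by simp)).mono
    fun _ hy => hy.differentiableAt (by simp)

lemma contDiffAt_complexHessian (hu : ContDiffAt ℝ ∞ u z) (j k : Fin n) :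
    ContDiffAt ℝ ∞ (fun w => complexHessian u w j k) z :=
  contDiffAt_dz (contDiffAt_dzbar (contDiffAt_ofReal_comp hu))

lemma complexHessian_add (hu : ContDiffAt ℝ ∞ u z) (hv : ContDiffAt ℝ ∞ v z) :
    complexHessian (fun w => u w + v w) z = complexHessian u z + complexHessian v z := by
  ext j k
  have hu' := contDiffAt_ofReal_comp hu
  have hv' := contDiffAt_ofReal_comp hv
  simp only [Matrix.add_apply, complexHessian_apply, Complex.ofReal_add]
  rw [← dz_add ((contDiffAt_dzbar hu').differentiableAt (by simp))
    ((contDiffAt_dzbar hv').differentiableAt (by simp))]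
  refine dz_congr ?_
  filter_upwards [eventually_differentiableAt hu', eventually_differentiableAt hv'] with w h1 h2
  exact dzbar_add h1 h2

lemma complexHessian_neg (u : Cn n → ℝ) (z : Cn n) :
    complexHessian (fun w => -u w) z = -complexHessian u z := by
  ext j k
  simp only [Matrix.neg_apply, complexHessian_apply, Complex.ofReal_neg]
  rw [← dz_neg]
  exact dz_congr (Eventually.of_forall fun w => dzbar_neg)

lemma complexHessian_const (c : ℝ) (z : Cn n) : complexHessian (fun _ => c) z = 0 := by
  ext j k
  have : dzbar k (fun _ : Cn n => (c : ℂ)) = fun _ => 0 := by ext w; simp [dzbar]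
  simp [complexHessian_apply, this, dz]

lemma complexHessian_sum {ι : Type*} (s : Finset ι) {u : ι → Cn n → ℝ}
    (hu : ∀ i ∈ s, ContDiffAt ℝ ∞ (u i) z) :
    complexHessian (fun w => ∑ i ∈ s, u i w) z = ∑ i ∈ s, complexHessian (u i) z := by
  classical
  induction s using Finset.induction_on with
  | empty => simp [complexHessian_const]
  | insert a s ha ih =>
    simp only [Finset.sum_insert ha]
    rw [complexHessian_add (hu a (by simp))
      (ContDiffAt.sum fun i hi => hu i (by simp [hi])), ih fun i hi => hu i (by simp [hi])]

lemma complexHessian_isHermitian (hu : ContDiffAt ℝ ∞ u z) : (complexHessian u z).IsHermitian := by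
  ext j k
  have h1 : (dzbar j fun v => (u v : ℂ)) = fun w => conj (dz j (fun v => (u v : ℂ)) w) := by
    ext w
    rw [← dzbar_conj]
    simp
  have h2 := contDiffAt_ofReal_comp hu
  rw [Matrix.conjTranspose_apply, complexHessian_apply, complexHessian_apply, h1, dz_conj,
    dz_dzbar_comm h2]
  simp

lemma differentiableAt_holJacobian {F : Cn m → Cn n} {z : Cn m} (hF : ContDiffAt ℂ ∞ F z)
    (a : Fin n) (j : Fin m) : DifferentiableAt ℂ (fun w => holJacobian F w a j) z := by
  have h1 : DifferentiableAt ℂ (fderiv ℂ F) z :=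
    (hF.fderiv_right (m := ∞) (by simp)).differentiableAt (by simp)
  have h2 := h1.clm_apply (differentiableAt_const (Pi.single j 1 : Cn m))
  exact differentiableAt_pi.1 h2 a

/-- The complex Hessian of a pull-back under a holomorphic map is the pull-back of the complex
Hessian. -/
lemma complexHessian_comp {F : Cn m → Cn n} {z : Cn m} (hF : ContDiffAt ℂ ∞ F z)
    (hu : ContDiffAt ℝ ∞ u (F z)) :
    complexHessian (fun w => u (F w)) z = (holJacobian F z)ᵀ * complexHessian u (F z) *
      (holJacobian F z).map (starRingEnd ℂ) := by
  ext j k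
  have hu' := contDiffAt_ofReal_comp hu
  have hd := fun b => (contDiffAt_dzbar (j := b) hu').differentiableAt (by simp)
  have hFz : DifferentiableAt ℂ F z := hF.differentiableAt (by simp)
  have hJ := fun b => differentiableAt_holJacobian hF b k
  have hJ' : ∀ b, DifferentiableAt ℝ (fun w => conj (holJacobian F w b k)) z := fun b =>
    Complex.conjCLE.differentiableAt.comp z ((hJ b).restrictScalars ℝ)
  have hd' : ∀ b, DifferentiableAt ℝ (fun w => dzbar b (fun v => (u v : ℂ)) (F w)) z := fun b =>
    (hd b).comp z (hFz.restrictScalars ℝ)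
  have h1 : dzbar k (fun w => (u (F w) : ℂ)) =ᶠ[𝓝 z] fun w =>
      ∑ b, dzbar b (fun v => (u v : ℂ)) (F w) * conj (holJacobian F w b k) := by
    filter_upwards [eventually_differentiableAt hF,
      hFz.continuousAt.eventually (eventually_differentiableAt hu')] with w h1 h2
    exact dzbar_comp_holomorphic h1 h2 k
  rw [complexHessian_apply, dz_congr h1, dz_sum fun b _ => (hd' b).fun_mul (hJ' b)]
  simp only [Matrix.mul_apply, Matrix.map_apply, Matrix.transpose_apply]
  refine Finset.sum_congr rfl fun b _ => ?_
  rw [dz_mul (hd' b) (hJ' b), dz_conj, dzbar_of_holomorphic (hJ b),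
    dz_comp_holomorphic (f := dzbar b fun v => (u v : ℂ)) hFz (hd b), map_zero, mul_zero, add_zero]
  congr 1
  exact Finset.sum_congr rfl fun a _ => mul_comm _ _

lemma fderiv_ofReal_log {r : Cn n → ℝ} (hr : DifferentiableAt ℝ r z) (h0 : r z ≠ 0) (v : Cn n) :
    fderiv ℝ (fun w => (Real.log (r w) : ℂ)) z v =
      (r z : ℂ)⁻¹ * fderiv ℝ (fun w => (r w : ℂ)) z v := by
  have h1 := (Complex.ofRealCLM.hasFDerivAt.comp z (hr.hasFDerivAt.log h0)).fderiv
  have h2 := (Complex.ofRealCLM.hasFDerivAt.comp z hr.hasFDerivAt).fderiv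
  have h3 : (fun w => (Real.log (r w) : ℂ)) = Complex.ofRealCLM ∘ fun w => Real.log (r w) := rfl
  have h4 : (fun w => (r w : ℂ)) = Complex.ofRealCLM ∘ r := rfl
  rw [h3, h4, h1, h2]
  simp

lemma dzbar_ofReal_log {r : Cn n → ℝ} (hr : DifferentiableAt ℝ r z) (h0 : r z ≠ 0) (k : Fin n) :
    dzbar k (fun w => (Real.log (r w) : ℂ)) z =
      (r z : ℂ)⁻¹ * dzbar k (fun w => (r w : ℂ)) z := by
  simp only [dzbar, fderiv_ofReal_log hr h0]; ring

lemma ofReal_norm_sq (c : ℂ) : ((‖c‖ ^ 2 : ℝ) : ℂ) = c * conj c := by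
  rw [Complex.mul_conj, Complex.normSq_eq_norm_sq]

/-- `log |s|²` is pluriharmonic where the holomorphic function `s` does not vanish, because
`∂̄ log |s|²` is the conjugate of `∂s / s`. -/
lemma complexHessian_log_norm_sq {s : Cn n → ℂ} (hs : ContDiffAt ℂ ∞ s z) (h0 : s z ≠ 0) :
    complexHessian (fun w => Real.log (‖s w‖ ^ 2)) z = 0 := by
  ext j k
  have hsz : DifferentiableAt ℂ s z := hs.differentiableAt (by simp)
  have h1 : DifferentiableAt ℂ (fun w => fderiv ℂ s w (Pi.single k 1)) z :=
    ((hs.fderiv_right (m := ∞) (by simp)).differentiableAt (by simp)).clm_apply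
      (differentiableAt_const _)
  have h2 : dzbar k (fun w => (Real.log (‖s w‖ ^ 2) : ℂ)) =ᶠ[𝓝 z] fun w =>
      conj (fderiv ℂ s w (Pi.single k 1) / s w) := by
    filter_upwards [eventually_differentiableAt hs, hsz.continuousAt.eventually_ne h0] with w hw hw0
    have hwr : DifferentiableAt ℝ s w := hw.restrictScalars ℝ
    have hwc : DifferentiableAt ℝ (fun w => conj (s w)) w :=
      Complex.conjCLE.differentiableAt.comp w hwr
    have hr : DifferentiableAt ℝ (fun w => ‖s w‖ ^ 2) w := hwr.norm_sq ℝ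
    rw [dzbar_ofReal_log hr (by simpa using hw0)]
    simp only [ofReal_norm_sq]
    rw [dzbar_mul hwr hwc, dzbar_of_holomorphic hw, dzbar_conj, dz_of_holomorphic hw, map_div₀]
    have : conj (s w) ≠ 0 := by simpa using hw0
    field_simp
    ring
  have h3 : DifferentiableAt ℂ (fun w => fderiv ℂ s w (Pi.single k 1) / s w) z := by
    simpa only [div_eq_mul_inv] using h1.fun_mul (hsz.fun_inv h0)
  rw [complexHessian_apply, dz_congr h2, dz_conj, dzbar_of_holomorphic h3]
  simp

end Hessian

/-! ### Algebra of the wedge product of `(1,1)`-forms -/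

section Wedge

variable {m n : ℕ}

lemma wedgeCoeff_eq_sum_det (A : Fin n → Matrix (Fin n) (Fin n) ℂ) :
    wedgeCoeff A = ∑ τ : Equiv.Perm (Fin n), ((Equiv.Perm.sign τ : ℤ) : ℂ) *
      (Matrix.of fun r i => A i r (τ i)).det := by
  rw [wedgeCoeff, Finset.sum_comm]
  refine Finset.sum_congr rfl fun τ _ => ?_
  rw [Matrix.det_apply', Finset.mul_sum]
  refine Finset.sum_congr rfl fun σ _ => ?_
  simp only [Matrix.of_apply]
  ring

lemma wedgeCoeff_mul_left (P : Matrix (Fin n) (Fin n) ℂ) (A : Fin n → Matrix (Fin n) (Fin n) ℂ) :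
    wedgeCoeff (fun i => P * A i) = P.det * wedgeCoeff A := by
  simp only [wedgeCoeff_eq_sum_det, Finset.mul_sum]
  refine Finset.sum_congr rfl fun τ _ => ?_
  have : (Matrix.of fun r i => (P * A i) r (τ i)) = P * Matrix.of fun r i => A i r (τ i) := by
    ext r i; simp [Matrix.mul_apply]
  rw [this, Matrix.det_mul]
  ring

lemma wedgeCoeff_transpose (A : Fin n → Matrix (Fin n) (Fin n) ℂ) :
    wedgeCoeff (fun i => (A i)ᵀ) = wedgeCoeff A := by
  rw [wedgeCoeff, wedgeCoeff, Finset.sum_comm]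
  refine Finset.sum_congr rfl fun τ _ => Finset.sum_congr rfl fun σ _ => ?_
  simp only [Matrix.transpose_apply]
  ring

lemma wedgeCoeff_mul_right (P : Matrix (Fin n) (Fin n) ℂ) (A : Fin n → Matrix (Fin n) (Fin n) ℂ) :
    wedgeCoeff (fun i => A i * P) = P.det * wedgeCoeff A := by
  rw [← wedgeCoeff_transpose]
  simp only [Matrix.transpose_mul]
  rw [wedgeCoeff_mul_left, Matrix.det_transpose, wedgeCoeff_transpose]

/-- A wedge product of `n` forms on `ℂⁿ` is multiplied by `|det J|²` under a linear change of
coordinates `J`. -/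
lemma wedgeCoeff_pullback (J : Matrix (Fin n) (Fin n) ℂ) (A : Fin n → Matrix (Fin n) (Fin n) ℂ) :
    wedgeCoeff (fun i => Jᵀ * A i * J.map (starRingEnd ℂ)) =
      ((‖J.det‖ ^ 2 : ℝ) : ℂ) * wedgeCoeff A := by
  have h : (J.map (starRingEnd ℂ)).det = conj J.det := ((starRingEnd ℂ).map_det J).symm
  rw [wedgeCoeff_mul_right (J.map (starRingEnd ℂ)) fun i => Jᵀ * A i, wedgeCoeff_mul_left,
    Matrix.det_transpose, h, ofReal_norm_sq]
  ring

lemma sign_mul_sign (τ : Equiv.Perm (Fin n)) :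
    ((Equiv.Perm.sign τ : ℤ) : ℂ) * ((Equiv.Perm.sign τ : ℤ) : ℂ) = 1 := by
  rw [← Int.cast_mul, Int.units_coe_mul_self, Int.cast_one]

lemma wedgeCoeff_const (B : Matrix (Fin n) (Fin n) ℂ) :
    wedgeCoeff (fun _ => B) = (n.factorial : ℂ) * B.det := by
  rw [wedgeCoeff_eq_sum_det]
  have : ∀ τ : Equiv.Perm (Fin n), ((Equiv.Perm.sign τ : ℤ) : ℂ) *
      (Matrix.of fun r i => B r (τ i)).det = B.det := by
    intro τ
    have h : (Matrix.of fun r i => B r (τ i)) = B.submatrix id τ := rfl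
    rw [h, Matrix.det_permute', ← mul_assoc, sign_mul_sign, one_mul]
  simp [this, Fintype.card_perm]

lemma sum_perm_apply_zero (φ : Fin (m + 1) → ℂ) :
    ∑ τ : Equiv.Perm (Fin (m + 1)), φ (τ 0) = (m.factorial : ℂ) * ∑ k, φ k := by
  rw [← Equiv.Perm.decomposeFin.symm.sum_comp, Fintype.sum_prod_type]
  simp [Fintype.card_perm, Finset.mul_sum]

/-- The coefficient of `α ∧ β^{n-1}`: the determinants in the expansion have one column from `A` and
the others from `B`, and are expanded along that column. -/
lemma wedgeCoeff_cons (A B : Matrix (Fin (m + 1)) (Fin (m + 1)) ℂ) :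
    wedgeCoeff (Fin.cons A fun _ : Fin m => B : Fin (m + 1) → _) =
      (m.factorial : ℂ) * (A * B.adjugate).trace := by
  rw [wedgeCoeff_eq_sum_det]
  have key : ∀ τ : Equiv.Perm (Fin (m + 1)), ((Equiv.Perm.sign τ : ℤ) : ℂ) *
      (Matrix.of fun r i => (Fin.cons A fun _ : Fin m => B : Fin (m + 1) → Matrix _ _ ℂ) i r
        (τ i)).det = (B.adjugate * A) (τ 0) (τ 0) := by
    intro τ
    have h : (Matrix.of fun r i => (Fin.cons A fun _ : Fin m => B : Fin (m + 1) → Matrix _ _ ℂ) i r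
        (τ i)) = (B.updateCol (τ 0) fun r => A r (τ 0)).submatrix id τ := by
      ext r i
      refine Fin.cases ?_ (fun i => ?_) i
      · simp
      · simp
    rw [h, Matrix.det_permute', ← mul_assoc, sign_mul_sign, one_mul, ← Matrix.cramer_apply,
      Matrix.cramer_eq_adjugate_mulVec]
    rfl
  simp only [key]
  rw [sum_perm_apply_zero fun k => (B.adjugate * A) k k, Matrix.trace_mul_comm]
  rfl

end Wedge

/-! ### Cofactors of the complex Hessian -/

section Cofactor

variable {n : ℕ} {z : Cn n}

lemma contDiffWithinAt_det {E : Type*} [NormedAddCommGroup E] [NormedSpace ℝ E] {s : Set E}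
    {B : E → Matrix (Fin n) (Fin n) ℂ} {x : E}
    (hB : ∀ j k, ContDiffWithinAt ℝ ∞ (fun w => B w j k) s x) :
    ContDiffWithinAt ℝ ∞ (fun w => (B w).det) s x := by
  simp only [Matrix.det_apply']
  exact ContDiffWithinAt.sum fun σ _ => contDiffWithinAt_const.mul
    (contDiffWithinAt_prod fun i _ => hB _ _)

lemma contDiffWithinAt_adjugate {E : Type*} [NormedAddCommGroup E] [NormedSpace ℝ E] {s : Set E}
    {B : E → Matrix (Fin n) (Fin n) ℂ} {x : E}
    (hB : ∀ j k, ContDiffWithinAt ℝ ∞ (fun w => B w j k) s x) (k j : Fin n) :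
    ContDiffWithinAt ℝ ∞ (fun w => (B w).adjugate k j) s x := by
  simp only [Matrix.adjugate_apply]
  refine contDiffWithinAt_det fun a b => ?_
  simp only [Matrix.updateRow_apply]
  split_ifs
  · exact contDiffWithinAt_const
  · exact hB _ _

/-- The Leibniz expansion of a cofactor: the permutations with `σ k = j`, with the factor of
column `k` left out. -/
lemma adjugate_eq_sum_perm (B : Matrix (Fin n) (Fin n) ℂ) (k j : Fin n) :
    B.adjugate k j = ∑ σ : Equiv.Perm (Fin n),
      (if σ k = j then ((Equiv.Perm.sign σ : ℤ) : ℂ) else 0) *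
        ∏ l ∈ Finset.univ.erase k, B (σ l) l := by
  have h : B.adjugate k j = (B.updateCol k (Pi.single j 1)).det := by
    rw [← Matrix.cramer_apply, Matrix.cramer_eq_adjugate_mulVec]
    simp
  rw [h, Matrix.det_apply']
  refine Finset.sum_congr rfl fun σ _ => ?_
  rw [← Finset.mul_prod_erase _ _ (Finset.mem_univ k), Matrix.updateCol_self, ← mul_assoc]
  congr 1
  · by_cases h : σ k = j <;> simp [h]
  · refine Finset.prod_congr rfl fun l hl => ?_
    rw [Matrix.updateCol_ne (Finset.ne_of_mem_erase hl)]

lemma dz_prod {ι : Type*} [DecidableEq ι] {s : Finset ι} {f : ι → Cn n → ℂ} {j : Fin n}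
    (hf : ∀ i ∈ s, DifferentiableAt ℝ (f i) z) :
    dz j (fun w => ∏ i ∈ s, f i w) z = ∑ i ∈ s, (∏ l ∈ s.erase i, f l z) * dz j (f i) z := by
  have h : fderiv ℝ (fun w => ∏ i ∈ s, f i w) z =
      ∑ i ∈ s, (∏ l ∈ s.erase i, f l z) • fderiv ℝ (f i) z := fderiv_finsetProd hf
  simp only [dz, h, _root_.sum_apply, smul_apply, smul_eq_mul, Finset.mul_sum,
    ← Finset.sum_sub_distrib]
  exact Finset.sum_congr rfl fun i _ => by ring

lemma dz_const_mul {f : Cn n → ℂ} {j : Fin n} (c : ℂ) (hf : DifferentiableAt ℝ f z) :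
    dz j (fun w => c * f w) z = c * dz j f z := by
  rw [dz_mul (differentiableAt_const c) hf]
  simp [dz]

/-- The cofactor matrix of a closed `(1,1)`-form is divergence free: expanded over permutations,
the divergence is antisymmetric under exchanging the direction of differentiation with the row
index of the differentiated entry. -/
lemma sum_dz_adjugate {B : Cn n → Matrix (Fin n) (Fin n) ℂ}
    (hB : ∀ j k, DifferentiableAt ℝ (fun w => B w j k) z)
    (hclosed : ∀ j k l, dz l (fun w => B w j k) z = dz j (fun w => B w l k) z) (k : Fin n) :
    ∑ j, dz j (fun w => (B w).adjugate k j) z = 0 := by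
  set T : Equiv.Perm (Fin n) → Fin n → ℂ := fun σ l =>
    ((Equiv.Perm.sign σ : ℤ) : ℂ) * ((∏ l' ∈ (Finset.univ.erase k).erase l, B z (σ l') l') *
      dz (σ k) (fun w => B w (σ l) l) z) with hT
  have h1 : ∀ j, dz j (fun w => (B w).adjugate k j) z = ∑ σ : Equiv.Perm (Fin n),
      if σ k = j then ∑ l ∈ Finset.univ.erase k, T σ l else 0 := by
    intro j
    simp only [adjugate_eq_sum_perm]
    have hp : ∀ σ : Equiv.Perm (Fin n), DifferentiableAt ℝ
        (fun w => ∏ l ∈ Finset.univ.erase k, B w (σ l) l) z := fun σ =>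
      (HasFDerivAt.finsetProd fun l _ => (hB (σ l) l).hasFDerivAt).differentiableAt
    rw [dz_sum fun σ _ => (hp σ).const_mul _]
    refine Finset.sum_congr rfl fun σ _ => ?_
    rw [dz_const_mul _ (hp σ), dz_prod fun l _ => hB _ _]
    split_ifs with h
    · rw [Finset.mul_sum, ← h]
    · simp
  simp only [h1]
  rw [Finset.sum_comm]
  simp only [Finset.sum_ite_eq, Finset.mem_univ, if_true]
  rw [Finset.sum_comm]
  refine Finset.sum_eq_zero fun l hl => ?_
  have hlk : k ≠ l := (Finset.ne_of_mem_erase hl).symm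
  -- `σ ↦ σ ∘ (k l)` exchanges `σ k` and `σ l`: by closedness only the sign changes
  have h2 : ∑ σ, T σ l = -∑ σ, T σ l := by
    rw [← Finset.sum_neg_distrib, ← Equiv.sum_comp (Equiv.mulRight (Equiv.swap k l))]
    refine Finset.sum_congr rfl fun σ _ => ?_
    simp only [hT, Equiv.coe_mulRight, Equiv.Perm.sign_mul, Equiv.Perm.sign_swap hlk,
      Equiv.Perm.mul_apply, Equiv.swap_apply_left, Equiv.swap_apply_right]
    have h3 : ∏ l' ∈ (Finset.univ.erase k).erase l, B z (σ (Equiv.swap k l l')) l' =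
        ∏ l' ∈ (Finset.univ.erase k).erase l, B z (σ l') l' := by
      refine Finset.prod_congr rfl fun l' hl' => ?_
      simp only [Finset.mem_erase] at hl'
      rw [Equiv.swap_apply_of_ne_of_ne hl'.2.1 hl'.1]
    rw [h3, hclosed (σ k) l (σ l)]
    push_cast
    ring
  linear_combination h2 / 2

variable {U : Set (Cn n)} {P u : Cn n → ℝ}

lemma contDiffAt_adjugate_complexHessian (hP : ContDiffAt ℝ ∞ P z) (k j : Fin n) :
    ContDiffAt ℝ ∞ (fun w => (complexHessian P w).adjugate k j) z :=
  contDiffWithinAt_univ.1 (contDiffWithinAt_adjugate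
    (fun a b => (contDiffAt_complexHessian hP a b).contDiffWithinAt) k j)

lemma sum_dz_adjugate_complexHessian (hP : ContDiffAt ℝ ∞ P z) (k : Fin n) :
    ∑ j, dz j (fun w => (complexHessian P w).adjugate k j) z = 0 :=
  sum_dz_adjugate (fun a b => (contDiffAt_complexHessian hP a b).differentiableAt (by simp))
    (fun _ _ _ => dz_dz_comm (contDiffAt_dzbar (contDiffAt_ofReal_comp hP))) k

/-- The conjugate of `sum_dz_adjugate_complexHessian`, the complex Hessian being Hermitian. -/
lemma sum_dzbar_adjugate_complexHessian (hU : IsOpen U) (hP : ContDiffOn ℝ ∞ P U) (hz : z ∈ U)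
    (j : Fin n) : ∑ k, dzbar k (fun w => (complexHessian P w).adjugate k j) z = 0 := by
  have h : ∀ k, dzbar k (fun w => (complexHessian P w).adjugate k j) z =
      conj (dz k (fun w => (complexHessian P w).adjugate j k) z) := by
    intro k
    rw [← dzbar_conj]
    refine dzbar_congr ?_
    filter_upwards [hU.mem_nhds hz] with w hw
    have h1 := (complexHessian_isHermitian (hP.contDiffAt (hU.mem_nhds hw))).eq
    conv_lhs => rw [← h1, ← Matrix.adjugate_conjTranspose]
    rfl
  simp only [h, ← map_sum, sum_dz_adjugate_complexHessian (hP.contDiffAt (hU.mem_nhds hz)),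
    map_zero]

/-- `√-1 ∂∂̄ u ∧ (√-1 ∂∂̄ P)^{n-1}` as a double divergence. -/
lemma sum_dz_dzbar_mul_adjugate (hU : IsOpen U) (hP : ContDiffOn ℝ ∞ P U)
    (hu : ContDiffOn ℝ ∞ u U) (hz : z ∈ U) :
    ∑ j, ∑ k, dz j (dzbar k fun w => (u w : ℂ) * (complexHessian P w).adjugate k j) z =
      (complexHessian u z * (complexHessian P z).adjugate).trace := by
  have hPw := fun w hw => hP.contDiffAt (x := w) (hU.mem_nhds hw)
  have huw := fun w hw => contDiffAt_ofReal_comp (hu.contDiffAt (x := w) (hU.mem_nhds hw))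
  have hA := fun w hw k j => contDiffAt_adjugate_complexHessian (hPw w hw) k j
  have hAd := fun w hw k j => (hA w hw k j).differentiableAt (by simp)
  have h1 : ∀ j, ∑ k, dz j (dzbar k fun w => (u w : ℂ) * (complexHessian P w).adjugate k j) z =
      dz j (fun w => ∑ k, dzbar k (fun w => (u w : ℂ)) w *
        (complexHessian P w).adjugate k j) z := by
    intro j
    rw [← dz_sum fun k _ =>
      (contDiffAt_dzbar ((huw z hz).mul (hA z hz k j))).differentiableAt (by simp)]
    refine dz_congr ?_
    filter_upwards [hU.mem_nhds hz] with w hw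
    have h2 : ∀ k, dzbar k (fun w => (u w : ℂ) * (complexHessian P w).adjugate k j) w =
        dzbar k (fun w => (u w : ℂ)) w * (complexHessian P w).adjugate k j +
          (u w : ℂ) * dzbar k (fun w => (complexHessian P w).adjugate k j) w := fun k =>
      dzbar_mul ((huw w hw).differentiableAt (by simp)) (hAd w hw k j)
    simp only [h2, Finset.sum_add_distrib, ← Finset.mul_sum,
      sum_dzbar_adjugate_complexHessian hU hP hw, mul_zero, add_zero]
  have hud := fun k => (contDiffAt_dzbar (j := k) (huw z hz)).differentiableAt (by simp)
  have h3 : ∀ j, dz j (fun w => ∑ k, dzbar k (fun w => (u w : ℂ)) w *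
      (complexHessian P w).adjugate k j) z = ∑ k, (complexHessian u z j k *
        (complexHessian P z).adjugate k j + dzbar k (fun w => (u w : ℂ)) z *
          dz j (fun w => (complexHessian P w).adjugate k j) z) := by
    intro j
    rw [dz_sum fun k _ => (hud k).fun_mul (hAd z hz k j)]
    exact Finset.sum_congr rfl fun k _ => dz_mul (hud k) (hAd z hz k j)
  simp only [h1, h3, Finset.sum_add_distrib]
  rw [Finset.sum_comm (f := fun j k => dzbar k (fun w => (u w : ℂ)) z *
          dz j (fun w => (complexHessian P w).adjugate k j) z)]
  simp only [← Finset.mul_sum, sum_dz_adjugate_complexHessian (hPw z hz), mul_zero,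
    Finset.sum_const_zero, add_zero, Matrix.trace, Matrix.diag, Matrix.mul_apply]

end Cofactor

/-! ### Integration by parts on open subsets of `ℂⁿ` -/

section TestFunctions

variable {n : ℕ} {U : Set (Cn n)} {a b : Cn n → ℂ}

/-- `b` is a smooth function on `ℂⁿ` with compact support contained in `U`. -/
structure IsTest (U : Set (Cn n)) (b : Cn n → ℂ) : Prop where
  smooth : ContDiff ℝ ∞ b
  compact : HasCompactSupport b
  support : tsupport b ⊆ U

lemma eventuallyEq_zero_of_notMem_tsupport {X M : Type*} [TopologicalSpace X] [Zero M] {b : X → M}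
    {z : X} (hz : z ∉ tsupport b) : b =ᶠ[𝓝 z] fun _ => 0 :=
  notMem_tsupport_iff_eventuallyEq.1 hz

lemma contDiff_of_contDiffOn_tsupport {E F : Type*} [NormedAddCommGroup E] [NormedSpace ℝ E]
    [NormedAddCommGroup F] [NormedSpace ℝ F] {U : Set E} {b : E → F} (hU : IsOpen U)
    (hb : ContDiffOn ℝ ∞ b U) (hs : tsupport b ⊆ U) : ContDiff ℝ ∞ b := by
  refine contDiff_iff_contDiffAt.2 fun z => ?_
  by_cases hz : z ∈ tsupport b
  · exact hb.contDiffAt (hU.mem_nhds (hs hz))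
  · exact contDiffAt_const.congr_of_eventuallyEq (eventuallyEq_zero_of_notMem_tsupport hz)

lemma dz_zero (j : Fin n) (z : Cn n) : dz j (fun _ => (0 : ℂ)) z = 0 := by simp [dz]

lemma dzbar_zero (j : Fin n) (z : Cn n) : dzbar j (fun _ => (0 : ℂ)) z = 0 := by simp [dzbar]

lemma tsupport_subset_of_eq_zero {X M N : Type*} [TopologicalSpace X] [Zero M] [Zero N] {b : X → M}
    {c : X → N} (h : ∀ z, z ∉ tsupport b → c z = 0) : tsupport c ⊆ tsupport b :=
  closure_minimal (fun z hz => by_contra fun hz' => hz (h z hz')) (isClosed_tsupport b)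

lemma IsTest.dz_eq_zero (j : Fin n) {z : Cn n} (hz : z ∉ tsupport b) : dz j b z = 0 := by
  rw [dz_congr (eventuallyEq_zero_of_notMem_tsupport hz), dz_zero]

lemma IsTest.dzbar_eq_zero (j : Fin n) {z : Cn n} (hz : z ∉ tsupport b) : dzbar j b z = 0 := by
  rw [dzbar_congr (eventuallyEq_zero_of_notMem_tsupport hz), dzbar_zero]

lemma IsTest.of_eq_zero {c : Cn n → ℂ} (hU : IsOpen U) (hb : IsTest U b)
    (hc : ContDiffOn ℝ ∞ c U) (h : ∀ z, z ∉ tsupport b → c z = 0) : IsTest U c :=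
  have hs := (tsupport_subset_of_eq_zero h)
  ⟨contDiff_of_contDiffOn_tsupport hU hc (hs.trans hb.support),
    hb.compact.of_isClosed_subset (isClosed_tsupport c) hs, hs.trans hb.support⟩

lemma contDiffOn_dz (hU : IsOpen U) (ha : ContDiffOn ℝ ∞ a U) (j : Fin n) :
    ContDiffOn ℝ ∞ (dz j a) U := fun _ hz =>
  (contDiffAt_dz (ha.contDiffAt (hU.mem_nhds hz))).contDiffWithinAt

lemma contDiffOn_dzbar (hU : IsOpen U) (ha : ContDiffOn ℝ ∞ a U) (j : Fin n) :
    ContDiffOn ℝ ∞ (dzbar j a) U := fun _ hz =>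
  (contDiffAt_dzbar (ha.contDiffAt (hU.mem_nhds hz))).contDiffWithinAt

lemma IsTest.dz (hU : IsOpen U) (hb : IsTest U b) (j : Fin n) : IsTest U (dz j b) :=
  hb.of_eq_zero hU (contDiffOn_dz hU hb.smooth.contDiffOn j) fun _ hz => IsTest.dz_eq_zero j hz

lemma IsTest.dzbar (hU : IsOpen U) (hb : IsTest U b) (j : Fin n) : IsTest U (dzbar j b) :=
  hb.of_eq_zero hU (contDiffOn_dzbar hU hb.smooth.contDiffOn j)
    fun _ hz => IsTest.dzbar_eq_zero j hz

lemma IsTest.mul_left (hU : IsOpen U) (hb : IsTest U b) (ha : ContDiffOn ℝ ∞ a U) :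
    IsTest U (fun z => a z * b z) :=
  hb.of_eq_zero hU (ha.mul hb.smooth.contDiffOn)
    fun _ hz => by rw [image_eq_zero_of_notMem_tsupport hz, mul_zero]

lemma IsTest.integrable (hb : IsTest U b) : Integrable b :=
  hb.smooth.continuous.integrable_of_hasCompactSupport hb.compact

lemma IsTest.integral_fderiv (hb : IsTest U b) (v : Cn n) : ∫ z, fderiv ℝ b z v = 0 := by
  have h1 : Integrable fun z => fderiv ℝ b z v := by
    refine Continuous.integrable_of_hasCompactSupport ?_ ?_
    · exact (hb.smooth.continuous_fderiv (by simp)).clm_apply continuous_const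
    · exact hb.compact.fderiv_apply ℝ v
  have h := integral_mul_fderiv_eq_neg_fderiv_mul_of_integrable (μ := volume)
    (f := fun _ : Cn n => (1 : ℂ)) (g := b) (v := v) (by simp) (by simpa using h1)
    (by simpa using hb.integrable) (fun _ _ => differentiableAt_const _)
    (fun _ _ => hb.smooth.differentiable (by simp) _)
  simpa using h

lemma IsTest.integrable_fderiv (hb : IsTest U b) (v : Cn n) :
    Integrable fun z => fderiv ℝ b z v :=
  ((hb.smooth.continuous_fderiv (by simp)).clm_apply
    continuous_const).integrable_of_hasCompactSupport (hb.compact.fderiv_apply ℝ v)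

lemma IsTest.integral_dz (hb : IsTest U b) (j : Fin n) : ∫ z, TwistedEnergy.dz j b z = 0 := by
  simp only [TwistedEnergy.dz]
  rw [integral_const_mul, integral_sub (hb.integrable_fderiv _)
    ((hb.integrable_fderiv _).const_mul _), integral_const_mul, hb.integral_fderiv,
    hb.integral_fderiv]
  simp

lemma IsTest.integral_dzbar (hb : IsTest U b) (j : Fin n) :
    ∫ z, TwistedEnergy.dzbar j b z = 0 := by
  simp only [TwistedEnergy.dzbar]
  rw [integral_const_mul, integral_add (hb.integrable_fderiv _)
    ((hb.integrable_fderiv _).const_mul _), integral_const_mul, hb.integral_fderiv,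
    hb.integral_fderiv]
  simp

lemma integral_mul_dz (hU : IsOpen U) (ha : ContDiffOn ℝ ∞ a U) (hb : IsTest U b) (j : Fin n) :
    ∫ z, a z * dz j b z = -∫ z, dz j a z * b z := by
  have h1 : ∀ z, dz j (fun w => a w * b w) z = dz j a z * b z + a z * dz j b z := by
    intro z
    by_cases hz : z ∈ tsupport b
    · exact dz_mul ((ha.contDiffAt (hU.mem_nhds (hb.support hz))).differentiableAt (by simp))
        (hb.smooth.differentiable (by simp) z)
    · rw [image_eq_zero_of_notMem_tsupport hz, IsTest.dz_eq_zero j hz]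
      have : (fun w => a w * b w) =ᶠ[𝓝 z] fun _ => 0 := by
        filter_upwards [eventuallyEq_zero_of_notMem_tsupport hz] with w hw
        rw [hw, mul_zero]
      rw [dz_congr this, dz_zero]
      simp
  have h2 := (hb.mul_left hU ha).integral_dz j
  simp only [h1] at h2
  rw [integral_add (hb.mul_left hU (contDiffOn_dz hU ha j)).integrable
    ((hb.dz hU j).mul_left hU ha).integrable] at h2
  linear_combination h2

lemma integral_mul_dzbar (hU : IsOpen U) (ha : ContDiffOn ℝ ∞ a U) (hb : IsTest U b)
    (j : Fin n) : ∫ z, a z * dzbar j b z = -∫ z, dzbar j a z * b z := by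
  have h1 : ∀ z, dzbar j (fun w => a w * b w) z = dzbar j a z * b z + a z * dzbar j b z := by
    intro z
    by_cases hz : z ∈ tsupport b
    · exact dzbar_mul ((ha.contDiffAt (hU.mem_nhds (hb.support hz))).differentiableAt (by simp))
        (hb.smooth.differentiable (by simp) z)
    · rw [image_eq_zero_of_notMem_tsupport hz, IsTest.dzbar_eq_zero j hz]
      have : (fun w => a w * b w) =ᶠ[𝓝 z] fun _ => 0 := by
        filter_upwards [eventuallyEq_zero_of_notMem_tsupport hz] with w hw
        rw [hw, mul_zero]
      rw [dzbar_congr this, dzbar_zero]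
      simp
  have h2 := (hb.mul_left hU ha).integral_dzbar j
  simp only [h1] at h2
  rw [integral_add (hb.mul_left hU (contDiffOn_dzbar hU ha j)).integrable
    ((hb.dzbar hU j).mul_left hU ha).integrable] at h2
  linear_combination h2

lemma integral_mul_dz_dzbar (hU : IsOpen U) (ha : ContDiffOn ℝ ∞ a U) (hb : IsTest U b)
    (j k : Fin n) : ∫ z, a z * dz j (dzbar k b) z = ∫ z, dz j (dzbar k a) z * b z := by
  rw [integral_mul_dz hU ha (hb.dzbar hU k), integral_mul_dzbar hU (contDiffOn_dz hU ha j) hb,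
    neg_neg]
  refine integral_congr_ae (Eventually.of_forall fun z => ?_)
  by_cases hz : z ∈ tsupport b
  · simp only [dz_dzbar_comm (ha.contDiffAt (hU.mem_nhds (hb.support hz)))]
  · simp [image_eq_zero_of_notMem_tsupport hz]

variable {P u α : Cn n → ℝ}

/-- The coefficients of the test form `u (√-1 ∂∂̄ P)^{n-1}`, up to a factorial. -/
lemma isTest_mul_adjugate (hU : IsOpen U) (hP : ContDiffOn ℝ ∞ P U)
    (hu : IsTest U fun z => (u z : ℂ)) (j k : Fin n) :
    IsTest U (fun w => (u w : ℂ) * (complexHessian P w).adjugate k j) := by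
  have h : ContDiffOn ℝ ∞ (fun w => (complexHessian P w).adjugate k j) U := fun w hw =>
    (contDiffAt_adjugate_complexHessian (hP.contDiffAt (hU.mem_nhds hw)) k j).contDiffWithinAt
  simpa only [mul_comm] using hu.mul_left hU h

lemma contDiff_of_ofReal {E : Type*} [NormedAddCommGroup E] [NormedSpace ℝ E] {u : E → ℝ}
    (hu : ContDiff ℝ ∞ fun z => (u z : ℂ)) : ContDiff ℝ ∞ u :=
  Complex.reCLM.contDiff.comp hu

lemma complexHessian_eq_zero {z : Cn n} (hz : z ∉ tsupport fun z => (u z : ℂ)) :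
    complexHessian u z = 0 := by
  rw [complexHessian_congr (v := fun _ => 0), complexHessian_const]
  filter_upwards [eventuallyEq_zero_of_notMem_tsupport hz] with w hw
  simpa using hw

lemma sum_dz_dzbar_mul_adjugate_of_isTest (hU : IsOpen U) (hP : ContDiffOn ℝ ∞ P U)
    (hu : IsTest U fun z => (u z : ℂ)) (z : Cn n) :
    ∑ j, ∑ k, dz j (dzbar k fun w => (u w : ℂ) * (complexHessian P w).adjugate k j) z =
      (complexHessian u z * (complexHessian P z).adjugate).trace := by
  by_cases hz : z ∈ tsupport fun z => (u z : ℂ)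
  · exact sum_dz_dzbar_mul_adjugate hU hP (contDiff_of_ofReal hu.smooth).contDiffOn (hu.support hz)
  · rw [complexHessian_eq_zero hz, zero_mul, Matrix.trace_zero]
    refine Finset.sum_eq_zero fun j _ => Finset.sum_eq_zero fun k _ => ?_
    have h : (fun w => (u w : ℂ) * (complexHessian P w).adjugate k j) =ᶠ[𝓝 z] fun _ => 0 := by
      filter_upwards [eventuallyEq_zero_of_notMem_tsupport hz] with w hw
      rw [hw, zero_mul]
    rw [dz_congr (dzbar_eventuallyEq h)]
    have : dzbar k (fun _ : Cn n => (0 : ℂ)) = fun _ => 0 := funext fun w => dzbar_zero k w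
    rw [this, dz_zero]

/-- Symmetry of `∫ α √-1∂∂̄u ∧ (√-1∂∂̄P)^{n-1}` in the smooth functions `α` and `u`. -/
lemma integral_mul_trace_complexHessian (hU : IsOpen U) (hP : ContDiffOn ℝ ∞ P U)
    (hα : ContDiffOn ℝ ∞ α U) (hu : IsTest U fun z => (u z : ℂ)) :
    ∫ z, (α z : ℂ) * (complexHessian u z * (complexHessian P z).adjugate).trace =
      ∫ z, (u z : ℂ) * (complexHessian α z * (complexHessian P z).adjugate).trace := by
  have hα' : ContDiffOn ℝ ∞ (fun z => (α z : ℂ)) U := fun z hz =>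
    (contDiffAt_ofReal_comp (hα.contDiffAt (hU.mem_nhds hz))).contDiffWithinAt
  have hv := isTest_mul_adjugate hU hP hu
  have h1 : ∀ j k, Integrable fun z => (α z : ℂ) *
      dz j (dzbar k fun w => (u w : ℂ) * (complexHessian P w).adjugate k j) z := fun j k =>
    ((((hv j k).dzbar hU k).dz hU j).mul_left hU hα').integrable
  have h2 : ∀ j k, Integrable fun z => dz j (dzbar k fun z => (α z : ℂ)) z *
      ((u z : ℂ) * (complexHessian P z).adjugate k j) := fun j k =>
    ((hv j k).mul_left hU (contDiffOn_dz hU (contDiffOn_dzbar hU hα' k) j)).integrable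
  calc _ = ∫ z, ∑ j, ∑ k, (α z : ℂ) *
        dz j (dzbar k fun w => (u w : ℂ) * (complexHessian P w).adjugate k j) z := by
        simp only [← sum_dz_dzbar_mul_adjugate_of_isTest hU hP hu, Finset.mul_sum]
    _ = ∑ j, ∑ k, ∫ z, dz j (dzbar k fun z => (α z : ℂ)) z *
          ((u z : ℂ) * (complexHessian P z).adjugate k j) := by
        rw [integral_finsetSum _ fun j _ => integrable_finsetSum _ fun k _ => h1 j k]
        refine Finset.sum_congr rfl fun j _ => ?_
        rw [integral_finsetSum _ fun k _ => h1 j k]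
        exact Finset.sum_congr rfl fun k _ => integral_mul_dz_dzbar hU hα' (hv j k) j k
    _ = _ := by
        simp only [← integral_finsetSum _ fun k _ => h2 _ k]
        rw [← integral_finsetSum _ fun j _ => integrable_finsetSum _ fun k _ => h2 j k]
        refine integral_congr_ae (Eventually.of_forall fun z => ?_)
        simp only [Matrix.trace, Matrix.diag, Matrix.mul_apply, complexHessian_apply,
          Finset.mul_sum]
        exact Finset.sum_congr rfl fun j _ => Finset.sum_congr rfl fun k _ => by ring

end TestFunctions

/-! ### The Poincaré–Lelong formula for a coordinate function -/

section Log

lemma integrableOn_log_norm_sq_ball (r : ℝ) :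
    IntegrableOn (fun ζ : ℂ => Real.log (‖ζ‖ ^ 2)) (Metric.ball 0 r) := by
  refine (integrableOn_fun_norm_addHaar (μ := (volume : Measure ℂ))
    (f := fun y => Real.log (y ^ 2))).2 ?_
  have h : Continuous fun y : ℝ => 2 * (y * Real.log y) :=
    continuous_const.mul Real.continuous_mul_log
  refine ((h.integrableOn_Icc (a := 0) (b := r)).mono_set Set.Ioo_subset_Icc_self).congr_fun
    (fun y hy => ?_) measurableSet_Ioo
  simp [Real.log_pow]
  ring

variable {m : ℕ} (j₀ : Fin (m + 1))

lemma ae_apply_ne_zero : ∀ᵐ w : Cn (m + 1), w j₀ ≠ 0 := Measure.ae_eval_ne (fun _ => volume) j₀ 0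

lemma locallyIntegrable_log_norm_sq :
    LocallyIntegrable fun w : Cn (m + 1) => Real.log (‖w j₀‖ ^ 2) := by
  intro w
  refine ⟨Metric.ball 0 (‖w‖ + 1), Metric.isOpen_ball.mem_nhds (by simp), ?_⟩
  set R := ‖w‖ + 1
  have h1 : IntegrableOn (fun p : ℂ × Cn m => Real.log (‖p.1‖ ^ 2))
      (Metric.ball 0 R ×ˢ Metric.ball 0 R) := by
    rw [IntegrableOn, Measure.volume_eq_prod, ← Measure.prod_restrict]
    have : IsFiniteMeasure ((volume : Measure (Cn m)).restrict (Metric.ball 0 R)) :=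
      ⟨by simpa using measure_ball_lt_top⟩
    exact Integrable.comp_fst (integrableOn_log_norm_sq_ball R) _
  have hmp := volume_preserving_piFinSuccAbove (fun _ => ℂ) j₀
  have h2 := (hmp.integrableOn_comp_preimage
    (MeasurableEquiv.piFinSuccAbove (fun _ => ℂ) j₀).measurableEmbedding).2 h1
  refine IntegrableOn.mono_set h2 fun v hv => ?_
  have hR : 0 < R := by positivity
  simp only [Metric.mem_ball, dist_zero_right, Set.mem_preimage, Set.mem_prod] at hv ⊢
  rw [pi_norm_lt_iff hR] at hv
  exact ⟨hv j₀, (pi_norm_lt_iff hR).2 fun i => hv (j₀.succAbove i)⟩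

lemma locallyIntegrable_ofReal_log_norm_sq :
    LocallyIntegrable fun w : Cn (m + 1) => (Real.log (‖w j₀‖ ^ 2) : ℂ) := fun w =>
  let ⟨s, hs, h⟩ := locallyIntegrable_log_norm_sq j₀ w
  ⟨s, hs, h.ofReal⟩

variable {j₀} {U : Set (Cn (m + 1))} {b : Cn (m + 1) → ℂ}

lemma IsTest.integrable_log_mul (hb : IsTest U b) :
    Integrable fun w => (Real.log (‖w j₀‖ ^ 2) : ℂ) * b w :=
  (locallyIntegrable_ofReal_log_norm_sq j₀).integrable_smul_right_of_hasCompactSupport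
    hb.smooth.continuous hb.compact

lemma IsTest.fderiv_apply (hb : IsTest U b) (v : Cn (m + 1)) :
    IsTest U fun w => fderiv ℝ b w v :=
  have h : tsupport (fun w => fderiv ℝ b w v) ⊆ tsupport b :=
    tsupport_subset_of_eq_zero fun z hz => by
      rw [(eventuallyEq_zero_of_notMem_tsupport hz).fderiv_eq]; simp
  ⟨contDiff_iff_contDiffAt.2 fun _ => contDiffAt_fderiv_apply hb.smooth.contDiffAt v,
    hb.compact.fderiv_apply ℝ v, h.trans hb.support⟩

/-- `log |w_{j₀}|²` does not depend on the other variables. -/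
lemma IsTest.integral_log_mul_fderiv (hb : IsTest U b) {j : Fin (m + 1)} (hj : j ≠ j₀) (c : ℂ) :
    ∫ w, (Real.log (‖w j₀‖ ^ 2) : ℂ) * fderiv ℝ b w (Pi.single j c) = 0 := by
  have h := integral_bilinear_hasLineDerivAt_right_eq_neg_left_of_integrable (μ := volume)
    (f := fun w : Cn (m + 1) => (Real.log (‖w j₀‖ ^ 2) : ℂ)) (f' := fun _ => 0)
    (g := b) (g' := fun w => fderiv ℝ b w (Pi.single j c)) (v := Pi.single j c)
    (B := ContinuousLinearMap.mul ℝ ℂ) (by simp)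
    (by simpa using (hb.fderiv_apply (Pi.single j c)).integrable_log_mul (j₀ := j₀))
    (by simpa using hb.integrable_log_mul (j₀ := j₀)) ?_ ?_
  · simpa using h
  · intro w _
    have h1 : ∀ t : ℝ, (w + t • (Pi.single j c : Cn (m + 1))) j₀ = w j₀ := by
      intro t; simp [hj.symm]
    simp only [HasLineDerivAt, h1]
    exact hasDerivAt_const _ _
  · intro w _
    exact ((hb.smooth.differentiable (by simp) w).hasFDerivAt).hasLineDerivAt _

lemma IsTest.integral_log_mul_dz (hb : IsTest U b) {j : Fin (m + 1)} (hj : j ≠ j₀) :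
    ∫ w, (Real.log (‖w j₀‖ ^ 2) : ℂ) * TwistedEnergy.dz j b w = 0 := by
  have h1 : ∀ w, (Real.log (‖w j₀‖ ^ 2) : ℂ) * TwistedEnergy.dz j b w =
      (1 / 2) * ((Real.log (‖w j₀‖ ^ 2) : ℂ) * fderiv ℝ b w (Pi.single j 1)) -
      (1 / 2 * Complex.I) * ((Real.log (‖w j₀‖ ^ 2) : ℂ) * fderiv ℝ b w (Pi.single j Complex.I)) :=
    fun w => by simp only [TwistedEnergy.dz]; ring
  simp only [h1]
  rw [integral_sub ((hb.fderiv_apply _).integrable_log_mul.const_mul _)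
    ((hb.fderiv_apply _).integrable_log_mul.const_mul _), integral_const_mul, integral_const_mul,
    hb.integral_log_mul_fderiv hj, hb.integral_log_mul_fderiv hj]
  simp

lemma IsTest.integral_log_mul_dzbar (hb : IsTest U b) {j : Fin (m + 1)} (hj : j ≠ j₀) :
    ∫ w, (Real.log (‖w j₀‖ ^ 2) : ℂ) * TwistedEnergy.dzbar j b w = 0 := by
  have h1 : ∀ w, (Real.log (‖w j₀‖ ^ 2) : ℂ) * TwistedEnergy.dzbar j b w =
      (1 / 2) * ((Real.log (‖w j₀‖ ^ 2) : ℂ) * fderiv ℝ b w (Pi.single j 1)) +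
      (1 / 2 * Complex.I) * ((Real.log (‖w j₀‖ ^ 2) : ℂ) * fderiv ℝ b w (Pi.single j Complex.I)) :=
    fun w => by simp only [TwistedEnergy.dzbar]; ring
  simp only [h1]
  rw [integral_add ((hb.fderiv_apply _).integrable_log_mul.const_mul _)
    ((hb.fderiv_apply _).integrable_log_mul.const_mul _), integral_const_mul, integral_const_mul,
    hb.integral_log_mul_fderiv hj, hb.integral_log_mul_fderiv hj]
  simp

lemma contDiff_norm_apply_sq (j₀ : Fin (m + 1)) :
    ContDiff ℝ ∞ fun w : Cn (m + 1) => ‖w j₀‖ ^ 2 :=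
  (contDiff_apply ℝ ℂ j₀).norm_sq ℝ

lemma contDiff_log_norm_sq_add {δ : ℝ} (hδ : 0 < δ) :
    ContDiff ℝ ∞ fun w : Cn (m + 1) => Real.log (‖w j₀‖ ^ 2 + δ) :=
  ((contDiff_norm_apply_sq j₀).add contDiff_const).log fun w => by positivity

lemma differentiable_apply (j₀ : Fin (m + 1)) : Differentiable ℂ fun w : Cn (m + 1) => w j₀ := by
  fun_prop

lemma dz_apply_self (w : Cn (m + 1)) : dz j₀ (fun w : Cn (m + 1) => w j₀) w = 1 := by
  rw [dz_of_holomorphic (differentiable_apply j₀ w)]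
  have : HasFDerivAt (fun w : Cn (m + 1) => w j₀)
      (ContinuousLinearMap.proj (R := ℂ) (φ := fun _ : Fin (m + 1) => ℂ) j₀) w :=
    (ContinuousLinearMap.proj (R := ℂ) (φ := fun _ : Fin (m + 1) => ℂ) j₀).hasFDerivAt
  rw [this.fderiv]
  simp

lemma dz_dzbar_log_norm_sq_add {δ : ℝ} (hδ : 0 < δ) (w : Cn (m + 1)) :
    dz j₀ (dzbar j₀ fun w => (Real.log (‖w j₀‖ ^ 2 + δ) : ℂ)) w =
      ((δ / (‖w j₀‖ ^ 2 + δ) ^ 2 : ℝ) : ℂ) := by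
  have hne : ∀ w : Cn (m + 1), ‖w j₀‖ ^ 2 + δ ≠ 0 := fun w => by positivity
  have hneC : ∀ w : Cn (m + 1), ((‖w j₀‖ ^ 2 + δ : ℝ) : ℂ) ≠ 0 := fun w =>
    Complex.ofReal_ne_zero.2 (hne w)
  have hs : ContDiff ℝ ∞ fun w : Cn (m + 1) => ‖w j₀‖ ^ 2 + δ :=
    (contDiff_norm_apply_sq j₀).add contDiff_const
  have hw := fun w => (differentiable_apply j₀ w).restrictScalars ℝ
  have hwc : ∀ w, DifferentiableAt ℝ (fun w : Cn (m + 1) => conj (w j₀)) w := fun w =>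
    Complex.conjCLE.differentiableAt.comp w (hw w)
  have hr : (fun w : Cn (m + 1) => ((‖w j₀‖ ^ 2 + δ : ℝ) : ℂ)) =
      fun w => w j₀ * conj (w j₀) + (δ : ℂ) := by
    ext w
    rw [Complex.ofReal_add, ofReal_norm_sq]
  have hrd : ∀ w, DifferentiableAt ℝ (fun w : Cn (m + 1) => ((‖w j₀‖ ^ 2 + δ : ℝ) : ℂ)) w :=
    fun w => (contDiffAt_ofReal_comp hs.contDiffAt).differentiableAt (by simp)
  have hbar : ∀ w, dzbar j₀ (fun w : Cn (m + 1) => ((‖w j₀‖ ^ 2 + δ : ℝ) : ℂ)) w = w j₀ := by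
    intro w
    rw [hr, dzbar_add ((hw w).fun_mul (hwc w)) (differentiableAt_const _), dzbar_mul (hw w) (hwc w),
      dzbar_of_holomorphic (differentiable_apply j₀ w), dzbar_conj, dz_apply_self,
      dzbar_of_holomorphic (differentiableAt_const _)]
    simp
  have hdz : dz j₀ (fun w : Cn (m + 1) => ((‖w j₀‖ ^ 2 + δ : ℝ) : ℂ)) w = conj (w j₀) := by
    rw [hr, dz_add ((hw w).fun_mul (hwc w)) (differentiableAt_const _), dz_mul (hw w) (hwc w),
      dz_conj, dzbar_of_holomorphic (differentiable_apply j₀ w), dz_apply_self]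
    simp [dz]
  have h1 : (dzbar j₀ fun w => (Real.log (‖w j₀‖ ^ 2 + δ) : ℂ)) = fun w : Cn (m + 1) =>
      ((‖w j₀‖ ^ 2 + δ : ℝ) : ℂ)⁻¹ * w j₀ := by
    ext w
    rw [dzbar_ofReal_log (hs.differentiable (by simp) w) (hne w), hbar]
  have hinv : DifferentiableAt ℝ (fun w : Cn (m + 1) => ((‖w j₀‖ ^ 2 + δ : ℝ) : ℂ)⁻¹) w :=
    (hrd w).fun_inv (hneC w)
  have hinv' : dz j₀ (fun w : Cn (m + 1) => ((‖w j₀‖ ^ 2 + δ : ℝ) : ℂ)⁻¹) w =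
      -conj (w j₀) / ((‖w j₀‖ ^ 2 + δ : ℝ) : ℂ) ^ 2 := by
    have h2 := dz_mul (j := j₀) hinv (hrd w)
    have h3 : (fun w : Cn (m + 1) => ((‖w j₀‖ ^ 2 + δ : ℝ) : ℂ)⁻¹ * ((‖w j₀‖ ^ 2 + δ : ℝ) : ℂ)) =
        fun _ => 1 := by
      ext w
      exact inv_mul_cancel₀ (hneC w)
    rw [h3, hdz] at h2
    have h4 : dz j₀ (fun _ : Cn (m + 1) => (1 : ℂ)) w = 0 := by simp [dz]
    rw [h4] at h2
    have h5 := hneC w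
    field_simp at h2 ⊢
    linear_combination -h2
  rw [h1, dz_mul hinv (hw w), dz_apply_self, hinv']
  have h5 := hneC w
  have h6 := ofReal_norm_sq (w j₀)
  rw [Complex.ofReal_div, Complex.ofReal_pow]
  field_simp
  rw [Complex.ofReal_add, h6]
  ring

/-- The standard mollifier `1 / (1 + |ζ|²)²` on the plane has integral `π`. -/
lemma integral_one_add_norm_sq_inv : ∫ ζ : ℂ, ((1 + ‖ζ‖ ^ 2) ^ 2)⁻¹ = Real.pi := by
  rw [integral_fun_norm_addHaar (μ := volume) (fun y : ℝ => ((1 + y ^ 2) ^ 2)⁻¹)]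
  have hvol : (volume : Measure ℂ).real (Metric.ball 0 1) = Real.pi := by
    simp [Measure.real, Complex.volume_ball]
  have hint : ∫ y in Set.Ioi (0 : ℝ), y * ((1 + y ^ 2) ^ 2)⁻¹ = 1 / 2 := by
    have hd : ∀ y ∈ Set.Ici (0 : ℝ), HasDerivAt (fun y : ℝ => -(1 / 2) * (1 + y ^ 2)⁻¹)
        (y * ((1 + y ^ 2) ^ 2)⁻¹) y := by
      intro y _
      have h1 : HasDerivAt (fun y : ℝ => 1 + y ^ 2) (2 * y) y := by
        simpa using (hasDerivAt_pow 2 y).const_add 1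
      have h2 := (h1.fun_inv (by positivity)).const_mul (-(1 / 2))
      refine h2.congr_deriv ?_
      field_simp
    have hlim : Tendsto (fun y : ℝ => -(1 / 2) * (1 + y ^ 2)⁻¹) atTop (𝓝 0) := by
      have h1 : Tendsto (fun y : ℝ => (1 + y ^ 2)⁻¹) atTop (𝓝 0) :=
        tendsto_inv_atTop_zero.comp
          (tendsto_atTop_add_const_left _ _ (tendsto_pow_atTop (by simp)))
      simpa only [mul_zero] using h1.const_mul (-(1 / 2))
    have h := integral_Ioi_of_hasDerivAt_of_nonneg' hd
      (fun y hy => mul_nonneg (le_of_lt hy) (by positivity)) hlim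
    rw [h]; norm_num
  simp only [Complex.finrank_real_complex, hvol, smul_eq_mul, Nat.reduceSub, pow_one, hint,
    nsmul_eq_mul]
  push_cast
  ring

lemma continuous_insertNth (j₀ : Fin (m + 1)) :
    Continuous fun p : ℂ × Cn m => (j₀.insertNth p.1 p.2 : Cn (m + 1)) := by fun_prop

/-- The functions `δ / (|ζ|² + δ)²`, where `δ = c⁻²`, are the rescalings of `1 / (1 + |ζ|²)²`. -/
lemma tendsto_integral_mollifier {V : ℂ → ℂ} (hV : Integrable V) (hV' : ContinuousAt V 0) :
    Tendsto (fun c : ℝ => ∫ ζ : ℂ, (((c ^ 2)⁻¹ / (‖ζ‖ ^ 2 + (c ^ 2)⁻¹) ^ 2 : ℝ) : ℂ) * V ζ) atTop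
      (𝓝 (Real.pi * V 0)) := by
  have h := tendsto_integral_comp_smul_smul_of_integrable (μ := (volume : Measure ℂ)) (F := ℂ)
    (φ := fun ζ => Real.pi⁻¹ * ((1 + ‖ζ‖ ^ 2) ^ 2)⁻¹) (fun ζ => by positivity)
    (by rw [integral_const_mul, integral_one_add_norm_sq_inv,
      inv_mul_cancel₀ Real.pi_ne_zero]) ?_ hV hV'
  · have h2 := h.const_mul (Real.pi : ℂ)
    refine h2.congr' ?_
    filter_upwards [eventually_gt_atTop 0] with c hc
    rw [← integral_const_mul]
    refine integral_congr_ae (Eventually.of_forall fun ζ => ?_)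
    have h5 : ‖c • ζ‖ = c * ‖ζ‖ := by rw [norm_smul, Real.norm_eq_abs, abs_of_pos hc]
    beta_reduce
    rw [h5]
    simp only [Complex.finrank_real_complex, Complex.real_smul, ← mul_assoc, ← Complex.ofReal_mul]
    congr 2
    have := Real.pi_ne_zero
    have h3 : 1 + (c * ‖ζ‖) ^ 2 ≠ 0 := by positivity
    have h4 : ‖ζ‖ ^ 2 + (c ^ 2)⁻¹ ≠ 0 := by positivity
    field_simp
    ring
  · have h1 : Tendsto (fun r : ℝ => Real.pi⁻¹ * r⁻¹ ^ 2) atTop (𝓝 0) := by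
      simpa using (tendsto_inv_atTop_zero.pow 2).const_mul (Real.pi⁻¹)
    refine squeeze_zero' (Eventually.of_forall fun ζ => by positivity) ?_
      (h1.comp tendsto_norm_cobounded_atTop)
    filter_upwards [tendsto_norm_cobounded_atTop.eventually (eventually_gt_atTop 0)] with ζ hζ
    simp only [Complex.finrank_real_complex, Function.comp_apply]
    rw [mul_left_comm]
    gcongr
    rw [← div_eq_mul_inv, div_le_iff₀ (by positivity), inv_pow, ← div_eq_inv_mul,
      le_div_iff₀ (by positivity)]
    nlinarith [sq_nonneg ‖ζ‖]

/-- The one-variable formula `∂∂̄ log |w|² = π δ₀`, with parameters: replace `log |w|²` by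
`log (|w|² + δ)`, whose Laplacian is an approximate identity. -/
lemma IsTest.integral_log_mul_dz_dzbar_self (hU : IsOpen U) (hb : IsTest U b) :
    ∫ w, (Real.log (‖w j₀‖ ^ 2) : ℂ) * TwistedEnergy.dz j₀ (TwistedEnergy.dzbar j₀ b) w =
      Real.pi * ∫ w' : Cn m, b (j₀.insertNth 0 w') := by
  set D : Cn (m + 1) → ℂ := TwistedEnergy.dz j₀ (TwistedEnergy.dzbar j₀ b) with hD
  have hDt : IsTest U D := (hb.dzbar hU j₀).dz hU j₀
  -- the regularization with `δ = c⁻²`, whose limit for `c → ∞` is computed in two ways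
  set L : ℝ → ℂ := fun c => ∫ w, (Real.log (‖w j₀‖ ^ 2 + (c ^ 2)⁻¹) : ℂ) * D w with hL
  have hlim1 : Tendsto L atTop (𝓝 (∫ w, (Real.log (‖w j₀‖ ^ 2) : ℂ) * D w)) := by
    refine tendsto_integral_filter_of_dominated_convergence
      (fun w => (|Real.log (‖w j₀‖ ^ 2)| + Real.log (‖w j₀‖ ^ 2 + 1)) * ‖D w‖) ?_ ?_ ?_ ?_
    · filter_upwards [eventually_gt_atTop 0] with c hc
      have h1 := (contDiff_log_norm_sq_add (j₀ := j₀) (inv_pos.2 (pow_pos hc 2))).continuous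
      exact ((Complex.continuous_ofReal.comp h1).mul
        hDt.smooth.continuous).aestronglyMeasurable
    -- domination for `δ ≤ 1`, as `log |w|² ≤ log (|w|² + δ) ≤ log (|w|² + 1)`
    · filter_upwards [eventually_ge_atTop 1] with c hc
      filter_upwards [ae_apply_ne_zero j₀] with w hw
      have hw2 : 0 < ‖w j₀‖ ^ 2 := by positivity
      have hc2 : (c ^ 2)⁻¹ ≤ 1 := inv_le_one_of_one_le₀ (one_le_pow₀ hc)
      have hc0 : 0 < (c ^ 2)⁻¹ := by positivity
      rw [norm_mul, Complex.norm_real, Real.norm_eq_abs]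
      gcongr
      have h1 : Real.log (‖w j₀‖ ^ 2) ≤ Real.log (‖w j₀‖ ^ 2 + (c ^ 2)⁻¹) :=
        Real.log_le_log hw2 (by linarith)
      have h2 : Real.log (‖w j₀‖ ^ 2 + (c ^ 2)⁻¹) ≤ Real.log (‖w j₀‖ ^ 2 + 1) :=
        Real.log_le_log (by positivity) (by linarith)
      have h3 : 0 ≤ Real.log (‖w j₀‖ ^ 2 + 1) := Real.log_nonneg (by linarith)
      rw [abs_le]
      constructor
      · linarith [neg_abs_le (Real.log (‖w j₀‖ ^ 2))]
      · linarith [abs_nonneg (Real.log (‖w j₀‖ ^ 2))]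
    · simp only [add_mul]
      refine Integrable.add ?_ ?_
      · have := (hDt.integrable_log_mul (j₀ := j₀)).norm
        simpa only [norm_mul, Complex.norm_real, Real.norm_eq_abs] using this
      · refine Continuous.integrable_of_hasCompactSupport ?_ hDt.compact.norm.mul_left
        exact (contDiff_log_norm_sq_add one_pos).continuous.mul hDt.smooth.continuous.norm
    · filter_upwards [ae_apply_ne_zero j₀] with w hw
      have hw2 : ‖w j₀‖ ^ 2 ≠ 0 := by positivity
      have h1 : Tendsto (fun c : ℝ => ‖w j₀‖ ^ 2 + (c ^ 2)⁻¹) atTop (𝓝 (‖w j₀‖ ^ 2)) := by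
        simpa using (tendsto_inv_atTop_zero.comp
          (tendsto_pow_atTop (two_ne_zero))).const_add (‖w j₀‖ ^ 2)
      exact ((Complex.continuous_ofReal.tendsto _).comp (h1.log hw2)).mul_const _
  set V : ℂ → ℂ := fun ζ => ∫ w' : Cn m, b (j₀.insertNth ζ w') with hV
  have hmp := volume_preserving_piFinSuccAbove (fun _ => ℂ) j₀
  have hme := (MeasurableEquiv.piFinSuccAbove (fun _ => ℂ) j₀).measurableEmbedding
  have hsymm : ∀ w : Cn (m + 1), j₀.insertNth (MeasurableEquiv.piFinSuccAbove (fun _ => ℂ) j₀ w).1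
      (MeasurableEquiv.piFinSuccAbove (fun _ => ℂ) j₀ w).2 = w := fun w =>
    (MeasurableEquiv.piFinSuccAbove (fun _ => ℂ) j₀).symm_apply_apply w
  have hprod : ∀ g : Cn (m + 1) → ℂ, Integrable g →
      Integrable fun p : ℂ × Cn m => g (j₀.insertNth p.1 p.2) := by
    intro g hg
    rw [← hmp.integrable_comp_emb hme]
    simpa only [Function.comp_def, hsymm] using hg
  have hFub : ∀ g : Cn (m + 1) → ℂ, Integrable g →
      ∫ w, g w = ∫ ζ : ℂ, ∫ w' : Cn m, g (j₀.insertNth ζ w') := by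
    intro g hg
    have h1 := hmp.integral_comp hme fun p : ℂ × Cn m => g (j₀.insertNth p.1 p.2)
    simp only [hsymm] at h1
    rw [h1, Measure.volume_eq_prod]
    exact integral_prod _ (hprod g hg)
  have hVint : Integrable V := (hprod b hb.integrable).integral_prod_left
  have hVcont : Continuous V := by
    rw [← continuousOn_univ]
    have hK : IsCompact ((fun w : Cn (m + 1) => fun i => w (j₀.succAbove i)) '' tsupport b) :=
      hb.compact.isCompact.image (by fun_prop)
    refine continuousOn_integral_of_compact_support hK
      (hb.smooth.continuous.comp (continuous_insertNth j₀)).continuousOn ?_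
    intro ζ w' _ hw'
    by_contra h
    exact hw' ⟨_, subset_tsupport b h, by ext i; simp⟩
  have hlim2 : Tendsto L atTop (𝓝 (Real.pi * V 0)) := by
    refine (tendsto_integral_mollifier hVint hVcont.continuousAt).congr' ?_
    filter_upwards [eventually_gt_atTop 0] with c hc
    have hc2 : 0 < (c ^ 2)⁻¹ := by positivity
    have hsm : ContDiffOn ℝ ∞ (fun w : Cn (m + 1) =>
        (Real.log (‖w j₀‖ ^ 2 + (c ^ 2)⁻¹) : ℂ)) U := fun w _ =>
      (contDiffAt_ofReal_comp (contDiff_log_norm_sq_add hc2).contDiffAt).contDiffWithinAt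
    simp only [hL, hD]
    rw [integral_mul_dz_dzbar hU hsm hb, hFub]
    · refine integral_congr_ae (Eventually.of_forall fun ζ => ?_)
      simp only [dz_dzbar_log_norm_sq_add hc2, Fin.insertNth_apply_same, hV]
      rw [integral_const_mul]
    · exact (hb.mul_left hU (contDiffOn_dz hU (contDiffOn_dzbar hU hsm j₀) j₀)).integrable
  exact tendsto_nhds_unique hlim1 hlim2

variable {P u : Cn (m + 1) → ℝ}

/-- The Poincaré–Lelong formula for the coordinate hyperplane `w_{j₀} = 0`, tested against
`u (√-1 ∂∂̄ P)^{n-1}`. -/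
lemma integral_log_mul_trace_complexHessian (hU : IsOpen U) (hP : ContDiffOn ℝ ∞ P U)
    (hu : IsTest U fun z => (u z : ℂ)) :
    ∫ w, (Real.log (‖w j₀‖ ^ 2) : ℂ) * (complexHessian u w * (complexHessian P w).adjugate).trace =
      Real.pi * ∫ w' : Cn m, (u (j₀.insertNth 0 w') : ℂ) *
        ((complexHessian P (j₀.insertNth 0 w')).submatrix j₀.succAbove j₀.succAbove).det := by
  have hv := isTest_mul_adjugate hU hP hu
  have h1 : ∀ j k, Integrable fun w => (Real.log (‖w j₀‖ ^ 2) : ℂ) *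
      dz j (dzbar k fun w => (u w : ℂ) * (complexHessian P w).adjugate k j) w := fun j k =>
    (((hv j k).dzbar hU k).dz hU j).integrable_log_mul
  -- a derivative in another direction than `w_{j₀}` integrates to zero against the logarithm
  have h2 : ∀ j k, ¬ (j = j₀ ∧ k = j₀) → ∫ w, (Real.log (‖w j₀‖ ^ 2) : ℂ) *
      dz j (dzbar k fun w => (u w : ℂ) * (complexHessian P w).adjugate k j) w = 0 := by
    intro j k hjk
    by_cases hj : j = j₀
    · simp only [fun w => dz_dzbar_comm (j := j) (k := k) ((hv j k).smooth.contDiffAt (x := w))]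
      exact ((hv j k).dz hU j).integral_log_mul_dzbar fun hk => hjk ⟨hj, hk⟩
    · exact ((hv j k).dzbar hU k).integral_log_mul_dz hj
  simp only [← sum_dz_dzbar_mul_adjugate_of_isTest hU hP hu, Finset.mul_sum]
  rw [integral_finsetSum _ fun j _ => integrable_finsetSum _ fun k _ => h1 j k]
  simp only [integral_finsetSum _ fun k _ => h1 _ k]
  rw [Finset.sum_eq_single j₀ _ (by simp), Finset.sum_eq_single j₀ _ (by simp),
    (hv j₀ j₀).integral_log_mul_dz_dzbar_self hU]
  · simp only [Matrix.adjugate_fin_succ_eq_det_submatrix, ← two_mul, pow_mul, neg_one_sq, one_pow,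
      one_mul]
  · exact fun k _ hk => h2 _ _ fun h => hk h.2
  · exact fun j _ hj => Finset.sum_eq_zero fun k _ => h2 _ _ fun h => hj h.1

end Log

/-! ### Integrals over compact complex manifolds -/

section ChartImage

variable {n : ℕ} {M : Type*} [TopologicalSpace M] [ChartedSpace (Cn n) M]

variable (n) in
/-- The part of the image of the chart at `x` that corresponds to points of `V`. -/
def chartImage (V : Set M) (x : M) : Set (Cn n) :=
  (chartAt (Cn n) x).target ∩ (chartAt (Cn n) x).symm ⁻¹' V

lemma isOpen_chartImage {V : Set M} (hV : IsOpen V) (x : M) : IsOpen (chartImage n V x) :=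
  (chartAt (Cn n) x).isOpen_inter_preimage_symm hV

lemma image_chartImage {V : Set M} {κ : M → Cn n} (x : M) :
    (fun z => κ ((chartAt (Cn n) x).symm z)) '' chartImage n V x =
      κ '' (V ∩ (chartAt (Cn n) x).source) := by
  ext w
  constructor
  · rintro ⟨z, ⟨hz, hzV⟩, rfl⟩
    exact ⟨_, ⟨hzV, (chartAt (Cn n) x).map_target hz⟩, rfl⟩
  · rintro ⟨p, ⟨hpV, hp⟩, rfl⟩
    have h := (chartAt (Cn n) x).left_inv hp
    exact ⟨chartAt (Cn n) x p, ⟨(chartAt (Cn n) x).map_source hp, by simpa [h] using hpV⟩,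
      by simp only [h]⟩

lemma injOn_comp_symm {V : Set M} {κ : M → Cn n} (hinj : Set.InjOn κ V) (x : M) :
    Set.InjOn (fun z => κ ((chartAt (Cn n) x).symm z)) (chartImage n V x) :=
  fun _ hz _ hz' h => (chartAt (Cn n) x).symm.injOn hz.1 hz'.1 (hinj hz.2 hz'.2 h)

end ChartImage

section Integral

variable {n : ℕ} {M : Type*} [TopologicalSpace M] [ChartedSpace (Cn n) M] [T2Space M]
  [CompactSpace M]

lemma chartPartition_isSubordinate (x : M) :
    tsupport (chartPartition n M x) ⊆ (chartAt (Cn n) x).source :=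
  (exists_chartPartition n M).choose_spec x

variable (n M) in
lemma finite_chartPartition : {x : M | (Function.support (chartPartition n M x)).Nonempty}.Finite :=
  (chartPartition n M).locallyFinite.finite_nonempty_of_compact

variable (n M) in
/-- The finitely many indices that contribute to the partition of unity. -/
noncomputable def chartIndex : Finset M := (finite_chartPartition n M).toFinset

lemma chartPartition_eq_zero {x : M} (hx : x ∉ chartIndex n M) (y : M) :
    chartPartition n M x y = 0 := by
  by_contra h
  exact hx ((finite_chartPartition n M).mem_toFinset.2 ⟨y, h⟩)

lemma sum_chartPartition (y : M) : ∑ x ∈ chartIndex n M, chartPartition n M x y = 1 := by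
  rw [← (chartPartition n M).sum_eq_one (Set.mem_univ y)]
  refine (finsum_eq_sum_of_support_subset _ fun x hx => ?_).symm
  by_contra h
  exact hx (chartPartition_eq_zero h y)

lemma integral_eq_sum (η : Chart n M → Cn n → ℝ) :
    integral η = ∑ x ∈ chartIndex n M, ∫ z in (chartAt (Cn n) x).target,
      chartPartition n M x ((chartAt (Cn n) x).symm z) * η (chartAt (Cn n) x) z := by
  refine finsum_eq_sum_of_support_subset _ fun x hx => ?_
  by_contra h
  exact hx (by simp [chartPartition_eq_zero h])

/-- All the integrals that make up `integral η` converge. -/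
def IsIntegrable (η : Chart n M → Cn n → ℝ) : Prop :=
  ∀ x : M, IntegrableOn (fun z => chartPartition n M x ((chartAt (Cn n) x).symm z) *
    η (chartAt (Cn n) x) z) (chartAt (Cn n) x).target

lemma integral_congr {η η' : Chart n M → Cn n → ℝ}
    (h : ∀ x : M, ∀ z ∈ (chartAt (Cn n) x).target,
      η (chartAt (Cn n) x) z = η' (chartAt (Cn n) x) z) : integral η = integral η' := by
  simp only [integral_eq_sum]
  refine Finset.sum_congr rfl fun x _ => ?_
  refine setIntegral_congr_fun (chartAt (Cn n) x).open_target.measurableSet fun z hz => ?_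
  simp only [h x z hz]

lemma IsIntegrable.congr {η η' : Chart n M → Cn n → ℝ} (hη : IsIntegrable η)
    (h : ∀ x : M, ∀ z ∈ (chartAt (Cn n) x).target,
      η (chartAt (Cn n) x) z = η' (chartAt (Cn n) x) z) : IsIntegrable η' := fun x =>
  (hη x).congr_fun (fun z hz => by simp only [h x z hz])
    (chartAt (Cn n) x).open_target.measurableSet

lemma integral_sum {ι : Type*} (s : Finset ι) {η : ι → Chart n M → Cn n → ℝ}
    (h : ∀ i ∈ s, IsIntegrable (η i)) :
    integral (fun e z => ∑ i ∈ s, η i e z) = ∑ i ∈ s, integral (η i) := by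
  simp only [integral_eq_sum, Finset.mul_sum]
  rw [Finset.sum_comm]
  refine Finset.sum_congr rfl fun x _ => ?_
  exact integral_finsetSum _ fun i hi => h i hi x

lemma integral_sub {η η' : Chart n M → Cn n → ℝ} (hη : IsIntegrable η)
    (hη' : IsIntegrable η') :
    integral (fun e z => η e z - η' e z) = integral η - integral η' := by
  simp only [integral_eq_sum, mul_sub]
  rw [← Finset.sum_sub_distrib]
  exact Finset.sum_congr rfl fun x _ => MeasureTheory.integral_sub (hη x) (hη' x)

lemma integral_mono {η η' : Chart n M → Cn n → ℝ} (hη : IsIntegrable η')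
    (h0 : ∀ x : M, ∀ z ∈ (chartAt (Cn n) x).target, 0 ≤ η (chartAt (Cn n) x) z)
    (h : ∀ x : M, ∀ z ∈ (chartAt (Cn n) x).target,
      η (chartAt (Cn n) x) z ≤ η' (chartAt (Cn n) x) z) : integral η ≤ integral η' := by
  simp only [integral_eq_sum]
  refine Finset.sum_le_sum fun x _ => ?_
  have hm := (chartAt (Cn n) x).open_target.measurableSet
  refine integral_mono_of_nonneg ?_ (hη x) ?_
  · filter_upwards [ae_restrict_mem hm] with z hz
    exact mul_nonneg ((chartPartition n M).nonneg _ _) (h0 x z hz)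
  · filter_upwards [ae_restrict_mem hm] with z hz
    exact mul_le_mul_of_nonneg_left (h x z hz) ((chartPartition n M).nonneg _ _)

lemma integral_nonneg {η : Chart n M → Cn n → ℝ}
    (h : ∀ x : M, ∀ z ∈ (chartAt (Cn n) x).target, 0 ≤ η (chartAt (Cn n) x) z) :
    0 ≤ integral η := by
  rw [integral_eq_sum]
  refine Finset.sum_nonneg fun x _ => ?_
  exact setIntegral_nonneg (chartAt (Cn n) x).open_target.measurableSet fun z hz =>
    mul_nonneg ((chartPartition n M).nonneg _ _) (h x z hz)

variable {V : Set M} {κ : M → Cn n}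

/-- The image of an open set under an injective differentiable map is measurable: it is a finite
union of images of open subsets of `ℂⁿ`. -/
lemma measurableSet_image (hinj : Set.InjOn κ V)
    (hdiff : ∀ x : M, DifferentiableOn ℝ (fun z => κ ((chartAt (Cn n) x).symm z))
      (chartImage n V x)) {O : Set M} (hO : IsOpen O) (hOV : O ⊆ V) : MeasurableSet (κ '' O) := by
  have h : κ '' O = ⋃ x ∈ chartIndex n M, κ '' (O ∩ (chartAt (Cn n) x).source) := by
    rw [← Set.image_iUnion₂]
    congr 1
    refine subset_antisymm (fun p hp => ?_) (Set.iUnion₂_subset fun x _ => Set.inter_subset_left)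
    obtain ⟨x, hx, hxp⟩ : ∃ x ∈ chartIndex n M, chartPartition n M x p ≠ 0 := by
      by_contra! h
      have := sum_chartPartition (n := n) p
      rw [Finset.sum_eq_zero h] at this
      exact zero_ne_one this
    exact Set.mem_biUnion hx ⟨hp, chartPartition_isSubordinate x (subset_tsupport _ hxp)⟩
  rw [h]
  refine Finset.measurableSet_biUnion _ fun x _ => ?_
  rw [← image_chartImage]
  have hsub : chartImage n O x ⊆ chartImage n V x :=
    Set.inter_subset_inter_right _ (Set.preimage_mono hOV)
  refine measurable_image_of_fderivWithin (isOpen_chartImage hO x).measurableSet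
    (fun z hz => ((hdiff x).mono hsub z hz).hasFDerivWithinAt)
    ((injOn_comp_symm hinj x).mono hsub)

/-- Integration in a generalized chart: if a form of top degree vanishes outside an open set `V` and
is the pull-back of `G` times Lebesgue measure under an injective differentiable map `κ` on `V`, its
integral is that of `G` over `κ '' V`. -/
lemma integral_eq_setIntegral (hV : IsOpen V) (hinj : Set.InjOn κ V)
    (hdiff : ∀ x : M, DifferentiableOn ℝ (fun z => κ ((chartAt (Cn n) x).symm z))
      (chartImage n V x)) {η : Chart n M → Cn n → ℝ} {G : Cn n → ℝ}
    (hη : ∀ x : M, ∀ z ∈ chartImage n V x, η (chartAt (Cn n) x) z =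
      |(fderiv ℝ (fun z => κ ((chartAt (Cn n) x).symm z)) z).det| *
        G (κ ((chartAt (Cn n) x).symm z)))
    (hη0 : ∀ x : M, ∀ z ∈ (chartAt (Cn n) x).target, (chartAt (Cn n) x).symm z ∉ V →
      η (chartAt (Cn n) x) z = 0)
    (hG : IntegrableOn G (κ '' V)) :
    IsIntegrable η ∧ integral η = ∫ w in κ '' V, G w := by
  classical
  -- `Function.invFunOn` below needs `M` to be nonempty
  rcases isEmpty_or_nonempty M with hM | hM
  · refine ⟨fun x => isEmptyElim x, ?_⟩
    have h1 : chartIndex n M = ∅ := Finset.eq_empty_of_isEmpty _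
    have h2 : κ '' V = ∅ := by rw [Set.eq_empty_of_isEmpty V, Set.image_empty]
    rw [integral_eq_sum, h1, h2]
    simp
  -- the partition of unity, transported to `κ '' V`
  set r : M → Cn n → ℝ := fun x w => chartPartition n M x (Function.invFunOn κ V w) with hr
  have hrκ : ∀ x, ∀ p ∈ V, r x (κ p) = chartPartition n M x p := by
    intro x p hp
    simp only [hr]
    rw [hinj.leftInvOn_invFunOn hp]
  have hmV : MeasurableSet (κ '' V) := measurableSet_image hinj hdiff hV le_rfl
  have hrm : ∀ x, AEStronglyMeasurable (r x) (volume.restrict (κ '' V)) := by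
    intro x
    refine (aemeasurable_restrict_of_measurable_subtype hmV ?_).aestronglyMeasurable
    refine measurable_of_isOpen fun O hO => ?_
    have h : (fun w : κ '' V => r x w) ⁻¹' O =
        (fun w : κ '' V => (w : Cn n)) ⁻¹' (κ '' (V ∩ chartPartition n M x ⁻¹' O)) := by
      ext ⟨w, p, hp, rfl⟩
      simp only [Set.mem_preimage, hrκ x p hp]
      constructor
      · exact fun h => ⟨p, ⟨hp, h⟩, rfl⟩
      · rintro ⟨q, ⟨hq, hqO⟩, hqp⟩
        rwa [← hinj hq hp hqp]
    rw [h]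
    exact measurable_subtype_coe (measurableSet_image hinj hdiff
      (hV.inter (hO.preimage (chartPartition n M x).continuous)) Set.inter_subset_left)
  have hrG : ∀ x, IntegrableOn (fun w => r x w * G w) (κ '' V) := by
    intro x
    refine Integrable.bdd_mul hG (hrm x) (c := 1) (Eventually.of_forall fun w => ?_)
    rw [Real.norm_eq_abs, abs_of_nonneg ((chartPartition n M).nonneg _ _)]
    exact (chartPartition n M).le_one _ _
  have hsub : ∀ x, chartImage n V x ⊆ (chartAt (Cn n) x).target := fun x => Set.inter_subset_left
  have hop := fun x => isOpen_chartImage (n := n) hV x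
  have hfd : ∀ x, ∀ z ∈ chartImage n V x, HasFDerivWithinAt
      (fun z => κ ((chartAt (Cn n) x).symm z))
      (fderiv ℝ (fun z => κ ((chartAt (Cn n) x).symm z)) z) (chartImage n V x) z := fun x z hz =>
    ((hdiff x).differentiableAt ((hop x).mem_nhds hz)).hasFDerivAt.hasFDerivWithinAt
  have hzero : ∀ x, ∀ z ∈ (chartAt (Cn n) x).target \ chartImage n V x,
      chartPartition n M x ((chartAt (Cn n) x).symm z) * η (chartAt (Cn n) x) z = 0 := by
    intro x z hz
    rw [hη0 x z hz.1 fun h => hz.2 ⟨hz.1, h⟩, mul_zero]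
  have heq : ∀ x, ∀ z ∈ chartImage n V x,
      |(fderiv ℝ (fun z => κ ((chartAt (Cn n) x).symm z)) z).det| •
        (r x (κ ((chartAt (Cn n) x).symm z)) * G (κ ((chartAt (Cn n) x).symm z))) =
      chartPartition n M x ((chartAt (Cn n) x).symm z) * η (chartAt (Cn n) x) z := by
    intro x z hz
    rw [hη x z hz, hrκ x _ hz.2, smul_eq_mul]
    ring
  have himage : ∀ x, κ '' (V ∩ (chartAt (Cn n) x).source) ⊆ κ '' V := fun x =>
    Set.image_mono Set.inter_subset_left
  refine ⟨fun x => ?_, ?_⟩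
  · have h1 : IntegrableOn (fun w => r x w * G w)
        ((fun z => κ ((chartAt (Cn n) x).symm z)) '' chartImage n V x) := by
      rw [image_chartImage]
      exact (hrG x).mono_set (himage x)
    rw [integrableOn_image_iff_integrableOn_abs_det_fderiv_smul volume (hop x).measurableSet
      (hfd x) (injOn_comp_symm hinj x)] at h1
    exact (h1.congr_fun (heq x) (hop x).measurableSet).of_forall_sdiff_eq_zero
      (chartAt (Cn n) x).open_target.measurableSet (hzero x)
  · have h1 : ∀ x, ∫ z in (chartAt (Cn n) x).target,
        chartPartition n M x ((chartAt (Cn n) x).symm z) * η (chartAt (Cn n) x) z =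
        ∫ w in κ '' V, r x w * G w := by
      intro x
      rw [setIntegral_eq_of_subset_of_forall_sdiff_eq_zero
        (chartAt (Cn n) x).open_target.measurableSet (hsub x) (hzero x),
        ← setIntegral_congr_fun (hop x).measurableSet (heq x),
        ← integral_image_eq_integral_abs_det_fderiv_smul volume (hop x).measurableSet (hfd x)
          (injOn_comp_symm hinj x) (fun w => r x w * G w), image_chartImage]
      refine (setIntegral_eq_of_subset_of_forall_sdiff_eq_zero hmV (himage x) ?_).symm
      rintro w ⟨⟨p, hp, rfl⟩, hw⟩
      have h0 : chartPartition n M x p = 0 := image_eq_zero_of_notMem_tsupport fun h =>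
        hw ⟨p, ⟨hp, chartPartition_isSubordinate x h⟩, rfl⟩
      rw [hrκ x p hp, h0, zero_mul]
    simp only [integral_eq_sum, h1]
    rw [← integral_finsetSum _ fun x _ => hrG x]
    refine setIntegral_congr_fun hmV ?_
    rintro _ ⟨p, hp, rfl⟩
    simp only [hrκ _ p hp, ← Finset.sum_mul, sum_chartPartition, one_mul]

/-- The real Jacobian of a holomorphic map is the squared modulus of the complex one. -/
lemma abs_det_fderiv_real {f : Cn n → Cn n} {z : Cn n} (hf : DifferentiableAt ℂ f z) :
    |(fderiv ℝ f z).det| = ‖(holJacobian f z).det‖ ^ 2 := by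
  have h1 : (fderiv ℝ f z).det =
      Algebra.norm ℝ (LinearMap.det (fderiv ℂ f z : Cn n →ₗ[ℂ] Cn n)) := by
    rw [hf.fderiv_restrictScalars ℝ, ← LinearMap.det_restrictScalars]
    rfl
  have h2 : holJacobian f z = LinearMap.toMatrix' (fderiv ℂ f z : Cn n →ₗ[ℂ] Cn n) := by
    ext k a
    simp [holJacobian, LinearMap.toMatrix'_apply]
  rw [h1, h2, LinearMap.det_toMatrix', Algebra.norm_complex_apply, Complex.normSq_eq_norm_sq,
    abs_of_nonneg (by positivity)]

/-- Integration of `u α₁ ∧ ⋯ ∧ α_n` in a generalized holomorphic chart `κ` on `V`, for forms with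
potentials `α_i = √-1 ∂∂̄ (Q_i ∘ κ)` on `V` and a function `u` that vanishes outside `V`. -/
lemma integral_topForm_eq_setIntegral (hV : IsOpen V) (hinj : Set.InjOn κ V)
    (hκ : ∀ x : M, ContDiffOn ℂ ∞ (fun z => κ ((chartAt (Cn n) x).symm z)) (chartImage n V x))
    {Q : Fin n → Cn n → ℝ} (hQ : ∀ i, ∀ w ∈ κ '' V, ContDiffAt ℝ ∞ (Q i) w)
    {α : Fin n → LocalForm n M}
    (hα : ∀ x : M, ∀ z ∈ chartImage n V x, ∀ i, α i (chartAt (Cn n) x) z =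
      complexHessian (fun z => Q i (κ ((chartAt (Cn n) x).symm z))) z)
    {u : M → ℝ} {g : Cn n → ℝ} (hu : ∀ p ∈ V, u p = g (κ p)) (hu0 : ∀ p ∉ V, u p = 0)
    (hG : IntegrableOn (fun w => g w * (2 ^ n * (wedgeCoeff fun i => complexHessian (Q i) w).re))
      (κ '' V)) :
    IsIntegrable (topForm u α) ∧ integral (topForm u α) =
      ∫ w in κ '' V, g w * (2 ^ n * (wedgeCoeff fun i => complexHessian (Q i) w).re) := by
  have hκz : ∀ x : M, ∀ z ∈ chartImage n V x,
      ContDiffAt ℂ ∞ (fun z => κ ((chartAt (Cn n) x).symm z)) z := fun x z hz =>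
    (hκ x).contDiffAt ((isOpen_chartImage hV x).mem_nhds hz)
  have hκd : ∀ x : M, ∀ z ∈ chartImage n V x,
      DifferentiableAt ℂ (fun z => κ ((chartAt (Cn n) x).symm z)) z := fun x z hz =>
    (hκz x z hz).differentiableAt (by simp)
  refine integral_eq_setIntegral hV hinj
    (fun x z hz => ((hκd x z hz).restrictScalars ℝ).differentiableWithinAt) ?_ ?_ hG
  · intro x z hz
    rw [abs_det_fderiv_real (hκd x z hz), topForm, hu _ hz.2]
    have h1 : (fun i => α i (chartAt (Cn n) x) z) = fun i =>
        (holJacobian (fun z => κ ((chartAt (Cn n) x).symm z)) z)ᵀ *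
          complexHessian (Q i) (κ ((chartAt (Cn n) x).symm z)) *
          (holJacobian (fun z => κ ((chartAt (Cn n) x).symm z)) z).map (starRingEnd ℂ) := by
      ext1 i
      rw [hα x z hz i]
      exact complexHessian_comp (hκz x z hz) (hQ i _ ⟨_, hz.2, rfl⟩)
    rw [h1, wedgeCoeff_pullback, Complex.re_ofReal_mul]
    ring
  · intro x z hz hzV
    rw [topForm, hu0 _ hzV, zero_mul]

end Integral

/-! ### Families of functions depending smoothly on time -/

section Time

variable {n : ℕ} {U : Set (Cn n)}

section General

variable {F : Type*} [NormedAddCommGroup F] [NormedSpace ℝ F] {H : ℝ × Cn n → F}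

lemma uniqueDiffOn_slab (hU : IsOpen U) : UniqueDiffOn ℝ (Set.Icc (0 : ℝ) 1 ×ˢ U) :=
  (uniqueDiffOn_Icc zero_lt_one).prod hU.uniqueDiffOn

lemma contDiffOn_fderivWithin_apply (hU : IsOpen U)
    (hH : ContDiffOn ℝ ∞ H (Set.Icc (0 : ℝ) 1 ×ˢ U)) (v : ℝ × Cn n) :
    ContDiffOn ℝ ∞ (fun p => fderivWithin ℝ H (Set.Icc (0 : ℝ) 1 ×ˢ U) p v)
      (Set.Icc (0 : ℝ) 1 ×ˢ U) :=
  (hH.fderivWithin (uniqueDiffOn_slab hU) (by simp)).clm_apply contDiffOn_const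

lemma hasFDerivAt_slice (hU : IsOpen U) (hH : ContDiffOn ℝ ∞ H (Set.Icc (0 : ℝ) 1 ×ˢ U))
    {t : ℝ} (ht : t ∈ Set.Icc (0 : ℝ) 1) {z : Cn n} (hz : z ∈ U) :
    HasFDerivAt (fun w => H (t, w)) ((fderivWithin ℝ H (Set.Icc (0 : ℝ) 1 ×ˢ U) (t, z)).comp
      (ContinuousLinearMap.inr ℝ ℝ (Cn n))) z := by
  have h1 : HasFDerivWithinAt H (fderivWithin ℝ H (Set.Icc (0 : ℝ) 1 ×ˢ U) (t, z))
      (Set.Icc (0 : ℝ) 1 ×ˢ U) (t, z) :=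
    (hH.differentiableOn (by simp) (t, z) ⟨ht, hz⟩).hasFDerivWithinAt
  have h2 : HasFDerivWithinAt (fun w : Cn n => (t, w)) (ContinuousLinearMap.inr ℝ ℝ (Cn n)) U z :=
    (hasFDerivAt_prodMk_right t z).hasFDerivWithinAt
  exact (h1.comp z h2 fun w hw => ⟨ht, hw⟩).hasFDerivAt (hU.mem_nhds hz)

lemma hasDerivWithinAt_slice (hH : ContDiffOn ℝ ∞ H (Set.Icc (0 : ℝ) 1 ×ˢ U))
    {t : ℝ} (ht : t ∈ Set.Icc (0 : ℝ) 1) {z : Cn n} (hz : z ∈ U) :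
    HasDerivWithinAt (fun s => H (s, z)) (fderivWithin ℝ H (Set.Icc (0 : ℝ) 1 ×ˢ U) (t, z) (1, 0))
      (Set.Icc 0 1) t := by
  have h1 : HasFDerivWithinAt H (fderivWithin ℝ H (Set.Icc (0 : ℝ) 1 ×ˢ U) (t, z))
      (Set.Icc (0 : ℝ) 1 ×ˢ U) (t, z) :=
    (hH.differentiableOn (by simp) (t, z) ⟨ht, hz⟩).hasFDerivWithinAt
  have h2 : HasDerivWithinAt (fun s : ℝ => (s, z)) ((1 : ℝ), (0 : Cn n)) (Set.Icc 0 1) t :=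
    ((hasDerivAt_id t).prodMk (hasDerivAt_const t z)).hasDerivWithinAt
  have h3 : Set.MapsTo (fun s : ℝ => (s, z)) (Set.Icc 0 1) (Set.Icc (0 : ℝ) 1 ×ˢ U) :=
    fun s hs => ⟨hs, hz⟩
  exact h1.comp_hasDerivWithinAt t h2 h3

lemma derivWithin_slice (hH : ContDiffOn ℝ ∞ H (Set.Icc (0 : ℝ) 1 ×ˢ U))
    {t : ℝ} (ht : t ∈ Set.Icc (0 : ℝ) 1) {z : Cn n} (hz : z ∈ U) :
    derivWithin (fun s => H (s, z)) (Set.Icc 0 1) t =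
      fderivWithin ℝ H (Set.Icc (0 : ℝ) 1 ×ˢ U) (t, z) (1, 0) :=
  (hasDerivWithinAt_slice hH ht hz).derivWithin (uniqueDiffOn_Icc zero_lt_one t ht)

lemma fderiv_slice (hU : IsOpen U) (hH : ContDiffOn ℝ ∞ H (Set.Icc (0 : ℝ) 1 ×ˢ U))
    {t : ℝ} (ht : t ∈ Set.Icc (0 : ℝ) 1) {z : Cn n} (hz : z ∈ U) (v : Cn n) :
    fderiv ℝ (fun w => H (t, w)) z v =
      fderivWithin ℝ H (Set.Icc (0 : ℝ) 1 ×ˢ U) (t, z) (0, v) := by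
  rw [(hasFDerivAt_slice hU hH ht hz).fderiv]
  simp

lemma contDiffOn_slice (hH : ContDiffOn ℝ ∞ H (Set.Icc (0 : ℝ) 1 ×ˢ U))
    {t : ℝ} (ht : t ∈ Set.Icc (0 : ℝ) 1) : ContDiffOn ℝ ∞ (fun w => H (t, w)) U :=
  hH.comp (contDiff_prodMk_right t).contDiffOn fun _ hw => ⟨ht, hw⟩

lemma contDiffOn_derivWithin (hU : IsOpen U) (hH : ContDiffOn ℝ ∞ H (Set.Icc (0 : ℝ) 1 ×ˢ U)) :
    ContDiffOn ℝ ∞ (fun p : ℝ × Cn n => derivWithin (fun s => H (s, p.2)) (Set.Icc 0 1) p.1)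
      (Set.Icc (0 : ℝ) 1 ×ˢ U) :=
  (contDiffOn_fderivWithin_apply hU hH (1, 0)).congr fun _ hp => derivWithin_slice hH hp.1 hp.2

lemma contDiffOn_fderiv_slice (hU : IsOpen U) (hH : ContDiffOn ℝ ∞ H (Set.Icc (0 : ℝ) 1 ×ˢ U))
    (v : Cn n) :
    ContDiffOn ℝ ∞ (fun p : ℝ × Cn n => fderiv ℝ (fun w => H (p.1, w)) p.2 v)
      (Set.Icc (0 : ℝ) 1 ×ˢ U) :=
  (contDiffOn_fderivWithin_apply hU hH (0, v)).congr fun _ hp => fderiv_slice hU hH hp.1 hp.2 v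

/-- Time and space derivatives commute, up to the boundary of the time interval. -/
lemma hasDerivWithinAt_fderiv_slice (hU : IsOpen U)
    (hH : ContDiffOn ℝ ∞ H (Set.Icc (0 : ℝ) 1 ×ˢ U)) {t : ℝ} (ht : t ∈ Set.Icc (0 : ℝ) 1)
    {z : Cn n} (hz : z ∈ U) (v : Cn n) :
    HasDerivWithinAt (fun s => fderiv ℝ (fun w => H (s, w)) z v)
      (fderiv ℝ (fun w => derivWithin (fun s => H (s, w)) (Set.Icc 0 1) t) z v)
      (Set.Icc 0 1) t := by
  set S := Set.Icc (0 : ℝ) 1 ×ˢ U with hS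
  have hSu : UniqueDiffOn ℝ S := uniqueDiffOn_slab hU
  have hp : (t, z) ∈ S := ⟨ht, hz⟩
  -- symmetry of second derivatives holds at the boundary times too, by continuity from the interior
  have hcl : (t, z) ∈ closure (interior S) := by
    rw [hS, interior_prod_eq, interior_Icc, hU.interior_eq, closure_prod_eq,
      closure_Ioo zero_ne_one]
    exact ⟨ht, subset_closure hz⟩
  have hsymm : IsSymmSndFDerivWithinAt ℝ H S (t, z) :=
    (hH _ hp).isSymmSndFDerivWithinAt (by simpa using ENat.LEInfty.out) hSu hcl hp
  have hd : DifferentiableWithinAt ℝ (fderivWithin ℝ H S) S (t, z) :=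
    (hH.fderivWithin (m := ∞) hSu (by simp)).differentiableOn (by simp) _ hp
  have happly : ∀ u v : ℝ × Cn n, fderivWithin ℝ (fun p => fderivWithin ℝ H S p u) S (t, z) v =
      fderivWithin ℝ (fderivWithin ℝ H S) S (t, z) v u := by
    intro u v
    rw [fderivWithin_clm_apply (hSu _ hp) hd (differentiableWithinAt_const u)]
    simp
  have h1 := hasDerivWithinAt_slice (contDiffOn_fderiv_slice hU hH v) ht hz
  refine h1.congr_deriv ?_
  have h2 : fderivWithin ℝ (fun p : ℝ × Cn n => fderiv ℝ (fun w => H (p.1, w)) p.2 v) S (t, z) =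
      fderivWithin ℝ (fun p => fderivWithin ℝ H S p (0, v)) S (t, z) :=
    fderivWithin_congr (fun p hp => fderiv_slice hU hH hp.1 hp.2 v) (fderiv_slice hU hH ht hz v)
  have h3 : fderivWithin ℝ (fun p : ℝ × Cn n => derivWithin (fun s => H (s, p.2)) (Set.Icc 0 1) p.1)
      S (t, z) = fderivWithin ℝ (fun p => fderivWithin ℝ H S p (1, 0)) S (t, z) :=
    fderivWithin_congr (fun p hp => derivWithin_slice hH hp.1 hp.2) (derivWithin_slice hH ht hz)
  rw [h2, happly, fderiv_slice hU (contDiffOn_derivWithin hU hH) ht hz, h3, happly, hsymm.eq]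

end General

section Wirtinger

variable {H : ℝ × Cn n → ℂ}

lemma contDiffOn_dz_slice (hU : IsOpen U) (hH : ContDiffOn ℝ ∞ H (Set.Icc (0 : ℝ) 1 ×ˢ U))
    (j : Fin n) : ContDiffOn ℝ ∞ (fun p : ℝ × Cn n => dz j (fun w => H (p.1, w)) p.2)
      (Set.Icc (0 : ℝ) 1 ×ˢ U) :=
  contDiffOn_const.mul ((contDiffOn_fderiv_slice hU hH _).sub
    (contDiffOn_const.mul (contDiffOn_fderiv_slice hU hH _)))

lemma contDiffOn_dzbar_slice (hU : IsOpen U) (hH : ContDiffOn ℝ ∞ H (Set.Icc (0 : ℝ) 1 ×ˢ U))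
    (j : Fin n) : ContDiffOn ℝ ∞ (fun p : ℝ × Cn n => dzbar j (fun w => H (p.1, w)) p.2)
      (Set.Icc (0 : ℝ) 1 ×ˢ U) :=
  contDiffOn_const.mul ((contDiffOn_fderiv_slice hU hH _).add
    (contDiffOn_const.mul (contDiffOn_fderiv_slice hU hH _)))

lemma hasDerivWithinAt_dz_slice (hU : IsOpen U)
    (hH : ContDiffOn ℝ ∞ H (Set.Icc (0 : ℝ) 1 ×ˢ U)) {t : ℝ} (ht : t ∈ Set.Icc (0 : ℝ) 1)
    {z : Cn n} (hz : z ∈ U) (j : Fin n) :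
    HasDerivWithinAt (fun s => dz j (fun w => H (s, w)) z)
      (dz j (fun w => derivWithin (fun s => H (s, w)) (Set.Icc 0 1) t) z) (Set.Icc 0 1) t :=
  ((hasDerivWithinAt_fderiv_slice hU hH ht hz _).fun_sub
    ((hasDerivWithinAt_fderiv_slice hU hH ht hz _).const_mul _)).const_mul _

lemma hasDerivWithinAt_dzbar_slice (hU : IsOpen U)
    (hH : ContDiffOn ℝ ∞ H (Set.Icc (0 : ℝ) 1 ×ˢ U)) {t : ℝ} (ht : t ∈ Set.Icc (0 : ℝ) 1)
    {z : Cn n} (hz : z ∈ U) (j : Fin n) :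
    HasDerivWithinAt (fun s => dzbar j (fun w => H (s, w)) z)
      (dzbar j (fun w => derivWithin (fun s => H (s, w)) (Set.Icc 0 1) t) z) (Set.Icc 0 1) t :=
  ((hasDerivWithinAt_fderiv_slice hU hH ht hz _).fun_add
    ((hasDerivWithinAt_fderiv_slice hU hH ht hz _).const_mul _)).const_mul _

variable {G : ℝ × Cn n → ℝ}

lemma contDiffOn_ofReal_slab {s : Set (ℝ × Cn n)} (hG : ContDiffOn ℝ ∞ G s) :
    ContDiffOn ℝ ∞ (fun p => (G p : ℂ)) s :=
  Complex.ofRealCLM.contDiff.comp_contDiffOn hG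

lemma contDiffOn_complexHessian_slice (hU : IsOpen U)
    (hG : ContDiffOn ℝ ∞ G (Set.Icc (0 : ℝ) 1 ×ˢ U)) (j k : Fin n) :
    ContDiffOn ℝ ∞ (fun p : ℝ × Cn n => complexHessian (fun w => G (p.1, w)) p.2 j k)
      (Set.Icc (0 : ℝ) 1 ×ˢ U) :=
  contDiffOn_dz_slice hU (contDiffOn_dzbar_slice hU (contDiffOn_ofReal_slab hG) k) j

lemma hasDerivWithinAt_complexHessian_slice (hU : IsOpen U)
    (hG : ContDiffOn ℝ ∞ G (Set.Icc (0 : ℝ) 1 ×ˢ U)) {t : ℝ} (ht : t ∈ Set.Icc (0 : ℝ) 1)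
    {z : Cn n} (hz : z ∈ U) (j k : Fin n) :
    HasDerivWithinAt (fun s => complexHessian (fun w => G (s, w)) z j k)
      (complexHessian (fun w => derivWithin (fun s => G (s, w)) (Set.Icc 0 1) t) z j k)
      (Set.Icc 0 1) t := by
  have hG' := contDiffOn_ofReal_slab hG
  have huniq := uniqueDiffOn_Icc (zero_lt_one (α := ℝ)) t ht
  refine (hasDerivWithinAt_dz_slice hU (contDiffOn_dzbar_slice hU hG' k) ht hz j).congr_deriv ?_
  rw [complexHessian_apply]
  refine dz_congr ?_
  filter_upwards [hU.mem_nhds hz] with w hw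
  rw [(hasDerivWithinAt_dzbar_slice hU hG' ht hw k).derivWithin huniq]
  refine dzbar_congr ?_
  filter_upwards [hU.mem_nhds hw] with v hv
  have h1 := hasDerivWithinAt_slice hG ht hv
  rw [h1.ofReal_comp.derivWithin huniq, h1.derivWithin huniq]

end Wirtinger

/-- Jacobi's formula for the derivative of a determinant. -/
lemma hasDerivWithinAt_det {B : ℝ → Matrix (Fin n) (Fin n) ℂ} {B' : Matrix (Fin n) (Fin n) ℂ}
    {s : Set ℝ} {t : ℝ} (hB : ∀ j k, HasDerivWithinAt (fun t => B t j k) (B' j k) s t) :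
    HasDerivWithinAt (fun t => (B t).det) (B' * (B t).adjugate).trace s t := by
  simp only [Matrix.det_apply']
  have h1 : ∀ σ : Equiv.Perm (Fin n), HasDerivWithinAt
      (fun t => ((Equiv.Perm.sign σ : ℤ) : ℂ) * ∏ i, B t (σ i) i)
      (((Equiv.Perm.sign σ : ℤ) : ℂ) * ∑ i, (∏ l ∈ Finset.univ.erase i, B t (σ l) l) • B' (σ i) i)
      s t := fun σ => (HasDerivWithinAt.fun_finsetProd fun i _ => hB (σ i) i).const_mul _
  refine (HasDerivWithinAt.fun_sum fun σ _ => h1 σ).congr_deriv ?_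
  simp only [Matrix.trace, Matrix.diag, Matrix.mul_apply, adjugate_eq_sum_perm, Finset.mul_sum]
  rw [Finset.sum_comm]
  conv_rhs => rw [Finset.sum_comm]
  refine Finset.sum_congr rfl fun i _ => ?_
  conv_rhs => rw [Finset.sum_comm]
  refine Finset.sum_congr rfl fun σ _ => ?_
  simp only [ite_mul, zero_mul, mul_ite, mul_zero, Finset.sum_ite_eq, Finset.mem_univ, if_true,
    smul_eq_mul]
  ring

end Time

/-! ### Integration in time of densities with a singular factor -/

section TimeIntegral

variable {n : ℕ} {M : Type*} [TopologicalSpace M] [ChartedSpace (Cn n) M]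

variable (n) in
/-- `f` is locally integrable in each of the preferred charts. -/
def IsLocallyIntegrable (f : M → ℝ) : Prop :=
  ∀ x : M, LocallyIntegrableOn (fun z => f ((chartAt (Cn n) x).symm z)) (chartAt (Cn n) x).target

variable [T2Space M] [CompactSpace M]

variable (n) in
/-- The compact support of the `x`-th function of the partition of unity, in the chart at `x`. -/
def chartSupport (x : M) : Set (Cn n) :=
  chartAt (Cn n) x '' tsupport (chartPartition n M x)

lemma isCompact_chartSupport (x : M) : IsCompact (chartSupport n x) :=
  (isClosed_tsupport _).isCompact.image_of_continuousOn
    ((chartAt (Cn n) x).continuousOn.mono (chartPartition_isSubordinate x))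

lemma chartSupport_subset (x : M) : chartSupport n x ⊆ (chartAt (Cn n) x).target := by
  rintro _ ⟨p, hp, rfl⟩
  exact (chartAt (Cn n) x).map_source (chartPartition_isSubordinate x hp)

lemma chartPartition_symm_eq_zero {x : M} {z : Cn n} (hz : z ∈ (chartAt (Cn n) x).target)
    (hz' : z ∉ chartSupport n x) : chartPartition n M x ((chartAt (Cn n) x).symm z) = 0 := by
  by_contra h
  exact hz' ⟨_, subset_tsupport _ h, (chartAt (Cn n) x).right_inv hz⟩

lemma setIntegral_chartSupport (x : M) (g : Cn n → ℝ) :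
    ∫ z in (chartAt (Cn n) x).target, chartPartition n M x ((chartAt (Cn n) x).symm z) * g z =
      ∫ z in chartSupport n x, chartPartition n M x ((chartAt (Cn n) x).symm z) * g z :=
  setIntegral_eq_of_subset_of_forall_sdiff_eq_zero (chartAt (Cn n) x).open_target.measurableSet
    (chartSupport_subset x) fun z hz => by rw [chartPartition_symm_eq_zero hz.1 hz.2, zero_mul]

lemma integrableOn_chartPartition_mul {f : M → ℝ} (hf : IsLocallyIntegrable n f) (x : M) :
    IntegrableOn (fun z => chartPartition n M x ((chartAt (Cn n) x).symm z) *
      f ((chartAt (Cn n) x).symm z)) (chartSupport n x) := by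
  have h1 := (hf x).integrableOn_compact_subset (chartSupport_subset x) (isCompact_chartSupport x)
  refine Integrable.bdd_mul h1 (c := 1) ?_ (Eventually.of_forall fun z => ?_)
  · refine ContinuousOn.aestronglyMeasurable ?_ (isCompact_chartSupport x).measurableSet
    exact (chartPartition n M x).continuous.comp_continuousOn
      ((chartAt (Cn n) x).continuousOn_symm.mono (chartSupport_subset x))
  · rw [Real.norm_eq_abs, abs_of_nonneg ((chartPartition n M).nonneg _ _)]
    exact (chartPartition n M).le_one _ _

lemma IsLocallyIntegrable.isIntegrable {f : M → ℝ} (hf : IsLocallyIntegrable n f)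
    {k : Chart n M → Cn n → ℝ}
    (hk : ∀ x : M, ContinuousOn (k (chartAt (Cn n) x)) (chartAt (Cn n) x).target) :
    IsIntegrable fun e z => f (e.symm z) * k e z := by
  intro x
  have h1 : IntegrableOn (fun z => chartPartition n M x ((chartAt (Cn n) x).symm z) *
      (f ((chartAt (Cn n) x).symm z) * k (chartAt (Cn n) x) z)) (chartSupport n x) := by
    simp only [← mul_assoc]
    exact (integrableOn_chartPartition_mul hf x).mul_continuousOn
      ((hk x).mono (chartSupport_subset x)) (isCompact_chartSupport x)
  exact h1.of_forall_sdiff_eq_zero (chartAt (Cn n) x).open_target.measurableSet fun z hz => by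
    rw [chartPartition_symm_eq_zero hz.1 hz.2, zero_mul]

lemma integrable_prod_chartSupport {f : M → ℝ} (hf : IsLocallyIntegrable n f)
    {k : ℝ → Chart n M → Cn n → ℝ}
    (hk : ∀ x : M, ContinuousOn (fun p : ℝ × Cn n => k p.1 (chartAt (Cn n) x) p.2)
      (Set.Icc 0 1 ×ˢ (chartAt (Cn n) x).target)) (x : M) :
    Integrable (fun p : ℝ × Cn n => chartPartition n M x ((chartAt (Cn n) x).symm p.2) *
      (f ((chartAt (Cn n) x).symm p.2) * k p.1 (chartAt (Cn n) x) p.2))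
      ((volume.restrict (Set.Ioc 0 1)).prod (volume.restrict (chartSupport n x))) := by
  have hc : ContinuousOn (fun p : ℝ × Cn n => k p.1 (chartAt (Cn n) x) p.2)
      (Set.Icc 0 1 ×ˢ chartSupport n x) :=
    (hk x).mono (Set.prod_mono_right (chartSupport_subset x))
  obtain ⟨C, hC⟩ := (isCompact_Icc.prod (isCompact_chartSupport x)).exists_bound_of_continuousOn hc
  have hm : MeasurableSet (Set.Ioc (0 : ℝ) 1 ×ˢ chartSupport n x) :=
    measurableSet_Ioc.prod (isCompact_chartSupport x).measurableSet
  have h1 := (integrableOn_chartPartition_mul hf x).comp_snd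
    ((volume : Measure ℝ).restrict (Set.Ioc 0 1))
  simp only [← mul_assoc]
  rw [Measure.prod_restrict] at h1 ⊢
  refine Integrable.mul_bdd (c := C) h1 ?_ ?_
  · exact (hc.mono (Set.prod_mono_left Set.Ioc_subset_Icc_self)).aestronglyMeasurable hm
  · filter_upwards [ae_restrict_mem hm] with p hp
    exact hC p ⟨Set.Ioc_subset_Icc_self hp.1, hp.2⟩

lemma intervalIntegrable_integral {f : M → ℝ} (hf : IsLocallyIntegrable n f)
    {k : ℝ → Chart n M → Cn n → ℝ}
    (hk : ∀ x : M, ContinuousOn (fun p : ℝ × Cn n => k p.1 (chartAt (Cn n) x) p.2)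
      (Set.Icc 0 1 ×ˢ (chartAt (Cn n) x).target)) :
    IntervalIntegrable (fun t => integral fun e z => f (e.symm z) * k t e z) volume 0 1 := by
  simp only [integral_eq_sum, setIntegral_chartSupport]
  rw [intervalIntegrable_iff_integrableOn_Ioc_of_le zero_le_one]
  exact integrable_finsetSum _ fun x _ => (integrable_prod_chartSupport hf hk x).integral_prod_left

/-- Integration in time under the integral sign. -/
lemma intervalIntegral_integral {f : M → ℝ} (hf : IsLocallyIntegrable n f)
    {k A : ℝ → Chart n M → Cn n → ℝ}
    (hk : ∀ x : M, ContinuousOn (fun p : ℝ × Cn n => k p.1 (chartAt (Cn n) x) p.2)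
      (Set.Icc 0 1 ×ˢ (chartAt (Cn n) x).target))
    (hA : ∀ x : M, ∀ z ∈ (chartAt (Cn n) x).target, ∀ t ∈ Set.Icc (0 : ℝ) 1,
      HasDerivWithinAt (fun t => A t (chartAt (Cn n) x) z) (k t (chartAt (Cn n) x) z)
        (Set.Icc 0 1) t) :
    ∫ t in (0 : ℝ)..1, integral (fun e z => f (e.symm z) * k t e z) =
      integral fun e z => f (e.symm z) * (A 1 e z - A 0 e z) := by
  have hFTC : ∀ x : M, ∀ z ∈ (chartAt (Cn n) x).target,
      ∫ t in Set.Ioc (0 : ℝ) 1, k t (chartAt (Cn n) x) z =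
        A 1 (chartAt (Cn n) x) z - A 0 (chartAt (Cn n) x) z := by
    intro x z hz
    rw [← intervalIntegral.integral_of_le zero_le_one]
    refine intervalIntegral.integral_eq_sub_of_hasDerivAt_of_le zero_le_one
      (fun t ht => (hA x z hz t ht).continuousWithinAt)
      (fun t ht => (hA x z hz t (Set.Ioo_subset_Icc_self ht)).hasDerivAt
        (Icc_mem_nhds ht.1 ht.2)) ?_
    refine ContinuousOn.intervalIntegrable_of_Icc zero_le_one ?_
    exact (hk x).comp (f := fun t : ℝ => (t, z)) (by fun_prop) fun t ht => ⟨ht, hz⟩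
  simp only [integral_eq_sum, setIntegral_chartSupport]
  rw [intervalIntegral.integral_of_le zero_le_one,
    integral_finsetSum _ fun x _ => (integrable_prod_chartSupport hf hk x).integral_prod_left]
  refine Finset.sum_congr rfl fun x _ => ?_
  rw [integral_integral_swap (integrable_prod_chartSupport hf hk x)]
  refine setIntegral_congr_fun (isCompact_chartSupport x).measurableSet fun z hz => ?_
  simp only [integral_const_mul, hFTC x z (chartSupport_subset x hz)]

end TimeIntegral

/-! ### Smooth functions, holomorphic charts and local potentials -/

section

variable {n : ℕ} {X : Type*} [TopologicalSpace X]

lemma eventually_symm_mem (e : Chart n X) {x : X} (hx : x ∈ e.source) {O : Set X}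
    (hO : O ∈ 𝓝 x) : ∀ᶠ z in 𝓝 (e x), z ∈ e.target ∧ e.symm z ∈ O := by
  refine (e.open_target.eventually_mem (e.map_source hx)).and ?_
  have h := (e.continuousAt_symm (e.map_source hx))
  rw [ContinuousAt, e.left_inv hx] at h
  exact h hO

lemma eventually_symm_symm (e κ : Chart n X) {x : X} (hx : x ∈ e.source) (hx' : x ∈ κ.source) :
    ∀ᶠ z in 𝓝 (e x), κ.symm (κ (e.symm z)) = e.symm z :=
  (eventually_symm_mem e hx (κ.open_source.mem_nhds hx')).mono fun _ hz => κ.left_inv hz.2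

/-- The complex Hessian in a chart of the atlas, by way of another holomorphic chart. -/
lemma complexHessian_symm_eq {u : X → ℝ} {x : X} {e κ : Chart n X} (hx : x ∈ e.source)
    (hx' : x ∈ κ.source) : complexHessian (fun z => u (e.symm z)) (e x) =
      complexHessian (fun z => u (κ.symm (κ (e.symm z)))) (e x) := by
  refine complexHessian_congr ?_
  filter_upwards [eventually_symm_symm e κ hx hx'] with z hz
  rw [hz]

end

section Charts

variable {n : ℕ} {X : Type*} [TopologicalSpace X] [ChartedSpace (Cn n) X]

lemma contDiffAt_transition [IsManifold 𝓘(ℂ, Cn n) ω X] {e e' : Chart n X}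
    (he : e ∈ atlas (Cn n) X) (he' : e' ∈ atlas (Cn n) X) {x : X} (hx : x ∈ e.source)
    (hx' : x ∈ e'.source) : ContDiffAt ℂ ∞ (fun z => e' (e.symm z)) (e x) := by
  have h1 : e.symm ≫ₕ e' ∈ contDiffGroupoid ω 𝓘(ℂ, Cn n) :=
    StructureGroupoid.compatible _ he he'
  have h2 := contMDiffOn_iff_contDiffOn.1 (contMDiffOn_of_mem_contDiffGroupoid h1)
  have h3 : e x ∈ (e.symm ≫ₕ e').source := by simp [hx', e.left_inv hx, e.map_source hx]
  exact (h2.contDiffAt ((e.symm ≫ₕ e').open_source.mem_nhds h3)).of_le le_top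

lemma contDiffAt_real_of_complex {E F : Type*} [NormedAddCommGroup E] [NormedSpace ℂ E]
    [NormedAddCommGroup F] [NormedSpace ℂ F] {f : E → F} {z : E}
    (hf : ContDiffAt ℂ ∞ f z) : ContDiffAt ℝ ∞ f z := hf.restrict_scalars ℝ

variable (n X) in
/-- A complex manifold is a smooth real manifold. -/
lemma isManifold_real [IsManifold 𝓘(ℂ, Cn n) ω X] : IsManifold 𝓘(ℝ, Cn n) ∞ X := by
  refine isManifold_of_contDiffOn _ _ _ fun e e' he he' z hz => ?_
  have hz' : z ∈ (e.symm ≫ₕ e').source := by simpa using hz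
  simp only [OpenPartialHomeomorph.trans_source, OpenPartialHomeomorph.symm_source,
    Set.mem_inter_iff, Set.mem_preimage] at hz'
  have h := contDiffAt_transition he he' (e.map_target hz'.1) hz'.2
  rw [e.right_inv hz'.1] at h
  exact (contDiffAt_real_of_complex h).contDiffWithinAt

/-- `u` is smooth at `x`, seen in any chart of the atlas. -/
def SmoothAt (n : ℕ) {X : Type*} [TopologicalSpace X] [ChartedSpace (Cn n) X] (u : X → ℝ)
    (x : X) : Prop :=
  ∀ e ∈ atlas (Cn n) X, x ∈ e.source → ContDiffAt ℝ ∞ (fun z => u (e.symm z)) (e x)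

/-- The form `α` is `√-1 ∂∂̄ P` at the point `x`, in each chart of the atlas. -/
def HasPotentialAt (α : LocalForm n X) (P : X → ℝ) (x : X) : Prop :=
  ∀ e ∈ atlas (Cn n) X, x ∈ e.source → α e (e x) = complexHessian (fun z => P (e.symm z)) (e x)

/-- `κ` is a holomorphic chart: the coordinate changes between `κ` and the charts of the atlas are
holomorphic. -/
structure IsHolomorphicChart (κ : Chart n X) : Prop where
  toChart : ∀ e ∈ atlas (Cn n) X, ∀ x ∈ κ.source, x ∈ e.source →
    ContDiffAt ℂ ∞ (fun z => κ (e.symm z)) (e x)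
  fromChart : ∀ e ∈ atlas (Cn n) X, ∀ x ∈ κ.source, x ∈ e.source →
    ContDiffAt ℂ ∞ (fun w => e (κ.symm w)) (κ x)

lemma isHolomorphicChart_of_mem_atlas [IsManifold 𝓘(ℂ, Cn n) ω X] {κ : Chart n X}
    (hκ : κ ∈ atlas (Cn n) X) : IsHolomorphicChart κ :=
  ⟨fun _ he _ hx hx' => contDiffAt_transition he hκ hx' hx,
    fun _ he _ hx hx' => contDiffAt_transition hκ he hx hx'⟩

variable {u v : X → ℝ} {x : X} {κ : Chart n X}

lemma SmoothAt.of_chart [IsManifold 𝓘(ℂ, Cn n) ω X] {e : Chart n X} (he : e ∈ atlas (Cn n) X)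
    (hx : x ∈ e.source) (hu : ContDiffAt ℝ ∞ (fun z => u (e.symm z)) (e x)) : SmoothAt n u x := by
  intro e' he' hx'
  have h1 := contDiffAt_real_of_complex (contDiffAt_transition he' he hx' hx)
  have h2 : ContDiffAt ℝ ∞ (fun z => u (e.symm z)) (e (e'.symm (e' x))) := by
    rwa [e'.left_inv hx']
  refine (h2.comp (e' x) h1).congr_of_eventuallyEq ?_
  filter_upwards [eventually_symm_symm e' e hx' hx] with z hz
  simp only [Function.comp_apply, hz]

lemma SmoothAt.comp_symm (hu : SmoothAt n u x) (hκ : IsHolomorphicChart κ) (hx : x ∈ κ.source) :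
    ContDiffAt ℝ ∞ (fun w => u (κ.symm w)) (κ x) := by
  have hxe := mem_chart_source (Cn n) x
  have hu' := hu _ (chart_mem_atlas _ x) hxe
  have h1 := contDiffAt_real_of_complex (hκ.fromChart _ (chart_mem_atlas _ x) x hx hxe)
  have h2 : ContDiffAt ℝ ∞ (fun z => u ((chartAt (Cn n) x).symm z))
      (chartAt (Cn n) x (κ.symm (κ x))) := by
    rwa [κ.left_inv hx]
  refine (h2.comp (κ x) h1).congr_of_eventuallyEq ?_
  filter_upwards [eventually_symm_symm κ _ hx hxe] with z hz
  simp only [Function.comp_apply, hz]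

lemma SmoothAt.congr (hu : SmoothAt n u x) (h : v =ᶠ[𝓝 x] u) : SmoothAt n v x := by
  intro e he hx
  refine (hu e he hx).congr_of_eventuallyEq ?_
  exact (eventually_symm_mem e hx h).mono fun z hz => hz.2

lemma SmoothAt.add (hu : SmoothAt n u x) (hv : SmoothAt n v x) :
    SmoothAt n (fun x => u x + v x) x := fun e he hx => (hu e he hx).add (hv e he hx)

lemma SmoothAt.sub (hu : SmoothAt n u x) (hv : SmoothAt n v x) :
    SmoothAt n (fun x => u x - v x) x := fun e he hx => (hu e he hx).sub (hv e he hx)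

lemma SmoothAt.mul (hu : SmoothAt n u x) (hv : SmoothAt n v x) :
    SmoothAt n (fun x => u x * v x) x := fun e he hx => (hu e he hx).mul (hv e he hx)

lemma SmoothAt.log (hu : SmoothAt n u x) (h0 : u x ≠ 0) :
    SmoothAt n (fun x => Real.log (u x)) x := fun e he hx =>
  (hu e he hx).log (by rwa [e.left_inv hx])

lemma smoothAt_const (c : ℝ) : SmoothAt n (fun _ : X => c) x := fun _ _ _ => contDiffAt_const

lemma SmoothAt.continuousAt (hu : SmoothAt n u x) : ContinuousAt u x := by
  have hxe := mem_chart_source (Cn n) x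
  have h1 := (hu _ (chart_mem_atlas _ x) hxe).continuousAt
  have h2 : ContinuousAt (fun y => u ((chartAt (Cn n) x).symm (chartAt (Cn n) x y))) x :=
    h1.comp ((chartAt (Cn n) x).continuousAt hxe)
  refine h2.congr ?_
  filter_upwards [(chartAt (Cn n) x).open_source.mem_nhds hxe] with y hy
  rw [(chartAt (Cn n) x).left_inv hy]

lemma smoothAt_of_contMDiff [IsManifold 𝓘(ℂ, Cn n) ω X]
    (hu : ContMDiff 𝓘(ℝ, Cn n) 𝓘(ℝ, ℝ) ∞ u) (x : X) : SmoothAt n u x := by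
  intro e he hx
  have := isManifold_real n X
  have h1 : ContMDiffOn 𝓘(ℝ, Cn n) 𝓘(ℝ, Cn n) ∞ e.symm e.target :=
    contMDiffOn_symm_of_mem_maximalAtlas (IsManifold.subset_maximalAtlas he)
  have h2 := contMDiffOn_iff_contDiffOn.1 (hu.comp_contMDiffOn h1)
  exact h2.contDiffAt (e.open_target.mem_nhds (e.map_source hx))

lemma hasPotentialAt_ddbar (u : X → ℝ) (x : X) : HasPotentialAt (ddbar u : LocalForm n X) u x := by
  intro e _ hx
  rfl

lemma HasPotentialAt.add {α α' : LocalForm n X} {P P' : X → ℝ} (hα : HasPotentialAt α P x)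
    (hα' : HasPotentialAt α' P' x) (hP : SmoothAt n P x) (hP' : SmoothAt n P' x) :
    HasPotentialAt (α + α') (fun x => P x + P' x) x := by
  intro e he hx
  rw [complexHessian_add (hP e he hx) (hP' e he hx), ← hα e he hx, ← hα' e he hx]
  rfl

/-- Minus the logarithm of the weight of a metric on `-K_X` is a local potential of its curvature
form. -/
lemma hasPotentialAt_of_hasCurvature [IsManifold 𝓘(ℂ, Cn n) ω X] {ω₀ : LocalForm n X}
    (hω₀ : IsKahlerForm ω₀) {h : AnticanonicalMetric n X} (hcurv : h.HasCurvature ω₀)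
    {e : Chart n X} (he : e ∈ atlas (Cn n) X) (hx : x ∈ e.source) :
    HasPotentialAt ω₀ (fun x => -Real.log (h.weight e (e x))) x := by
  intro e' he' hx'
  have hT := contDiffAt_transition he' he hx' hx
  have hex : e (e'.symm (e' x)) = e x := by rw [e'.left_inv hx']
  have hw : ContDiffAt ℝ ∞ (fun z => -Real.log (h.weight e z)) (e (e'.symm (e' x))) := by
    rw [hex]
    have hxt := e.map_source hx
    exact (((h.smooth e he).contDiffAt (e.open_target.mem_nhds hxt)).log
      (h.pos e he _ hxt).ne').neg
  rw [hω₀.compatible e' he' e he x ⟨hx', hx⟩, hcurv e he _ (e.map_source hx),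
    complexHessian_comp (u := fun z => -Real.log (h.weight e z)) hT hw, hex, complexHessian_neg]
  rfl

lemma smoothAt_log_weight [IsManifold 𝓘(ℂ, Cn n) ω X] (h : AnticanonicalMetric n X)
    {e : Chart n X} (he : e ∈ atlas (Cn n) X) (hx : x ∈ e.source) :
    SmoothAt n (fun x => -Real.log (h.weight e (e x))) x := by
  have hxt := e.map_source hx
  refine SmoothAt.of_chart he hx ?_
  have h1 : ContDiffAt ℝ ∞ (fun z => -Real.log (h.weight e z)) (e x) :=
    (((h.smooth e he).contDiffAt (e.open_target.mem_nhds hxt)).log (h.pos e he _ hxt).ne').neg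
  refine h1.congr_of_eventuallyEq ?_
  filter_upwards [e.open_target.mem_nhds hxt] with z hz
  rw [e.right_inv hz]

lemma normSq_eq (h : AnticanonicalMetric n X) (S : AnticanonicalSection n X)
    {e : Chart n X} (he : e ∈ atlas (Cn n) X) (hx : x ∈ e.source) :
    normSq h S x = h.weight e (e x) * ‖S.coeff e (e x)‖ ^ 2 := by
  have hx' := mem_chart_source (Cn n) x
  have h1 := h.compatible _ (chart_mem_atlas (Cn n) x) e he x ⟨hx', hx⟩
  have h2 := S.compatible _ (chart_mem_atlas (Cn n) x) e he x ⟨hx', hx⟩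
  rw [normSq, h1, h2, norm_mul]
  ring

lemma normSq_nonneg (h : AnticanonicalMetric n X) (S : AnticanonicalSection n X) (x : X) :
    0 ≤ normSq h S x :=
  mul_nonneg (h.pos _ (chart_mem_atlas (Cn n) x) _ (mem_chart_target _ x)).le (by positivity)

lemma contDiffAt_coeff (S : AnticanonicalSection n X) {e : Chart n X} (he : e ∈ atlas (Cn n) X)
    {z : Cn n} (hz : z ∈ e.target) : ContDiffAt ℂ ∞ (S.coeff e) z :=
  (contDiffOn_of_differentiableOn e.open_target (S.holomorphic e he)).contDiffAt
    (e.open_target.mem_nhds hz)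

lemma smoothAt_normSq (h : AnticanonicalMetric n X) (S : AnticanonicalSection n X) (x : X) :
    SmoothAt n (normSq h S) x := by
  intro e he hx
  have hxt := e.map_source hx
  have h1 : ContDiffAt ℝ ∞ (fun z => h.weight e z * ‖S.coeff e z‖ ^ 2) (e x) :=
    ((h.smooth e he).contDiffAt (e.open_target.mem_nhds hxt)).mul
      ((contDiffAt_real_of_complex (contDiffAt_coeff S he hxt)).norm_sq ℝ)
  refine h1.congr_of_eventuallyEq ?_
  filter_upwards [e.open_target.mem_nhds hxt] with z hz
  rw [normSq_eq h S he (e.map_target hz), e.right_inv hz]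

lemma smoothAt_log_normSq_add (h : AnticanonicalMetric n X) (S : AnticanonicalSection n X)
    {ε : ℝ} (hε : 0 < ε) (x : X) : SmoothAt n (fun x => Real.log (normSq h S x + ε)) x :=
  ((smoothAt_normSq h S x).add (smoothAt_const ε)).log
    (by have := normSq_nonneg h S x; positivity)

end Charts

/-! ### Charts adapted to the divisor -/

section Adapted

variable {m : ℕ}

/-- The derivative of `z ↦ (z with the j₀-th coordinate replaced by s z)`, where `s` has derivative
`L`. -/
noncomputable def updateDeriv (j₀ : Fin (m + 1)) (L : Cn (m + 1) →L[ℂ] ℂ) :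
    Cn (m + 1) →L[ℂ] Cn (m + 1) :=
  ContinuousLinearMap.pi fun i => if i = j₀ then L else ContinuousLinearMap.proj i

lemma injective_updateDeriv {j₀ : Fin (m + 1)} {L : Cn (m + 1) →L[ℂ] ℂ}
    (hL : L (Pi.single j₀ 1) ≠ 0) : Function.Injective
    (updateDeriv j₀ L : Cn (m + 1) →ₗ[ℂ] Cn (m + 1)) := by
  rw [injective_iff_map_eq_zero]
  intro v hv
  have h1 : ∀ i, (if i = j₀ then L else ContinuousLinearMap.proj i) v = 0 := fun i =>
    congrFun hv i
  have h2 : ∀ i, i ≠ j₀ → v i = 0 := fun i hi => by simpa [hi] using h1 i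
  have h3 : v = v j₀ • (Pi.single j₀ 1 : Cn (m + 1)) := by
    ext i
    by_cases hi : i = j₀
    · subst hi; simp
    · simp [hi, h2 i hi]
  have h4 : L v = 0 := by simpa using h1 j₀
  rw [h3, map_smul, smul_eq_mul, mul_eq_zero] at h4
  rw [h3, h4.resolve_right hL, zero_smul]

/-- `updateDeriv` as a linear equivalence, if `∂s/∂z_{j₀} ≠ 0`. -/
noncomputable def updateDerivEquiv (j₀ : Fin (m + 1)) (L : Cn (m + 1) →L[ℂ] ℂ)
    (hL : L (Pi.single j₀ 1) ≠ 0) : Cn (m + 1) ≃L[ℂ] Cn (m + 1) :=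
  (LinearEquiv.ofInjectiveEndo _ (injective_updateDeriv hL)).toContinuousLinearEquiv

lemma hasFDerivAt_update {j₀ : Fin (m + 1)} {s : Cn (m + 1) → ℂ} {z : Cn (m + 1)}
    (hs : DifferentiableAt ℂ s z) (hL : fderiv ℂ s z (Pi.single j₀ 1) ≠ 0) :
    HasFDerivAt (fun z => Function.update z j₀ (s z))
      (updateDerivEquiv j₀ (fderiv ℂ s z) hL : Cn (m + 1) →L[ℂ] Cn (m + 1)) z := by
  have h1 : (updateDerivEquiv j₀ (fderiv ℂ s z) hL : Cn (m + 1) →L[ℂ] Cn (m + 1)) =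
      updateDeriv j₀ (fderiv ℂ s z) := by ext; rfl
  rw [h1, updateDeriv, hasFDerivAt_pi]
  intro i
  by_cases hi : i = j₀
  · subst hi
    simpa using hs.hasFDerivAt
  · simp only [ne_eq, hi, not_false_eq_true, Function.update_of_ne, if_false]
    exact (ContinuousLinearMap.proj (R := ℂ) (φ := fun _ : Fin (m + 1) => ℂ) i).hasFDerivAt

lemma contDiffAt_update {j₀ : Fin (m + 1)} {s : Cn (m + 1) → ℂ} {z : Cn (m + 1)}
    (hs : ContDiffAt ℂ ∞ s z) : ContDiffAt ℂ ∞ (fun z => Function.update z j₀ (s z)) z := by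
  rw [contDiffAt_pi]
  intro i
  by_cases hi : i = j₀
  · subst hi
    simpa using hs
  · simp only [ne_eq, hi, not_false_eq_true, Function.update_of_ne]
    exact (contDiff_apply ℂ ℂ i).contDiffAt

lemma exists_apply_single_ne_zero {L : Cn (m + 1) →L[ℂ] ℂ} (hL : L ≠ 0) :
    ∃ j₀, L (Pi.single j₀ 1) ≠ 0 := by
  by_contra! h
  refine hL (ContinuousLinearMap.ext fun v => ?_)
  have h1 : v = ∑ i, v i • (Pi.single i 1 : Cn (m + 1)) := by
    rw [← Finset.univ_sum_single v]
    refine Finset.sum_congr rfl fun i _ => ?_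
    rw [← Pi.single_smul, Finset.univ_sum_single]
    simp
  rw [h1, map_sum]
  simp [h]

variable {X : Type*} [TopologicalSpace X] [ChartedSpace (Cn (m + 1)) X]

/-- Near a point of the divisor of `S`, the local coefficient of `S` is a coordinate of a
holomorphic chart. -/
lemma exists_adaptedChart [IsManifold 𝓘(ℂ, Cn (m + 1)) ω X] (S : AnticanonicalSection (m + 1) X)
    {e : Chart (m + 1) X} (he : e ∈ atlas (Cn (m + 1)) X) {p : X} (hp : p ∈ e.source)
    (hS : fderiv ℂ (S.coeff e) (e p) ≠ 0) :
    ∃ (κ : Chart (m + 1) X) (j₀ : Fin (m + 1)), IsHolomorphicChart κ ∧ p ∈ κ.source ∧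
      κ.source ⊆ e.source ∧ ∀ x ∈ κ.source, κ x j₀ = S.coeff e (e x) := by
  obtain ⟨j₀, hj₀⟩ := exists_apply_single_ne_zero hS
  set s := S.coeff e with hs
  have hsm : ∀ z ∈ e.target, ContDiffAt ℂ ∞ s z := fun z hz => contDiffAt_coeff S he hz
  have hsd : ∀ z ∈ e.target, DifferentiableAt ℂ s z := fun z hz =>
    (hsm z hz).differentiableAt (by simp)
  have hpt := e.map_source hp
  set F : Cn (m + 1) → Cn (m + 1) := fun z => Function.update z j₀ (s z) with hF
  -- the inverse function theorem for `z ↦ (z with the j₀-th coordinate replaced by s z)`; the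
  -- domain is shrunk to make the inverse smooth everywhere on it
  set ψ₀ := (contDiffAt_update (j₀ := j₀) (hsm _ hpt)).toOpenPartialHomeomorph F
    (hasFDerivAt_update (hsd _ hpt) hj₀) (by simp) with hψ₀
  have hψ₀F : ⇑ψ₀ = F := ContDiffAt.toOpenPartialHomeomorph_coe _ _ _
  have hψ₀p : e p ∈ ψ₀.source := ContDiffAt.mem_toOpenPartialHomeomorph_source _ _ _
  set O : Set (Cn (m + 1)) := e.target ∩ {z | fderiv ℂ s z (Pi.single j₀ 1) ≠ 0} with hO
  have hOo : IsOpen O := by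
    have hc : ContinuousOn (fun z => fderiv ℂ s z (Pi.single j₀ 1)) e.target := fun z hz =>
      (((hsm z hz).fderiv_right (m := ∞) (by simp)).continuousAt.clm_apply
        continuousAt_const).continuousWithinAt
    exact hc.isOpen_inter_preimage e.open_target isOpen_ne
  set ψ := ψ₀.restrOpen O hOo with hψ
  have hψF : ⇑ψ = F := hψ₀F
  have hψs : ψ.source = ψ₀.source ∩ O := rfl
  have hκs : ∀ x, x ∈ (e ≫ₕ ψ).source ↔ x ∈ e.source ∧ e x ∈ ψ₀.source ∧ e x ∈ O := by
    intro x
    rw [OpenPartialHomeomorph.trans_source, hψs]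
    rfl
  have hκF : ∀ x, (e ≫ₕ ψ) x = F (e x) := fun x => by
    rw [OpenPartialHomeomorph.trans_apply, hψF]
  refine ⟨e ≫ₕ ψ, j₀, ⟨?_, ?_⟩, (hκs p).2 ⟨hp, hψ₀p, hpt, hj₀⟩, fun x hx => ((hκs x).1 hx).1, ?_⟩
  · intro e' he' x hx hx'
    have hxe := ((hκs x).1 hx).1
    simp only [hκF]
    have h1 : ContDiffAt ℂ ∞ F (e (e'.symm (e' x))) := by
      rw [e'.left_inv hx']
      exact contDiffAt_update (hsm _ (e.map_source hxe))
    exact h1.comp (e' x) (contDiffAt_transition he' he hx' hxe)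
  · intro e' he' x hx hx'
    obtain ⟨hxe, hxψ, hxO⟩ := (hκs x).1 hx
    have hxs : e x ∈ ψ.source := by rw [hψs]; exact ⟨hxψ, hxO⟩
    have hxt : ψ (e x) ∈ ψ.target := ψ.map_source hxs
    have hinv : ψ.symm (ψ (e x)) = e x := ψ.left_inv hxs
    have h1 : ContDiffAt ℂ ∞ ψ.symm (ψ (e x)) := by
      refine ψ.contDiffAt_symm (f₀' := updateDerivEquiv j₀ (fderiv ℂ s (e x)) hxO.2) hxt ?_ ?_
      · rw [hinv, hψF]
        exact hasFDerivAt_update (hsd _ hxO.1) hxO.2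
      · rw [hinv, hψF]
        exact contDiffAt_update (hsm _ hxO.1)
    have h2 := contDiffAt_transition he he' hxe hx'
    rw [← hinv] at h2
    exact h2.comp (ψ (e x)) h1
  · intro x hx
    rw [hκF]
    simp [hF]

end Adapted

/-! ### The singular potential `log (|S|² + ε) - log |S|²` -/

section LogDefect

variable {n : ℕ} {X : Type*} [TopologicalSpace X] [ChartedSpace (Cn n) X]

/-- The function `log (|S|² + ε) - log |S|²`, written as `log (1 + ε / |S|²)` so that its value on
the divisor is `0`. -/
noncomputable def logDefect (h : AnticanonicalMetric n X) (S : AnticanonicalSection n X) (ε : ℝ)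
    (x : X) : ℝ :=
  Real.log (1 + ε / normSq h S x)

/-- A local potential `log (|S|² + ε) - log h` of `χ_ε` on the domain of the chart `e`. -/
noncomputable def chiPotential (h : AnticanonicalMetric n X) (S : AnticanonicalSection n X) (ε : ℝ)
    (e : Chart n X) (x : X) : ℝ :=
  Real.log (normSq h S x + ε) + -Real.log (h.weight e (e x))

variable {h : AnticanonicalMetric n X} {S : AnticanonicalSection n X} {ε : ℝ} {x : X}

lemma logDefect_nonneg (hε : 0 ≤ ε) (x : X) : 0 ≤ logDefect h S ε x :=
  Real.log_nonneg (by have := normSq_nonneg h S x; linarith [div_nonneg hε this])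

lemma logDefect_mono {ε' : ℝ} (hε : 0 ≤ ε) (hε' : ε ≤ ε') (x : X) :
    logDefect h S ε x ≤ logDefect h S ε' x := by
  have h1 := normSq_nonneg h S x
  have h2 : ε / normSq h S x ≤ ε' / normSq h S x := div_le_div_of_nonneg_right hε' h1
  exact Real.log_le_log (by linarith [div_nonneg hε h1]) (by linarith)

lemma logDefect_eq (hε : 0 < ε) (hx : normSq h S x ≠ 0) :
    logDefect h S ε x = Real.log (normSq h S x + ε) - Real.log (normSq h S x) := by
  have h1 : 0 < normSq h S x := lt_of_le_of_ne (normSq_nonneg h S x) hx.symm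
  rw [logDefect, ← Real.log_div (by positivity) hx, add_div, div_self hx]

lemma logDefect_eq_chiPotential (hε : 0 < ε) {e : Chart n X} (he : e ∈ atlas (Cn n) X)
    (hxe : x ∈ e.source) (hx : S.coeff e (e x) ≠ 0) :
    logDefect h S ε x = chiPotential h S ε e x - Real.log (‖S.coeff e (e x)‖ ^ 2) := by
  have h1 := normSq_eq h S he hxe
  have h2 := (h.pos e he _ (e.map_source hxe)).ne'
  have h3 : ‖S.coeff e (e x)‖ ^ 2 ≠ 0 := by positivity
  rw [logDefect_eq hε (by rw [h1]; exact mul_ne_zero h2 h3), chiPotential]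
  nth_rw 2 [h1]
  rw [Real.log_mul h2 h3]
  ring

lemma smoothAt_logDefect (hε : 0 < ε) (hx : normSq h S x ≠ 0) :
    SmoothAt n (logDefect h S ε) x := by
  refine ((smoothAt_log_normSq_add h S hε x).sub ((smoothAt_normSq h S x).log hx)).congr ?_
  filter_upwards [(smoothAt_normSq h S x).continuousAt.eventually_ne hx] with y hy
  exact logDefect_eq hε hy

lemma normSq_eq_zero_iff (h : AnticanonicalMetric n X) {e : Chart n X} (he : e ∈ atlas (Cn n) X)
    (hxe : x ∈ e.source) : normSq h S x = 0 ↔ S.coeff e (e x) = 0 := by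
  rw [normSq_eq h S he hxe]
  simp [(h.pos e he _ (e.map_source hxe)).ne']

lemma mem_range_iff (h : AnticanonicalMetric n X) {m : ℕ} {Y : Type*} [TopologicalSpace Y]
    [ChartedSpace (Cn m) Y] {ι : Y → X} (hD : IsSmoothDivisor (m := m) S ι) :
    x ∈ Set.range ι ↔ normSq h S x = 0 := by
  rw [hD.range_eq, normSq_eq_zero_iff h (chart_mem_atlas (Cn n) x) (mem_chart_source (Cn n) x)]
  rfl

variable [IsManifold 𝓘(ℂ, Cn n) ω X]

lemma smoothAt_chiPotential (hε : 0 < ε) {e : Chart n X} (he : e ∈ atlas (Cn n) X)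
    (hx : x ∈ e.source) : SmoothAt n (chiPotential h S ε e) x :=
  (smoothAt_log_normSq_add h S hε x).add (smoothAt_log_weight h he hx)

variable {ω₀ : LocalForm n X}

lemma hasPotentialAt_chiEps (hω₀ : IsKahlerForm ω₀) (hcurv : h.HasCurvature ω₀) (hε : 0 < ε)
    {e : Chart n X} (he : e ∈ atlas (Cn n) X) (hx : x ∈ e.source) :
    HasPotentialAt (chiEps ω₀ h S ε) (chiPotential h S ε e) x :=
  (hasPotentialAt_ddbar _ x).add (hasPotentialAt_of_hasCurvature hω₀ hcurv he hx)
    (smoothAt_log_normSq_add h S hε x) (smoothAt_log_weight h he hx)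

/-- Away from the divisor `log (|S|² + ε) - log |S|²` is a potential of `χ_ε`, since there
`√-1 ∂∂̄ log |S|² = -ω₀`. -/
lemma hasPotentialAt_chiEps_logDefect (hω₀ : IsKahlerForm ω₀) (hcurv : h.HasCurvature ω₀)
    (hε : 0 < ε) (hx : normSq h S x ≠ 0) :
    HasPotentialAt (chiEps ω₀ h S ε) (logDefect h S ε) x := by
  intro e he hxe
  have hxt := e.map_source hxe
  rw [hasPotentialAt_chiEps hω₀ hcurv hε he hxe e he hxe]
  have hs : S.coeff e (e x) ≠ 0 := by
    intro h0
    exact hx (by rw [normSq_eq h S he hxe, h0]; simp)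
  have hsm := contDiffAt_coeff S he hxt
  have h1 : (fun z => chiPotential h S ε e (e.symm z)) =ᶠ[𝓝 (e x)] fun z =>
      logDefect h S ε (e.symm z) + Real.log (‖S.coeff e z‖ ^ 2) := by
    filter_upwards [e.open_target.mem_nhds hxt, hsm.continuousAt.eventually_ne hs] with z hz hz'
    rw [logDefect_eq_chiPotential hε he (e.map_target hz) (by rwa [e.right_inv hz]),
      e.right_inv hz]
    ring
  rw [complexHessian_congr h1, complexHessian_add (smoothAt_logDefect hε hx e he hxe),
    complexHessian_log_norm_sq hsm hs, add_zero]
  exact ((contDiffAt_real_of_complex hsm).norm_sq ℝ).log (by positivity)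

end LogDefect

section LocalIntegrability

/-- Local integrability of a function can be tested in any holomorphic chart. -/
lemma integrableAtFilter_symm {n : ℕ} {X : Type*} [TopologicalSpace X] [ChartedSpace (Cn n) X]
    {κ : Chart n X} (hκ : IsHolomorphicChart κ) {f : X → ℝ} {p : X} (hp : p ∈ κ.source)
    (hf : IntegrableAtFilter (fun w => f (κ.symm w)) (𝓝 (κ p))) {e : Chart n X}
    (he : e ∈ atlas (Cn n) X) (hpe : p ∈ e.source) :
    IntegrableAtFilter (fun z => f (e.symm z)) (𝓝 (e p)) := by
  obtain ⟨N₀, hN₀, hfN₀⟩ := hf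
  set O : Set (Cn n) := κ.target ∩ κ.symm ⁻¹' e.source with hO
  have hOo : IsOpen O := κ.isOpen_inter_preimage_symm e.open_source
  have hpO : κ p ∈ O := ⟨κ.map_source hp, by simpa [κ.left_inv hp] using hpe⟩
  obtain ⟨r, hr, hrN⟩ := Metric.nhds_basis_closedBall.mem_iff.1
    (Filter.inter_mem hN₀ (hOo.mem_nhds hpO))
  set N := Metric.closedBall (κ p) r with hN
  have hNc : IsCompact N := isCompact_closedBall _ _
  have hNO : N ⊆ O := fun w hw => (hrN hw).2
  have hT : ContDiffOn ℝ ∞ (fun w => e (κ.symm w)) O := by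
    intro w hw
    have h1 := contDiffAt_real_of_complex
      (hκ.fromChart e he (κ.symm w) (κ.map_target hw.1) hw.2)
    rw [κ.right_inv hw.1] at h1
    exact h1.contDiffWithinAt
  have hinj : Set.InjOn (fun w => e (κ.symm w)) N := fun w hw w' hw' h =>
    κ.symm.injOn (hNO hw).1 (hNO hw').1 (e.injOn (hNO hw).2 (hNO hw').2 h)
  -- the Jacobian of the coordinate change is bounded on the compact set `N`
  refine ⟨(fun w => e (κ.symm w)) '' N, ?_, ?_⟩
  · have h1 := (hκ.toChart e he p hp hpe).continuousAt
    have h2 : N ∈ 𝓝 (κ (e.symm (e p))) := by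
      rw [e.left_inv hpe]
      exact Metric.closedBall_mem_nhds _ hr
    filter_upwards [h1 h2, eventually_symm_mem e hpe (κ.open_source.mem_nhds hp)] with z hz hz'
    exact ⟨_, hz, by simp only [κ.left_inv hz'.2, e.right_inv hz'.1]⟩
  · refine (integrableOn_image_iff_integrableOn_abs_det_fderiv_smul volume hNc.measurableSet
      (fun w hw => ((hT.contDiffAt (hOo.mem_nhds (hNO hw))).differentiableAt
        (by simp)).hasFDerivAt.hasFDerivWithinAt) hinj _).2 ?_
    have h1 : ContinuousOn (fun w => |(fderiv ℝ (fun w => e (κ.symm w)) w).det|) N :=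
      (ContinuousLinearMap.continuous_det.comp_continuousOn
        ((hT.continuousOn_fderiv_of_isOpen hOo (by simp)).mono hNO)).abs
    have h2 : IntegrableOn (fun w => f (κ.symm w)) N := hfN₀.mono_set fun w hw => (hrN hw).1
    refine (h2.continuousOn_mul h1 hNc).congr_fun (fun w hw => ?_) hNc.measurableSet
    simp only [smul_eq_mul, e.left_inv (hNO hw).2]

lemma integrableAtFilter_of_eventually_continuousAt {E : Type*} [MeasurableSpace E]
    [TopologicalSpace E] [BorelSpace E] [LocallyCompactSpace E] [T2Space E]
    [SecondCountableTopology E] {μ : Measure E} [IsLocallyFiniteMeasure μ] {f : E → ℝ} {z : E}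
    (hf : ∀ᶠ w in 𝓝 z, ContinuousAt f w) : IntegrableAtFilter f (𝓝 z) μ := by
  obtain ⟨O, hO, hOo, hz⟩ := eventually_nhds_iff.1 hf
  have h1 : ContinuousOn f O := fun w hw => (hO w hw).continuousWithinAt
  have h2 := h1.locallyIntegrableOn (μ := μ) hOo.measurableSet z hz
  rwa [hOo.nhdsWithin_eq hz] at h2

variable {m : ℕ} {X : Type*} [TopologicalSpace X] [ChartedSpace (Cn (m + 1)) X]
  [IsManifold 𝓘(ℂ, Cn (m + 1)) ω X]
  {Y : Type*} [TopologicalSpace Y] [ChartedSpace (Cn m) Y]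
  {h : AnticanonicalMetric (m + 1) X} {S : AnticanonicalSection (m + 1) X} {ι : Y → X} {ε : ℝ}

/-- `log (|S|² + ε) - log |S|²` is locally integrable: along the divisor it differs from
`-log |w_{j₀}|²` by a smooth function, for a suitable coordinate `w_{j₀}`. -/
lemma isLocallyIntegrable_logDefect (hD : IsSmoothDivisor (m := m) S ι) (hε : 0 < ε) :
    IsLocallyIntegrable (m + 1) (logDefect h S ε) := by
  intro x z hz
  rw [(chartAt (Cn (m + 1)) x).open_target.nhdsWithin_eq hz]
  set e := chartAt (Cn (m + 1)) x with he
  have hea : e ∈ atlas (Cn (m + 1)) X := chart_mem_atlas _ x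
  obtain ⟨p, hp, rfl⟩ : ∃ p ∈ e.source, e p = z := ⟨e.symm z, e.map_target hz, e.right_inv hz⟩
  by_cases h0 : normSq h S p = 0
  · obtain ⟨y, rfl⟩ := (mem_range_iff h hD).2 h0
    have hys := mem_chart_source (Cn (m + 1)) (ι y)
    have hya := chart_mem_atlas (Cn (m + 1)) (ι y)
    obtain ⟨κ, j₀, hκ, hpκ, hκe, hκj⟩ := exists_adaptedChart S hya hys (hD.transversal y)
    refine integrableAtFilter_symm hκ hpκ ?_ hea hp
    have h1 : IntegrableAtFilter
        (fun w => chiPotential h S ε (chartAt (Cn (m + 1)) (ι y)) (κ.symm w)) (𝓝 (κ (ι y))) := by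
      refine integrableAtFilter_of_eventually_continuousAt ?_
      filter_upwards [κ.open_target.mem_nhds (κ.map_source hpκ)] with w hw
      have h2 := ((smoothAt_chiPotential (h := h) (S := S) hε hya
        (hκe (κ.map_target hw))).comp_symm hκ (κ.map_target hw)).continuousAt
      rwa [κ.right_inv hw] at h2
    obtain ⟨N, hN, hi⟩ := h1.sub (locallyIntegrable_log_norm_sq j₀ (κ (ι y)))
    have hT : κ.target ∈ 𝓝 (κ (ι y)) := κ.open_target.mem_nhds (κ.map_source hpκ)
    refine ⟨N ∩ κ.target, Filter.inter_mem hN hT, ?_⟩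
    refine (hi.mono_set Set.inter_subset_left).congr ?_
    have hsub : ∀ᵐ w ∂(volume.restrict (N ∩ κ.target)), w ∈ κ.target := by
      refine ae_restrict_of_ae_restrict_of_subset Set.inter_subset_right ?_
      exact ae_restrict_mem κ.open_target.measurableSet
    filter_upwards [hsub, ae_restrict_of_ae (ae_apply_ne_zero j₀)] with w hw hw0
    have hws := κ.map_target hw
    have hc := hκj _ hws
    rw [κ.right_inv hw] at hc
    rw [logDefect_eq_chiPotential hε hya (hκe hws) (by rwa [← hc]), ← hc]
    rfl
  · refine integrableAtFilter_of_eventually_continuousAt ?_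
    have h1 := (smoothAt_normSq h S p).continuousAt.eventually_ne h0
    filter_upwards [eventually_symm_mem e hp h1] with z hz
    have h2 := (smoothAt_logDefect hε hz.2 e hea (e.map_target hz.1)).continuousAt
    rwa [e.right_inv hz.1] at h2

end LocalIntegrability

/-! ### The Poincaré–Lelong formula in a chart -/

section TopForm

variable {n m : ℕ} {X : Type*} [TopologicalSpace X]

lemma topForm_cons (u : X → ℝ) (α α' : LocalForm (m + 1) X) (e : Chart (m + 1) X)
    (z : Cn (m + 1)) : topForm u (Fin.cons α fun _ : Fin m => α') e z =
      u (e.symm z) * (2 ^ (m + 1) * m.factorial * (α e z * (α' e z).adjugate).trace.re) := by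
  have h : (fun i => (Fin.cons α fun _ : Fin m => α' : Fin (m + 1) → LocalForm (m + 1) X) i e z) =
      Fin.cons (α e z) fun _ : Fin m => α' e z := by
    ext1 i
    refine Fin.cases ?_ (fun i => ?_) i <;> simp
  rw [topForm, h, wedgeCoeff_cons, ← Complex.ofReal_natCast, Complex.re_ofReal_mul, mul_assoc]

end TopForm

section TestTraces

variable {n m : ℕ} {U : Set (Cn n)} {a P u : Cn n → ℝ}

lemma contDiffOn_trace_mul_adjugate (hU : IsOpen U) (ha : ContDiffOn ℝ ∞ a U)
    (hP : ContDiffOn ℝ ∞ P U) :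
    ContDiffOn ℝ ∞ (fun w => (complexHessian a w * (complexHessian P w).adjugate).trace) U := by
  intro w hw
  simp only [Matrix.trace, Matrix.diag, Matrix.mul_apply]
  refine ContDiffWithinAt.sum fun j _ => ContDiffWithinAt.sum fun k _ => ?_
  exact ((contDiffAt_complexHessian (ha.contDiffAt (hU.mem_nhds hw)) j k).mul
    (contDiffAt_adjugate_complexHessian (hP.contDiffAt (hU.mem_nhds hw)) k j)).contDiffWithinAt

lemma isTest_trace_mul_adjugate (hU : IsOpen U) (hP : ContDiffOn ℝ ∞ P U)
    (hu : IsTest U fun z => (u z : ℂ)) :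
    IsTest U fun w => (complexHessian u w * (complexHessian P w).adjugate).trace :=
  hu.of_eq_zero hU
    (contDiffOn_trace_mul_adjugate hU (contDiff_of_ofReal hu.smooth).contDiffOn hP)
    fun _ hz => by rw [complexHessian_eq_zero hz, zero_mul, Matrix.trace_zero]

lemma isTest_mul_trace_mul_adjugate (hU : IsOpen U) (ha : ContDiffOn ℝ ∞ a U)
    (hP : ContDiffOn ℝ ∞ P U) (hu : IsTest U fun z => (u z : ℂ)) :
    IsTest U fun w => (u w : ℂ) * (complexHessian a w * (complexHessian P w).adjugate).trace := by
  simpa only [mul_comm] using hu.mul_left hU (contDiffOn_trace_mul_adjugate hU ha hP)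

lemma contDiff_insertNth (j₀ : Fin (m + 1)) :
    ContDiff ℂ ∞ fun w' : Cn m => (j₀.insertNth 0 w' : Cn (m + 1)) := by
  refine contDiff_pi.2 fun i => ?_
  refine j₀.succAboveCases ?_ (fun k => ?_) i
  · simpa using contDiff_const
  · simpa using contDiff_apply ℂ ℂ k

lemma IsTest.comp_insertNth {U : Set (Cn (m + 1))} {b : Cn (m + 1) → ℂ} (hb : IsTest U b)
    (j₀ : Fin (m + 1)) :
    IsTest ((fun w' : Cn m => (j₀.insertNth 0 w' : Cn (m + 1))) ⁻¹' U)
      fun w' => b (j₀.insertNth 0 w') := by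
  have hc := (contDiff_insertNth j₀).continuous
  have hs : tsupport (fun w' : Cn m => b (j₀.insertNth 0 w')) ⊆
      (fun w' : Cn m => (j₀.insertNth 0 w' : Cn (m + 1))) ⁻¹' tsupport b :=
    closure_minimal (fun w hw => subset_tsupport b hw) ((isClosed_tsupport b).preimage hc)
  refine ⟨hb.smooth.comp ((contDiff_insertNth j₀).restrict_scalars ℝ), ?_,
    hs.trans (Set.preimage_mono hb.support)⟩
  have h1 : IsCompact ((fun w : Cn (m + 1) => fun i => w (j₀.succAbove i)) '' tsupport b) :=
    hb.compact.isCompact.image (by fun_prop)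
  refine h1.of_isClosed_subset (isClosed_tsupport _) fun w' hw' => ?_
  exact ⟨_, hs hw', by ext i; simp⟩

lemma integral_mul_re {E : Type*} [MeasurableSpace E] {μ : Measure E} {f : E → ℝ} {g : E → ℂ}
    (h : Integrable (fun x => (f x : ℂ) * g x) μ) :
    Integrable (fun x => f x * (g x).re) μ ∧
      ∫ x, f x * (g x).re ∂μ = (∫ x, (f x : ℂ) * g x ∂μ).re := by
  have h1 : (fun x => f x * (g x).re) = fun x => Complex.reCLM ((f x : ℂ) * g x) := by
    ext x
    simp
  rw [h1]
  exact ⟨Complex.reCLM.integrable_comp h, Complex.reCLM.integral_comp_comm h⟩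

end TestTraces

section ChartIntegral

variable {n : ℕ} {X : Type*} [TopologicalSpace X]

/-- The function `u` in the chart `κ`, extended by zero. -/
noncomputable def inChart (κ : Chart n X) (u : X → ℝ) : Cn n → ℝ :=
  κ.target.indicator fun w => u (κ.symm w)

variable {κ : Chart n X} {u P : X → ℝ}

lemma inChart_eventuallyEq {w : Cn n} (hw : w ∈ κ.target) :
    inChart κ u =ᶠ[𝓝 w] fun w => u (κ.symm w) := by
  filter_upwards [κ.open_target.mem_nhds hw] with v hv
  exact Set.indicator_of_mem hv _

variable [ChartedSpace (Cn n) X]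

lemma HasPotentialAt.eq_complexHessian {α : LocalForm n X} {P : X → ℝ} {e κ : Chart n X} {z : Cn n}
    (hα : HasPotentialAt α P (e.symm z)) (he : e ∈ atlas (Cn n) X) (hz : z ∈ e.target)
    (hp : e.symm z ∈ κ.source) :
    α e z = complexHessian (fun z => P (κ.symm (κ (e.symm z)))) z := by
  have h1 := hα e he (e.map_target hz)
  rw [complexHessian_symm_eq (e.map_target hz) hp, e.right_inv hz] at h1
  exact h1

lemma contDiffOn_comp_symm (hκ : IsHolomorphicChart κ) (hP : ∀ x ∈ κ.source, SmoothAt n P x) :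
    ContDiffOn ℝ ∞ (fun w => P (κ.symm w)) κ.target := by
  intro w hw
  have h1 := (hP _ (κ.map_target hw)).comp_symm hκ (κ.map_target hw)
  rw [κ.right_inv hw] at h1
  exact h1.contDiffWithinAt

lemma isTest_inChart [CompactSpace X] (hκ : IsHolomorphicChart κ)
    (hu : ∀ x ∈ κ.source, SmoothAt n u x) (hus : tsupport u ⊆ κ.source) :
    IsTest κ.target fun w => (inChart κ u w : ℂ) := by
  have hK : IsCompact (κ '' tsupport u) :=
    (isClosed_tsupport u).isCompact.image_of_continuousOn (κ.continuousOn.mono hus)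
  have hs : tsupport (fun w => (inChart κ u w : ℂ)) ⊆ κ '' tsupport u := by
    refine closure_minimal (fun w hw => ?_) hK.isClosed
    have hw' : inChart κ u w ≠ 0 := fun h => hw (by simp [h])
    have hwt : w ∈ κ.target := by
      by_contra h
      exact hw' (Set.indicator_of_notMem h _)
    rw [inChart, Set.indicator_of_mem hwt] at hw'
    exact ⟨_, subset_tsupport u hw', κ.right_inv hwt⟩
  have ht : κ '' tsupport u ⊆ κ.target := by
    rintro _ ⟨p, hp, rfl⟩
    exact κ.map_source (hus hp)
  refine ⟨contDiff_of_contDiffOn_tsupport κ.open_target (fun w hw => ?_) (hs.trans ht),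
    hK.of_isClosed_subset (isClosed_tsupport _) hs, hs.trans ht⟩
  have h1 := (contDiffOn_comp_symm hκ hu).contDiffAt (κ.open_target.mem_nhds hw)
  exact (contDiffAt_ofReal_comp
    (h1.congr_of_eventuallyEq (inChart_eventuallyEq hw))).contDiffWithinAt

end ChartIntegral

section LocalFormula

variable {m : ℕ} {X : Type*} [TopologicalSpace X] [ChartedSpace (Cn (m + 1)) X] [T2Space X]
  [CompactSpace X] {κ : Chart (m + 1) X} {u f P a : X → ℝ} {α ω' : LocalForm (m + 1) X}

/-- The integral of `f α ∧ ω^{n-1}` in a holomorphic chart, if `f` vanishes outside its domain. -/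
lemma integral_topForm_cons_eq (hκ : IsHolomorphicChart κ)
    (ha : ∀ x ∈ κ.source, SmoothAt (m + 1) a x) (hα : ∀ x ∈ κ.source, HasPotentialAt α a x)
    (hP : ∀ x ∈ κ.source, SmoothAt (m + 1) P x) (hω : ∀ x ∈ κ.source, HasPotentialAt ω' P x)
    (hf : ∀ x ∉ κ.source, f x = 0)
    (hi : IntegrableOn (fun w => f (κ.symm w) * (complexHessian (fun w => a (κ.symm w)) w *
      (complexHessian (fun w => P (κ.symm w)) w).adjugate).trace.re) κ.target) :
    integral (topForm f (Fin.cons α fun _ : Fin m => ω')) = 2 ^ (m + 1) * m.factorial *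
      ∫ w in κ.target, f (κ.symm w) * (complexHessian (fun w => a (κ.symm w)) w *
        (complexHessian (fun w => P (κ.symm w)) w).adjugate).trace.re := by
  have hwedge : ∀ w, f (κ.symm w) * (2 ^ (m + 1) * (wedgeCoeff fun i => complexHessian
      ((Fin.cons (fun w => a (κ.symm w)) fun _ : Fin m => fun w => P (κ.symm w) :
        Fin (m + 1) → Cn (m + 1) → ℝ) i) w).re) =
      2 ^ (m + 1) * m.factorial * (f (κ.symm w) * (complexHessian (fun w => a (κ.symm w)) w *
        (complexHessian (fun w => P (κ.symm w)) w).adjugate).trace.re) := by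
    intro w
    have h : (fun i => complexHessian
      ((Fin.cons (fun w => a (κ.symm w)) fun _ : Fin m => fun w => P (κ.symm w) :
        Fin (m + 1) → Cn (m + 1) → ℝ) i) w) =
        Fin.cons (complexHessian (fun w => a (κ.symm w)) w)
          fun _ : Fin m => complexHessian (fun w => P (κ.symm w)) w := by
      ext1 i
      refine Fin.cases ?_ (fun i => ?_) i <;> simp
    rw [h, wedgeCoeff_cons, ← Complex.ofReal_natCast, Complex.re_ofReal_mul]
    ring
  have himg : κ '' κ.source = κ.target := κ.image_source_eq_target
  have h := integral_topForm_eq_setIntegral (n := m + 1) (V := κ.source) (κ := κ) (u := f)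
    (α := Fin.cons α fun _ : Fin m => ω') (g := fun w => f (κ.symm w))
    (Q := Fin.cons (fun w => a (κ.symm w)) fun _ => fun w => P (κ.symm w)) κ.open_source κ.injOn
    ?_ ?_ ?_ (fun p hp => by rw [κ.left_inv hp]) hf ?_
  · rw [h.2, himg, ← integral_const_mul]
    simp only [hwedge]
  · intro x z hz
    have h1 := hκ.toChart _ (chart_mem_atlas _ x) _ hz.2 ((chartAt (Cn (m + 1)) x).map_target hz.1)
    rw [(chartAt (Cn (m + 1)) x).right_inv hz.1] at h1
    exact h1.contDiffWithinAt
  · intro i w hw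
    rw [himg] at hw
    refine Fin.cases ?_ (fun i => ?_) i
    · exact (contDiffOn_comp_symm hκ ha).contDiffAt (κ.open_target.mem_nhds hw)
    · exact (contDiffOn_comp_symm hκ hP).contDiffAt (κ.open_target.mem_nhds hw)
  · intro x z hz i
    refine Fin.cases ?_ (fun i => ?_) i
    · exact (hα _ hz.2).eq_complexHessian (chart_mem_atlas _ x) hz.1 hz.2
    · exact (hω _ hz.2).eq_complexHessian (chart_mem_atlas _ x) hz.1 hz.2
  · rw [himg]
    simp only [hwedge]
    exact hi.const_mul _

/-- The Poincaré–Lelong formula in a chart `κ`, for a function `f = a - c log |w_{j₀}|²` with `a`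
smooth, tested against `u ω^{n-1}` with `u` supported in the chart. -/
lemma integral_topForm_ddbar_eq (hκ : IsHolomorphicChart κ)
    (ha : ∀ x ∈ κ.source, SmoothAt (m + 1) a x) (hα : ∀ x ∈ κ.source, HasPotentialAt α a x)
    (hP : ∀ x ∈ κ.source, SmoothAt (m + 1) P x) (hω : ∀ x ∈ κ.source, HasPotentialAt ω' P x)
    (hu : ∀ x ∈ κ.source, SmoothAt (m + 1) u x) (hus : tsupport u ⊆ κ.source) {c : ℝ}
    {j₀ : Fin (m + 1)}
    (hf : ∀ x ∈ κ.source, κ x j₀ ≠ 0 → f x = a x - c * Real.log (‖κ x j₀‖ ^ 2)) :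
    integral (topForm f (Fin.cons (ddbar u) fun _ : Fin m => ω')) =
      integral (topForm u (Fin.cons α fun _ : Fin m => ω')) -
        c * (2 * Real.pi * (2 ^ m * m.factorial * ∫ w' : Cn m, inChart κ u (j₀.insertNth 0 w') *
          ((complexHessian (fun w => P (κ.symm w)) (j₀.insertNth 0 w')).submatrix
            j₀.succAbove j₀.succAbove).det.re)) := by
  set ah : Cn (m + 1) → ℝ := fun w => a (κ.symm w) with hah
  set Ph : Cn (m + 1) → ℝ := fun w => P (κ.symm w) with hPh
  have ha' : ContDiffOn ℝ ∞ ah κ.target := contDiffOn_comp_symm hκ ha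
  have hP' : ContDiffOn ℝ ∞ Ph κ.target := contDiffOn_comp_symm hκ hP
  have hut := isTest_inChart hκ hu hus
  have hto := κ.open_target
  have htr := isTest_trace_mul_adjugate hto hP' hut
  have haC : ContDiffOn ℝ ∞ (fun w => (ah w : ℂ)) κ.target := fun w hw =>
    (contDiffAt_ofReal_comp (ha'.contDiffAt (hto.mem_nhds hw))).contDiffWithinAt
  have hoff : ∀ w, w ∉ κ.target → (complexHessian (inChart κ u) w *
      (complexHessian Ph w).adjugate).trace = 0 := by
    intro w hw
    rw [complexHessian_eq_zero fun h => hw (hut.support h), zero_mul, Matrix.trace_zero]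
  have hi1 := integral_mul_re (htr.mul_left hto haC).integrable
  have hi2 := integral_mul_re (htr.integrable_log_mul (j₀ := j₀))
  have hi3 := integral_mul_re (isTest_mul_trace_mul_adjugate hto ha' hP' hut).integrable
  have hae : (fun w => κ.source.indicator f (κ.symm w) * (complexHessian (fun w => u (κ.symm w)) w *
      (complexHessian Ph w).adjugate).trace.re) =ᵐ[volume.restrict κ.target]
      fun w => ah w * (complexHessian (inChart κ u) w * (complexHessian Ph w).adjugate).trace.re -
        c * (Real.log (‖w j₀‖ ^ 2) *
          (complexHessian (inChart κ u) w * (complexHessian Ph w).adjugate).trace.re) := by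
    filter_upwards [ae_restrict_mem hto.measurableSet, ae_restrict_of_ae (ae_apply_ne_zero j₀)]
      with w hw hw0
    have hws := κ.map_target hw
    rw [complexHessian_congr (inChart_eventuallyEq hw), Set.indicator_of_mem hws,
      hf _ hws (by rwa [κ.right_inv hw]), κ.right_inv hw]
    ring
  have hiL := (hi1.1.sub (hi2.1.const_mul c))
  have hL := integral_topForm_cons_eq (f := κ.source.indicator f) (α := ddbar u) (a := u) hκ hu
    (fun x _ => hasPotentialAt_ddbar u x) hP hω (fun x hx => Set.indicator_of_notMem hx _)
    (hiL.integrableOn.congr_fun_ae hae.symm)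
  -- `√-1 ∂∂̄ u` vanishes outside the chart, so `f` may be cut off there
  have hL' : integral (topForm f (Fin.cons (ddbar u) fun _ : Fin m => ω')) =
      integral (topForm (κ.source.indicator f) (Fin.cons (ddbar u) fun _ : Fin m => ω')) := by
    refine integral_congr fun x z hz => ?_
    rw [topForm_cons, topForm_cons]
    by_cases hp : (chartAt (Cn (m + 1)) x).symm z ∈ κ.source
    · rw [Set.indicator_of_mem hp]
    · have h0 : u =ᶠ[𝓝 ((chartAt (Cn (m + 1)) x).symm z)] fun _ => 0 :=
        eventuallyEq_zero_of_notMem_tsupport fun h => hp (hus h)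
      have h1 : ddbar u (chartAt (Cn (m + 1)) x) z = 0 := by
        have h2 := eventually_symm_mem (chartAt (Cn (m + 1)) x)
          ((chartAt (Cn (m + 1)) x).map_target hz) h0
        rw [(chartAt (Cn (m + 1)) x).right_inv hz] at h2
        rw [ddbar, complexHessian_congr (v := fun _ => 0) (h2.mono fun w hw => hw.2),
          complexHessian_const]
      simp [h1]
  have hR := integral_topForm_cons_eq (f := u) (α := α) (a := a) hκ ha hα hP hω
    (fun x hx => image_eq_zero_of_notMem_tsupport fun h => hx (hus h)) (ω' := ω') ?_
  · have hRi : ∫ w in κ.target, u (κ.symm w) * (complexHessian ah w *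
        (complexHessian Ph w).adjugate).trace.re =
        ∫ w, inChart κ u w * (complexHessian ah w * (complexHessian Ph w).adjugate).trace.re := by
      refine Eq.trans ?_ (setIntegral_eq_integral_of_forall_compl_eq_zero (s := κ.target)
        fun w hw => ?_)
      · refine setIntegral_congr_fun hto.measurableSet fun w hw => ?_
        simp only [inChart, Set.indicator_of_mem hw]
      · rw [inChart, Set.indicator_of_notMem hw, zero_mul]
    have hminor := integral_mul_re
      (f := fun w' : Cn m => inChart κ u (j₀.insertNth 0 w'))
      (g := fun w' => ((complexHessian Ph (j₀.insertNth 0 w')).submatrix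
            j₀.succAbove j₀.succAbove).det) (μ := volume) ?_
    · rw [hL', hL, hR, hRi, integral_congr_ae hae, setIntegral_eq_integral_of_forall_compl_eq_zero,
        MeasureTheory.integral_sub hi1.1 (hi2.1.const_mul c), integral_const_mul, hi1.2, hi2.2,
        hi3.2, integral_mul_trace_complexHessian hto hP' ha' hut,
        integral_log_mul_trace_complexHessian hto hP' hut, Complex.re_ofReal_mul, hminor.2]
      · ring
      · intro w hw
        simp [hoff w hw]
    · have h1 := ((isTest_mul_adjugate hto hP' hut j₀ j₀).comp_insertNth j₀).integrable
      simpa only [Matrix.adjugate_fin_succ_eq_det_submatrix, ← two_mul, pow_mul, neg_one_sq,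
        one_pow, one_mul] using h1
  · refine hi3.1.integrableOn.congr_fun (fun w hw => ?_) hto.measurableSet
    simp only [inChart, Set.indicator_of_mem hw]
    rfl

end LocalFormula

/-! ### Integrals over the divisor -/

section Divisor

variable {m : ℕ}

lemma holJacobian_insertNth (j₀ : Fin (m + 1)) (w' : Cn m) :
    holJacobian (fun w' : Cn m => (j₀.insertNth 0 w' : Cn (m + 1))) w' =
      (1 : Matrix (Fin (m + 1)) (Fin (m + 1)) ℂ).submatrix id j₀.succAbove := by
  have hlin : IsLinearMap ℂ fun w' : Cn m => (j₀.insertNth 0 w' : Cn (m + 1)) := by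
    refine ⟨fun v w => ?_, fun c v => ?_⟩ <;> ext k <;> refine j₀.succAboveCases ?_ (fun i => ?_) k
    all_goals simp
  have hd : fderiv ℂ (fun w' : Cn m => (j₀.insertNth 0 w' : Cn (m + 1))) w' =
      (hlin.mk' _).toContinuousLinearMap := (hlin.mk' _).toContinuousLinearMap.fderiv
  ext k a
  rw [holJacobian, Matrix.of_apply, hd, Matrix.submatrix_apply]
  change (j₀.insertNth 0 (Pi.single a 1 : Cn m) : Cn (m + 1)) k = _
  refine j₀.succAboveCases ?_ (fun i => ?_) k
  · rw [Fin.insertNth_apply_same, id, Matrix.one_apply_ne (Fin.succAbove_ne j₀ a).symm]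
  · rw [Fin.insertNth_apply_succAbove, id, Matrix.one_apply, Pi.single_apply]
    simp only [Fin.succAbove_right_inj]

lemma complexHessian_comp_insertNth {P : Cn (m + 1) → ℝ} {j₀ : Fin (m + 1)} {w' : Cn m}
    (hP : ContDiffAt ℝ ∞ P (j₀.insertNth 0 w')) :
    complexHessian (fun w' : Cn m => P (j₀.insertNth 0 w')) w' =
      (complexHessian P (j₀.insertNth 0 w')).submatrix j₀.succAbove j₀.succAbove := by
  rw [complexHessian_comp (contDiff_insertNth j₀).contDiffAt hP, holJacobian_insertNth]
  ext a b
  simp [Matrix.mul_apply, Matrix.one_apply, apply_ite]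

variable {n : ℕ} {X : Type*} [TopologicalSpace X] [ChartedSpace (Cn n) X]
  [IsManifold 𝓘(ℂ, Cn n) ω X]
  {Y : Type*} [TopologicalSpace Y] [ChartedSpace (Cn m) Y] [IsManifold 𝓘(ℂ, Cn m) ω Y]
  {ι : Y → X}

lemma contDiffAt_chart_comp (hι : ContMDiff 𝓘(ℂ, Cn m) 𝓘(ℂ, Cn n) ω ι) {e : Chart m Y}
    (he : e ∈ atlas (Cn m) Y) {e' : Chart n X} (he' : e' ∈ atlas (Cn n) X) {z : Cn m}
    (hz : z ∈ e.target) (hz' : ι (e.symm z) ∈ e'.source) :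
    ContDiffAt ℂ ∞ (fun w => e' (ι (e.symm w))) z := by
  have h1 : ContMDiffAt 𝓘(ℂ, Cn m) 𝓘(ℂ, Cn m) ω e.symm z :=
    (contMDiffOn_symm_of_mem_maximalAtlas (IsManifold.subset_maximalAtlas he)).contMDiffAt
      (e.open_target.mem_nhds hz)
  have h2 : ContMDiffAt 𝓘(ℂ, Cn n) 𝓘(ℂ, Cn n) ω e' (ι (e.symm z)) :=
    (contMDiffOn_of_mem_maximalAtlas (IsManifold.subset_maximalAtlas he')).contMDiffAt
      (e'.open_source.mem_nhds hz')
  have h3 := (h2.comp (e.symm z) hι.contMDiffAt).comp z h1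
  exact (contMDiffAt_iff_contDiffAt.1 h3).of_le le_top

/-- The pull-back of `√-1 ∂∂̄ P` is `√-1 ∂∂̄ (P ∘ ι)`. -/
lemma pullback_eq_complexHessian (hι : ContMDiff 𝓘(ℂ, Cn m) 𝓘(ℂ, Cn n) ω ι) {e : Chart m Y}
    (he : e ∈ atlas (Cn m) Y) {z : Cn m} (hz : z ∈ e.target) {α : LocalForm n X} {P : X → ℝ}
    (hα : HasPotentialAt α P (ι (e.symm z))) (hP : SmoothAt n P (ι (e.symm z))) :
    pullback ι α e z = complexHessian (fun w => P (ι (e.symm w))) z := by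
  set e' : Chart n X := chartAt (Cn n) (ι (e.symm z)) with he'
  have hs : ι (e.symm z) ∈ e'.source := mem_chart_source _ _
  have ha : e' ∈ atlas (Cn n) X := chart_mem_atlas _ _
  have hF := contDiffAt_chart_comp hι he ha hz hs
  have h1 : (fun w => P (ι (e.symm w))) =ᶠ[𝓝 z]
      fun w => P (e'.symm (e' (ι (e.symm w)))) := by
    have hc : ContinuousAt (fun w => ι (e.symm w)) z :=
      hι.continuous.continuousAt.comp (e.continuousAt_symm hz)
    filter_upwards [hc (e'.open_source.mem_nhds hs)] with w hw
    rw [e'.left_inv hw]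
  rw [complexHessian_congr h1,
    complexHessian_comp (u := fun z => P (e'.symm z)) hF (hP e' ha hs), ← hα e' ha hs]
  rfl

end Divisor

section DivisorIntegral

variable {m : ℕ} {X : Type*} [TopologicalSpace X] [ChartedSpace (Cn (m + 1)) X]
  [IsManifold 𝓘(ℂ, Cn (m + 1)) ω X] [CompactSpace X]
  {Y : Type*} [TopologicalSpace Y] [ChartedSpace (Cn m) Y] [IsManifold 𝓘(ℂ, Cn m) ω Y]
  [T2Space Y] [CompactSpace Y] {ι : Y → X} {κ : Chart (m + 1) X} {u P : X → ℝ}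
  {ω' : LocalForm (m + 1) X}

/-- The integral of `u ω^{n-1}` over the divisor, in a holomorphic chart in which the divisor is a
coordinate hyperplane. -/
lemma integral_topForm_pullback_eq (hι : ContMDiff 𝓘(ℂ, Cn m) 𝓘(ℂ, Cn (m + 1)) ω ι)
    (hinj : Function.Injective ι) (hκ : IsHolomorphicChart κ)
    (hP : ∀ x ∈ κ.source, SmoothAt (m + 1) P x) (hω : ∀ x ∈ κ.source, HasPotentialAt ω' P x)
    (hu : ∀ x ∈ κ.source, SmoothAt (m + 1) u x) (hus : tsupport u ⊆ κ.source) {j₀ : Fin (m + 1)}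
    (hκr : ∀ x ∈ κ.source, x ∈ Set.range ι ↔ κ x j₀ = 0) :
    IsIntegrable (topForm (fun y => u (ι y)) fun _ : Fin m => pullback ι ω') ∧
      integral (topForm (fun y => u (ι y)) fun _ : Fin m => pullback ι ω') =
        2 ^ m * m.factorial * ∫ w' : Cn m, inChart κ u (j₀.insertNth 0 w') *
          ((complexHessian (fun w => P (κ.symm w)) (j₀.insertNth 0 w')).submatrix
            j₀.succAbove j₀.succAbove).det.re := by
  set V : Set Y := ι ⁻¹' κ.source with hV
  have hVo : IsOpen V := κ.open_source.preimage hι.continuous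
  -- the remaining coordinates are holomorphic coordinates on the divisor
  set κY : Y → Cn m := fun y i => κ (ι y) (j₀.succAbove i) with hκY
  have hins : ∀ y ∈ V, j₀.insertNth 0 (κY y) = κ (ι y) := by
    intro y hy
    have h0 := (hκr _ hy).1 ⟨y, rfl⟩
    rw [← h0]
    exact j₀.insertNth_self_removeNth (κ (ι y))
  have hYinj : Set.InjOn κY V := fun y hy y' hy' h =>
    hinj (κ.injOn hy hy' (by rw [← hins y hy, ← hins y' hy', h]))
  have himg : κY '' V = (fun w' : Cn m => (j₀.insertNth 0 w' : Cn (m + 1))) ⁻¹' κ.target := by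
    ext w'
    constructor
    · rintro ⟨y, hy, rfl⟩
      rw [Set.mem_preimage, hins y hy]
      exact κ.map_source hy
    · intro hw
      have hs := κ.map_target hw
      obtain ⟨y, hy⟩ := (hκr _ hs).2 (by rw [κ.right_inv hw]; simp)
      have hyV : y ∈ V := by rw [hV, Set.mem_preimage, hy]; exact hs
      refine ⟨y, hyV, ?_⟩
      ext i
      simp only [hκY, hy]
      rw [κ.right_inv hw]
      simp
  have hto := κ.open_target
  have hP' : ContDiffOn ℝ ∞ (fun w => P (κ.symm w)) κ.target := contDiffOn_comp_symm hκ hP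
  have hut := isTest_inChart hκ hu hus
  have hminor := integral_mul_re
    (f := fun w' : Cn m => inChart κ u (j₀.insertNth 0 w'))
    (g := fun w' => ((complexHessian (fun w => P (κ.symm w)) (j₀.insertNth 0 w')).submatrix
          j₀.succAbove j₀.succAbove).det) (μ := volume) (by
    have h1 := ((isTest_mul_adjugate hto hP' hut j₀ j₀).comp_insertNth j₀).integrable
    simpa only [Matrix.adjugate_fin_succ_eq_det_submatrix, ← two_mul, pow_mul, neg_one_sq,
      one_pow, one_mul] using h1)
  have hm : MeasurableSet (κY '' V) := by
    rw [himg]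
    exact (hto.preimage (contDiff_insertNth j₀).continuous).measurableSet
  set Q : Cn m → ℝ := fun w' => P (κ.symm (j₀.insertNth 0 w')) with hQ
  have hPat : ∀ w' ∈ κY '' V, ContDiffAt ℝ ∞ (fun w => P (κ.symm w)) (j₀.insertNth 0 w') := by
    intro w' hw
    rw [himg] at hw
    exact hP'.contDiffAt (hto.mem_nhds hw)
  have hwedge : ∀ w' ∈ κY '' V, inChart κ u (j₀.insertNth 0 w') *
      (2 ^ m * (wedgeCoeff fun _ : Fin m => complexHessian Q w').re) = 2 ^ m * m.factorial *
        (inChart κ u (j₀.insertNth 0 w') * ((complexHessian (fun w => P (κ.symm w))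
          (j₀.insertNth 0 w')).submatrix j₀.succAbove j₀.succAbove).det.re) := by
    intro w' hw
    rw [wedgeCoeff_const, complexHessian_comp_insertNth (hPat w' hw), ← Complex.ofReal_natCast,
      Complex.re_ofReal_mul]
    ring
  have hchart : ∀ y : Y, ∀ z ∈ chartImage m V y,
      ContDiffAt ℂ ∞ (fun z => κ (ι ((chartAt (Cn m) y).symm z))) z := by
    intro y z hz
    set p := ι ((chartAt (Cn m) y).symm z) with hp
    have hs : p ∈ (chartAt (Cn (m + 1)) p).source := mem_chart_source _ _
    have ha := chart_mem_atlas (Cn (m + 1)) p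
    have h1 := contDiffAt_chart_comp hι (chart_mem_atlas _ y) ha hz.1 hs
    have h2 := (hκ.toChart _ ha p hz.2 hs).comp z h1
    refine h2.congr_of_eventuallyEq ?_
    have hc : ContinuousAt (fun w => ι ((chartAt (Cn m) y).symm w)) z :=
      hι.continuous.continuousAt.comp ((chartAt (Cn m) y).continuousAt_symm hz.1)
    filter_upwards [hc ((chartAt (Cn (m + 1)) p).open_source.mem_nhds hs)] with w hw
    simp only [Function.comp_apply]
    rw [(chartAt (Cn (m + 1)) p).left_inv hw]
  have h := integral_topForm_eq_setIntegral (n := m) (V := V) (κ := κY)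
    (u := fun y => u (ι y)) (α := fun _ : Fin m => pullback ι ω')
    (g := fun w' => inChart κ u (j₀.insertNth 0 w')) (Q := fun _ => Q) hVo hYinj ?_ ?_ ?_ ?_ ?_ ?_
  · refine ⟨h.1, ?_⟩
    rw [h.2, ← integral_const_mul, setIntegral_congr_fun hm hwedge]
    refine setIntegral_eq_integral_of_forall_compl_eq_zero fun w' hw => ?_
    rw [himg, Set.mem_preimage] at hw
    rw [inChart, Set.indicator_of_notMem hw, zero_mul, mul_zero]
  · exact fun y z hz => (contDiffAt_pi.2 fun i =>
      contDiffAt_pi.1 (hchart y z hz) (j₀.succAbove i)).contDiffWithinAt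
  · exact fun _ w' hw => (hPat w' hw).comp w'
      ((contDiff_insertNth j₀).restrict_scalars ℝ).contDiffAt
  · intro y z hz _
    rw [pullback_eq_complexHessian hι (chart_mem_atlas _ y) hz.1 (hω _ hz.2) (hP _ hz.2)]
    refine complexHessian_congr ?_
    filter_upwards [(isOpen_chartImage hVo y).mem_nhds hz] with w hw
    rw [hQ]
    simp only
    rw [hins _ hw.2, κ.left_inv hw.2]
  · intro y hy
    rw [hins y hy, inChart, Set.indicator_of_mem (κ.map_source hy), κ.left_inv hy]
  · exact fun y hy => image_eq_zero_of_notMem_tsupport fun h => hy (hus h)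
  · exact (hminor.1.const_mul _).integrableOn.congr_fun (fun w' hw => (hwedge w' hw).symm) hm

end DivisorIntegral

/-! ### The global Poincaré–Lelong formula -/

section Continuity

variable {n : ℕ} {T : Type*} [TopologicalSpace T] {s : Set T} {A B : T → Matrix (Fin n) (Fin n) ℂ}

lemma continuousOn_matrix (hA : ∀ j k, ContinuousOn (fun p => A p j k) s) : ContinuousOn A s :=
  continuousOn_pi.2 fun j => continuousOn_pi.2 fun k => hA j k

lemma continuousOn_trace_mul_adjugate (hA : ∀ j k, ContinuousOn (fun p => A p j k) s)
    (hB : ∀ j k, ContinuousOn (fun p => B p j k) s) :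
    ContinuousOn (fun p => (A p * (B p).adjugate).trace.re) s := by
  have h : Continuous fun q : Matrix (Fin n) (Fin n) ℂ × Matrix (Fin n) (Fin n) ℂ =>
      (q.1 * q.2.adjugate).trace.re :=
    Complex.continuous_re.comp
      (continuous_fst.matrix_mul continuous_snd.matrix_adjugate).matrix_trace
  exact h.comp_continuousOn (f := fun p => (A p, B p))
    ((continuousOn_matrix hA).prodMk (continuousOn_matrix hB))

lemma continuousOn_det_re (hB : ∀ j k, ContinuousOn (fun p => B p j k) s) :
    ContinuousOn (fun p => (B p).det.re) s :=
  (Complex.continuous_re.comp continuous_id.matrix_det).comp_continuousOn (continuousOn_matrix hB)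

end Continuity

section LocalPotentials

variable {n : ℕ} {X : Type*} [TopologicalSpace X] [ChartedSpace (Cn n) X]

/-- The form `α` has a smooth potential on the domain of each chart of the atlas. -/
def HasLocalPotentials (α : LocalForm n X) : Prop :=
  ∀ e ∈ atlas (Cn n) X, ∃ P : X → ℝ, ∀ x ∈ e.source, SmoothAt n P x ∧ HasPotentialAt α P x

variable {α α' : LocalForm n X} {u : X → ℝ}

lemma hasLocalPotentials_ddbar (hu : ∀ x, SmoothAt n u x) :
    HasLocalPotentials (ddbar u : LocalForm n X) := fun _ _ =>
  ⟨u, fun x _ => ⟨hu x, hasPotentialAt_ddbar u x⟩⟩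

lemma HasLocalPotentials.add (hα : HasLocalPotentials α) (hα' : HasLocalPotentials α') :
    HasLocalPotentials (α + α') := fun e he => by
  obtain ⟨P, hP⟩ := hα e he
  obtain ⟨P', hP'⟩ := hα' e he
  exact ⟨fun x => P x + P' x, fun x hx => ⟨(hP x hx).1.add (hP' x hx).1,
    (hP x hx).2.add (hP' x hx).2 (hP x hx).1 (hP' x hx).1⟩⟩

lemma HasLocalPotentials.continuousOn (hα : HasLocalPotentials α) {e : Chart n X}
    (he : e ∈ atlas (Cn n) X) (j k : Fin n) : ContinuousOn (fun z => α e z j k) e.target := by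
  obtain ⟨P, hP⟩ := hα e he
  refine ContinuousOn.congr (f := fun z => complexHessian (fun w => P (e.symm w)) z j k) ?_ ?_
  · intro z hz
    have h1 := (hP _ (e.map_target hz)).1 e he (e.map_target hz)
    rw [e.right_inv hz] at h1
    exact (contDiffAt_complexHessian h1 j k).continuousAt.continuousWithinAt
  · intro z hz
    have h1 := (hP _ (e.map_target hz)).2 e he (e.map_target hz)
    rw [e.right_inv hz] at h1
    simp only [h1]

lemma IsHolomorphicChart.restrOpen {κ : Chart n X} (hκ : IsHolomorphicChart κ) {O : Set X}
    (hO : IsOpen O) : IsHolomorphicChart (κ.restrOpen O hO) := by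
  have hs : ∀ x ∈ (κ.restrOpen O hO).source, x ∈ κ.source := fun x hx => by
    rw [κ.restrOpen_source] at hx
    exact hx.1
  exact ⟨fun e he x hx hx' => hκ.toChart e he x (hs x hx) hx',
    fun e he x hx hx' => hκ.fromChart e he x (hs x hx) hx'⟩

lemma isLocallyIntegrable_of_smoothAt (hu : ∀ x, SmoothAt n u x) :
    IsLocallyIntegrable n u := fun x =>
  ((continuous_iff_continuousAt.2 fun x => (hu x).continuousAt).comp_continuousOn
    (chartAt (Cn n) x).continuousOn_symm).locallyIntegrableOn
      (chartAt (Cn n) x).open_target.measurableSet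

lemma hasLocalPotentials_chiEps [IsManifold 𝓘(ℂ, Cn n) ω X] {ω₀ : LocalForm n X}
    {h : AnticanonicalMetric n X} {S : AnticanonicalSection n X} {ε : ℝ} (hω₀ : IsKahlerForm ω₀)
    (hcurv : h.HasCurvature ω₀) (hε : 0 < ε) : HasLocalPotentials (chiEps ω₀ h S ε) := fun e he =>
  ⟨chiPotential h S ε e, fun _ hx => ⟨smoothAt_chiPotential hε he hx,
    hasPotentialAt_chiEps hω₀ hcurv hε he hx⟩⟩

lemma hasLocalPotentials_of_hasCurvature [IsManifold 𝓘(ℂ, Cn n) ω X] {ω₀ : LocalForm n X}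
    {h : AnticanonicalMetric n X} (hω₀ : IsKahlerForm ω₀)
    (hcurv : h.HasCurvature ω₀) : HasLocalPotentials ω₀ := fun e he =>
  ⟨fun x => -Real.log (h.weight e (e x)), fun _ hx => ⟨smoothAt_log_weight h he hx,
    hasPotentialAt_of_hasCurvature hω₀ hcurv he hx⟩⟩

variable [T2Space X] [CompactSpace X]

lemma isIntegrable_of_eq_zero {η : Chart n X → Cn n → ℝ}
    (h : ∀ x : X, ∀ z ∈ (chartAt (Cn n) x).target, η (chartAt (Cn n) x) z = 0) :
    IsIntegrable η ∧ integral η = 0 := by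
  have h0 : IsIntegrable (fun (_ : Chart n X) _ => 0) := fun x => by simp
  refine ⟨h0.congr fun x z hz => (h x z hz).symm, ?_⟩
  rw [integral_congr (η' := fun _ _ => 0) h, integral_eq_sum]
  simp

end LocalPotentials

section PoincareLelong

variable {m : ℕ} {X : Type*} [TopologicalSpace X] [ChartedSpace (Cn (m + 1)) X] [T2Space X]
  [CompactSpace X]

lemma isIntegrable_topForm_cons {f : X → ℝ} (hf : IsLocallyIntegrable (m + 1) f)
    {α ω' : LocalForm (m + 1) X} (hα : HasLocalPotentials α) (hω : HasLocalPotentials ω') :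
    IsIntegrable (topForm f (Fin.cons α fun _ : Fin m => ω')) := by
  refine (hf.isIntegrable (k := fun e z => 2 ^ (m + 1) * m.factorial *
    (α e z * (ω' e z).adjugate).trace.re) fun x => ?_).congr
      fun x z _ => (topForm_cons f α ω' _ z).symm
  exact continuousOn_const.mul (continuousOn_trace_mul_adjugate
    (hα.continuousOn (chart_mem_atlas _ x)) (hω.continuousOn (chart_mem_atlas _ x)))

variable [IsManifold 𝓘(ℂ, Cn (m + 1)) ω X]
  {Y : Type*} [TopologicalSpace Y] [ChartedSpace (Cn m) Y] [IsManifold 𝓘(ℂ, Cn m) ω Y]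
  [T2Space Y] [CompactSpace Y] {ι : Y → X} {ω₀ ω' : LocalForm (m + 1) X}
  {h : AnticanonicalMetric (m + 1) X} {S : AnticanonicalSection (m + 1) X} {ε : ℝ}

/-- The Poincaré–Lelong formula for functions supported near a given point. -/
lemma exists_nhds_integral_logDefect (hω₀ : IsKahlerForm ω₀) (hcurv : h.HasCurvature ω₀)
    (hD : IsSmoothDivisor (m := m) S ι) (hε : 0 < ε) (hω : HasLocalPotentials ω') (p : X) :
    ∃ O : Set X, IsOpen O ∧ p ∈ O ∧ ∀ u : X → ℝ, (∀ x, SmoothAt (m + 1) u x) → tsupport u ⊆ O →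
      IsIntegrable (topForm (fun y => u (ι y)) fun _ : Fin m => pullback ι ω') ∧
      integral (topForm (logDefect h S ε) (Fin.cons (ddbar u) fun _ : Fin m => ω')) =
        integral (topForm u (Fin.cons (chiEps ω₀ h S ε) fun _ : Fin m => ω')) -
          2 * Real.pi * integral (topForm (fun y => u (ι y)) fun _ : Fin m => pullback ι ω') := by
  by_cases hp : normSq h S p = 0
  · obtain ⟨y, rfl⟩ := (mem_range_iff h hD).2 hp
    have hya := chart_mem_atlas (Cn (m + 1)) (ι y)
    obtain ⟨κ, j₀, hκ, hpκ, hκe, hκj⟩ :=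
      exists_adaptedChart S hya (mem_chart_source (Cn (m + 1)) (ι y)) (hD.transversal y)
    obtain ⟨P, hP⟩ := hω _ hya
    refine ⟨κ.source, κ.open_source, hpκ, fun u hu hus => ?_⟩
    have h1 := integral_topForm_pullback_eq (ω' := ω') (j₀ := j₀) hD.holomorphic hD.injective hκ
      (fun x hx => (hP x (hκe hx)).1) (fun x hx => (hP x (hκe hx)).2) (fun x _ => hu x) hus
      (fun x hx => by
        rw [mem_range_iff h hD, normSq_eq_zero_iff h hya (hκe hx), hκj x hx])
    have h2 := integral_topForm_ddbar_eq (ω' := ω') (j₀ := j₀) (f := logDefect h S ε) (c := 1)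
      hκ (fun x hx => smoothAt_chiPotential (h := h) (S := S) hε hya (hκe hx))
      (fun x hx => hasPotentialAt_chiEps hω₀ hcurv hε hya (hκe hx))
      (fun x hx => (hP x (hκe hx)).1) (fun x hx => (hP x (hκe hx)).2) (fun x _ => hu x) hus
      (fun x hx hx0 => by
        rw [hκj x hx] at hx0 ⊢
        rw [logDefect_eq_chiPotential hε hya (hκe hx) hx0, one_mul])
    exact ⟨h1.1, by rw [h2, h1.2, one_mul]⟩
  · have ha := chart_mem_atlas (Cn (m + 1)) p
    have hO : IsOpen {x | normSq h S x ≠ 0} := isOpen_ne_fun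
      (continuous_iff_continuousAt.2 fun x => (smoothAt_normSq h S x).continuousAt) continuous_const
    obtain ⟨P, hP⟩ := hω _ ha
    have hκ := (isHolomorphicChart_of_mem_atlas ha).restrOpen hO
    have hs : ∀ x ∈ ((chartAt (Cn (m + 1)) p).restrOpen _ hO).source,
        x ∈ (chartAt (Cn (m + 1)) p).source ∧ normSq h S x ≠ 0 := fun x hx => by
      rw [OpenPartialHomeomorph.restrOpen_source] at hx
      exact hx
    refine ⟨_, ((chartAt (Cn (m + 1)) p).restrOpen _ hO).open_source, ?_, fun u hu hus => ?_⟩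
    · rw [OpenPartialHomeomorph.restrOpen_source]
      exact ⟨mem_chart_source _ p, hp⟩
    have h1 := isIntegrable_of_eq_zero
      (η := topForm (fun y => u (ι y)) fun _ : Fin m => pullback ι ω') fun y z _ => by
        have h0 : u (ι ((chartAt (Cn m) y).symm z)) = 0 := by
          refine image_eq_zero_of_notMem_tsupport fun h0 => (hs _ (hus h0)).2 ?_
          exact (mem_range_iff h hD).1 ⟨_, rfl⟩
        rw [topForm, h0, zero_mul]
    have h2 := integral_topForm_ddbar_eq (ω' := ω') (j₀ := 0) (f := logDefect h S ε) (c := 0)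
      hκ (fun x hx => smoothAt_logDefect (h := h) (S := S) hε (hs x hx).2)
      (fun x hx => hasPotentialAt_chiEps_logDefect hω₀ hcurv hε (hs x hx).2)
      (fun x hx => (hP x (hs x hx).1).1) (fun x hx => (hP x (hs x hx).1).2) (fun x _ => hu x) hus
      (fun x hx _ => by rw [zero_mul, sub_zero])
    exact ⟨h1.1, by rw [h2, h1.2, zero_mul, mul_zero]⟩

/-- The Poincaré–Lelong formula `√-1 ∂∂̄ (log (|S|² + ε) - log |S|²) = χ_ε - 2π [D]`, tested against
`u ω^{n-1}`. -/
lemma integral_logDefect_ddbar (hω₀ : IsKahlerForm ω₀) (hcurv : h.HasCurvature ω₀)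
    (hD : IsSmoothDivisor (m := m) S ι) (hε : 0 < ε) (hω : HasLocalPotentials ω') {u : X → ℝ}
    (hu : ∀ x, SmoothAt (m + 1) u x) :
    integral (topForm (logDefect h S ε) (Fin.cons (ddbar u) fun _ : Fin m => ω')) =
      integral (topForm u (Fin.cons (chiEps ω₀ h S ε) fun _ : Fin m => ω')) -
        2 * Real.pi * integral (topForm (fun y => u (ι y)) fun _ : Fin m => pullback ι ω') := by
  have := isManifold_real (m + 1) X
  choose O hOo hpO hO using
    exists_nhds_integral_logDefect (h := h) (S := S) hω₀ hcurv hD hε hω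
  obtain ⟨ρ, hρ⟩ := SmoothPartitionOfUnity.exists_isSubordinate 𝓘(ℝ, Cn (m + 1)) isClosed_univ O
    hOo fun x _ => Set.mem_iUnion.2 ⟨x, hpO x⟩
  have hfin : {i : X | (Function.support (ρ i)).Nonempty}.Finite :=
    ρ.locallyFinite.finite_nonempty_of_compact
  set s := hfin.toFinset with hs
  set v : X → X → ℝ := fun i x => ρ i x * u x with hv
  have hvs : ∀ i x, SmoothAt (m + 1) (v i) x := fun i x =>
    (smoothAt_of_contMDiff (ρ i).contMDiff x).mul (hu x)
  have hvt : ∀ i, tsupport (v i) ⊆ O i := fun i => (tsupport_mul_subset_left).trans (hρ i)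
  have hsum : ∀ x, u x = ∑ i ∈ s, v i x := by
    intro x
    have h1 : ∑ i ∈ s, ρ i x = 1 := by
      rw [← ρ.sum_eq_one (Set.mem_univ x)]
      refine (finsum_eq_sum_of_support_subset _ fun i hi => ?_).symm
      exact hfin.mem_toFinset.2 ⟨x, hi⟩
    simp only [hv, ← Finset.sum_mul, h1, one_mul]
  have hloc := fun i => hO i (v i) (hvs i) (hvt i)
  have hL : integral (topForm (logDefect h S ε) (Fin.cons (ddbar u) fun _ : Fin m => ω')) =
      ∑ i ∈ s, integral (topForm (logDefect h S ε)
        (Fin.cons (ddbar (v i)) fun _ : Fin m => ω')) := by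
    rw [← integral_sum s fun i _ => isIntegrable_topForm_cons (isLocallyIntegrable_logDefect hD hε)
      (hasLocalPotentials_ddbar (hvs i)) hω]
    refine integral_congr fun x z hz => ?_
    have h1 : (ddbar u : LocalForm (m + 1) X) (chartAt (Cn (m + 1)) x) z =
        ∑ i ∈ s, (ddbar (v i) : LocalForm (m + 1) X) (chartAt (Cn (m + 1)) x) z := by
      simp only [ddbar]
      rw [← complexHessian_sum s]
      · simp only [hsum]
      · intro i _
        have h2 := hvs i _ _ (chart_mem_atlas (Cn (m + 1)) x)
          ((chartAt (Cn (m + 1)) x).map_target hz)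
        rwa [(chartAt (Cn (m + 1)) x).right_inv hz] at h2
    simp only [topForm_cons, h1, Matrix.sum_mul, Matrix.trace_sum, Complex.re_sum, Finset.mul_sum]
  have hR : integral (topForm u (Fin.cons (chiEps ω₀ h S ε) fun _ : Fin m => ω')) =
      ∑ i ∈ s, integral (topForm (v i) (Fin.cons (chiEps ω₀ h S ε) fun _ : Fin m => ω')) := by
    rw [← integral_sum s fun i _ => isIntegrable_topForm_cons
      (isLocallyIntegrable_of_smoothAt (hvs i))
      (hasLocalPotentials_chiEps hω₀ hcurv hε) hω]
    refine integral_congr fun x z _ => ?_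
    simp only [topForm, hsum, Finset.sum_mul]
  have hY : integral (topForm (fun y => u (ι y)) fun _ : Fin m => pullback ι ω') =
      ∑ i ∈ s, integral (topForm (fun y => v i (ι y)) fun _ : Fin m => pullback ι ω') := by
    rw [← integral_sum s fun i _ => (hloc i).1]
    refine integral_congr fun x z _ => ?_
    simp only [topForm, hsum, Finset.sum_mul]
  rw [hL, hR, hY, Finset.mul_sum, ← Finset.sum_sub_distrib]
  exact Finset.sum_congr rfl fun i _ => (hloc i).2

end PoincareLelong

/-! ### Paths of potentials -/

section Density

variable {n m : ℕ} {X : Type*} [TopologicalSpace X]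

lemma formAt_zero {ω₀ : LocalForm n X} {γ : ℝ → X → ℝ} {e : Chart n X} (h0 : γ 0 = 0) (z : Cn n) :
    formAt ω₀ γ 0 e z = ω₀ e z := by
  have h1 : (fun w => γ 0 (e.symm w)) = fun _ : Cn n => (0 : ℝ) := by
    ext w
    rw [h0]
    rfl
  simp only [formAt, Pi.add_apply, ddbar, h1, complexHessian_const, add_zero]

/-- The density of `ω^n / n`. -/
noncomputable def volumeDensity (α : LocalForm (m + 1) X) (e : Chart (m + 1) X)
    (z : Cn (m + 1)) : ℝ :=
  2 ^ (m + 1) * m.factorial * (α e z).det.re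

/-- The density of `α ∧ ω^{n-1}`. -/
noncomputable def mixedDensity (α α' : LocalForm (m + 1) X) (e : Chart (m + 1) X)
    (z : Cn (m + 1)) : ℝ :=
  2 ^ (m + 1) * m.factorial * (α e z * (α' e z).adjugate).trace.re

lemma volumeDensity_nonneg {α : LocalForm (m + 1) X} {e : Chart (m + 1) X}
    {z : Cn (m + 1)} (h : (α e z).PosDef) :
    0 ≤ volumeDensity α e z :=
  mul_nonneg (by positivity) (Complex.lt_def.1 h.det_pos).1.le

lemma topForm_cons_eq_mixedDensity (u : X → ℝ) (α α' : LocalForm (m + 1) X) :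
    topForm u (Fin.cons α fun _ : Fin m => α') = fun e z => u (e.symm z) * mixedDensity α α' e z :=
  funext fun e => funext fun z => topForm_cons u α α' e z

end Density

section Paths

variable {n : ℕ} {X : Type*} [TopologicalSpace X] [ChartedSpace (Cn n) X]
  [IsManifold 𝓘(ℂ, Cn n) ω X] {ω₀ : LocalForm n X} {φ : X → ℝ} {γ : ℝ → X → ℝ}
  {e : Chart n X} {t : ℝ}

lemma IsPotentialPath.contDiffOn (hγ : IsPotentialPath ω₀ φ γ) (he : e ∈ atlas (Cn n) X) :
    ContDiffOn ℝ ∞ (fun p : ℝ × Cn n => γ p.1 (e.symm p.2)) (Set.Icc 0 1 ×ˢ e.target) := by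
  have := isManifold_real n X
  have h1 : ContMDiffOn 𝓘(ℝ, Cn n) 𝓘(ℝ, Cn n) ∞ e.symm e.target :=
    contMDiffOn_symm_of_mem_maximalAtlas (IsManifold.subset_maximalAtlas he)
  have h2 : ContMDiffOn (𝓘(ℝ, ℝ).prod 𝓘(ℝ, Cn n)) (𝓘(ℝ, ℝ).prod 𝓘(ℝ, Cn n)) ∞
      (fun p : ℝ × Cn n => (p.1, e.symm p.2)) (Set.Icc 0 1 ×ˢ e.target) :=
    contMDiffOn_fst.prodMk (h1.comp contMDiffOn_snd fun p hp => hp.2)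
  have h3 := hγ.smooth.comp h2 fun p hp => ⟨hp.1, Set.mem_univ _⟩
  rw [← modelWithCornersSelf_prod, chartedSpaceSelf_prod] at h3
  exact contMDiffOn_iff_contDiffOn.1 h3

lemma IsPotentialPath.contDiffOn_velocity (hγ : IsPotentialPath ω₀ φ γ)
    (he : e ∈ atlas (Cn n) X) : ContDiffOn ℝ ∞
      (fun p : ℝ × Cn n => velocity γ p.1 (e.symm p.2)) (Set.Icc 0 1 ×ˢ e.target) :=
  contDiffOn_derivWithin e.open_target (hγ.contDiffOn he)

lemma IsPotentialPath.smoothAt_velocity (hγ : IsPotentialPath ω₀ φ γ)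
    (ht : t ∈ Set.Icc (0 : ℝ) 1) (x : X) : SmoothAt n (velocity γ t) x := fun _ he hx =>
  (contDiffOn_slice (hγ.contDiffOn_velocity he) ht).contDiffAt
    ((OpenPartialHomeomorph.open_target _).mem_nhds (OpenPartialHomeomorph.map_source _ hx))

lemma IsPotentialPath.smoothAt (hγ : IsPotentialPath ω₀ φ γ)
    (ht : t ∈ Set.Icc (0 : ℝ) 1) (x : X) : SmoothAt n (γ t) x := fun _ he hx =>
  (contDiffOn_slice (hγ.contDiffOn he) ht).contDiffAt
    ((OpenPartialHomeomorph.open_target _).mem_nhds (OpenPartialHomeomorph.map_source _ hx))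

lemma IsPotentialPath.continuousOn_formAt (hγ : IsPotentialPath ω₀ φ γ)
    (hω₀ : IsKahlerForm ω₀) (he : e ∈ atlas (Cn n) X) (j k : Fin n) :
    ContinuousOn (fun p : ℝ × Cn n => formAt ω₀ γ p.1 e p.2 j k) (Set.Icc 0 1 ×ˢ e.target) :=
  (((hω₀.smooth e he j k).continuousOn.comp continuousOn_snd fun _ hp => hp.2)).add
    (contDiffOn_complexHessian_slice e.open_target (hγ.contDiffOn he) j k).continuousOn

lemma IsPotentialPath.continuousOn_ddbar_velocity (hγ : IsPotentialPath ω₀ φ γ)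
    (he : e ∈ atlas (Cn n) X) (j k : Fin n) :
    ContinuousOn (fun p : ℝ × Cn n => (ddbar (velocity γ p.1) : LocalForm n X) e p.2 j k)
      (Set.Icc 0 1 ×ˢ e.target) := by
  have h := contDiffOn_complexHessian_slice e.open_target (hγ.contDiffOn_velocity he) j k
  exact h.continuousOn

lemma IsPotentialPath.hasLocalPotentials_formAt (hγ : IsPotentialPath ω₀ φ γ)
    {h : AnticanonicalMetric n X}
    (hω₀ : IsKahlerForm ω₀) (hcurv : h.HasCurvature ω₀) (ht : t ∈ Set.Icc (0 : ℝ) 1) :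
    HasLocalPotentials (formAt ω₀ γ t) :=
  (hasLocalPotentials_of_hasCurvature hω₀ hcurv).add
    (hasLocalPotentials_ddbar fun x => hγ.smoothAt ht x)

end Paths

section DensityPaths

variable {m : ℕ} {X : Type*} [TopologicalSpace X] [ChartedSpace (Cn (m + 1)) X]
  [IsManifold 𝓘(ℂ, Cn (m + 1)) ω X] {ω₀ : LocalForm (m + 1) X} {φ : X → ℝ} {γ : ℝ → X → ℝ}
  {e : Chart (m + 1) X} {t : ℝ}

/-- The derivative of `ω_t^n / n` is `√-1 ∂∂̄ γ̇(t) ∧ ω_t^{n-1}`. -/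
lemma IsPotentialPath.hasDerivWithinAt_volumeDensity (hγ : IsPotentialPath ω₀ φ γ)
    (he : e ∈ atlas (Cn (m + 1)) X) (ht : t ∈ Set.Icc (0 : ℝ) 1) {z : Cn (m + 1)}
    (hz : z ∈ e.target) :
    HasDerivWithinAt (fun t => volumeDensity (formAt ω₀ γ t) e z)
      (mixedDensity (ddbar (velocity γ t)) (formAt ω₀ γ t) e z) (Set.Icc 0 1) t := by
  have h1 := hasDerivWithinAt_det (B := fun t => formAt ω₀ γ t e z)
    (B' := ddbar (velocity γ t) e z) (t := t) (s := Set.Icc 0 1) fun j k =>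
      (hasDerivWithinAt_complexHessian_slice e.open_target (hγ.contDiffOn he) ht hz j k).const_add _
  exact (Complex.reCLM.hasFDerivAt.comp_hasDerivWithinAt t h1).const_mul _

lemma IsPotentialPath.continuousOn_mixedDensity (hγ : IsPotentialPath ω₀ φ γ)
    (hω₀ : IsKahlerForm ω₀) (he : e ∈ atlas (Cn (m + 1)) X) {α : ℝ → LocalForm (m + 1) X}
    (hα : ∀ j k, ContinuousOn (fun p : ℝ × Cn (m + 1) => α p.1 e p.2 j k)
      (Set.Icc 0 1 ×ˢ e.target)) :
    ContinuousOn (fun p : ℝ × Cn (m + 1) => mixedDensity (α p.1) (formAt ω₀ γ p.1) e p.2)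
      (Set.Icc 0 1 ×ˢ e.target) :=
  continuousOn_const.mul (continuousOn_trace_mul_adjugate hα (hγ.continuousOn_formAt hω₀ he))

end DensityPaths

/-! ### Comparison of the functionals -/

section Comparison

variable {m : ℕ} {X : Type*} [TopologicalSpace X] [ChartedSpace (Cn (m + 1)) X]
  [IsManifold 𝓘(ℂ, Cn (m + 1)) ω X] [T2Space X] [CompactSpace X]
  {Y : Type*} [TopologicalSpace Y] [ChartedSpace (Cn m) Y]
  {ω₀ : LocalForm (m + 1) X} {h : AnticanonicalMetric (m + 1) X}
  {S : AnticanonicalSection (m + 1) X} {ι : Y → X} {ε : ℝ} {φ : X → ℝ} {γ : ℝ → X → ℝ}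

/-- The primitive of `∫_X (log (|S|² + ε) - log |S|²) √-1 ∂∂̄ γ̇ ∧ ω_t^{n-1}` is the integral of
`log (|S|² + ε) - log |S|²` against `ω_t^n / n`. It is nonnegative at `t = 1`, and at `t = 0` it is
increasing in `ε`. -/
lemma neg_integral_le_integral_logDefect (hω₀ : IsKahlerForm ω₀)
    (hD : IsSmoothDivisor (m := m) S ι) (hε : ε ∈ Set.Ioc (0 : ℝ) 1)
    (hγ : IsPotentialPath ω₀ φ γ) :
    -integral (fun e z => logDefect h S 1 (e.symm z) * volumeDensity ω₀ e z) ≤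
      ∫ t in (0 : ℝ)..1, integral (topForm (logDefect h S ε)
        (Fin.cons (ddbar (velocity γ t)) fun _ : Fin m => formAt ω₀ γ t)) := by
  have hloc := isLocallyIntegrable_logDefect (h := h) hD hε.1
  have ha := fun x : X => chart_mem_atlas (Cn (m + 1)) x
  simp only [topForm_cons_eq_mixedDensity]
  rw [intervalIntegral_integral (A := fun t => volumeDensity (formAt ω₀ γ t)) hloc
    (fun x => hγ.continuousOn_mixedDensity hω₀ (ha x)
      (α := fun t => ddbar (velocity γ t)) (hγ.continuousOn_ddbar_velocity (ha x)))
    (fun x z hz t ht => hγ.hasDerivWithinAt_volumeDensity (ha x) ht hz)]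
  have hcont : ∀ t ∈ Set.Icc (0 : ℝ) 1, ∀ x : X, ContinuousOn
      (volumeDensity (formAt ω₀ γ t) (chartAt (Cn (m + 1)) x)) (chartAt (Cn (m + 1)) x).target := by
    intro t ht x
    refine continuousOn_const.mul (continuousOn_det_re fun j k => ?_)
    exact (hγ.continuousOn_formAt hω₀ (ha x) j k).comp (f := fun z : Cn (m + 1) => (t, z))
      (by fun_prop) fun z hz => ⟨ht, hz⟩
  have hcont₀ : ∀ x : X, ContinuousOn (volumeDensity ω₀ (chartAt (Cn (m + 1)) x))
      (chartAt (Cn (m + 1)) x).target := fun x =>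
    continuousOn_const.mul (continuousOn_det_re fun j k => (hω₀.smooth _ (ha x) j k).continuousOn)
  have h1 : (1 : ℝ) ∈ Set.Icc (0 : ℝ) 1 := ⟨zero_le_one, le_rfl⟩
  have h0 : (0 : ℝ) ∈ Set.Icc (0 : ℝ) 1 := ⟨le_rfl, zero_le_one⟩
  simp only [mul_sub]
  rw [integral_sub (hloc.isIntegrable (hcont 1 h1)) (hloc.isIntegrable (hcont 0 h0))]
  have hpos : 0 ≤ integral fun e z =>
      logDefect h S ε (e.symm z) * volumeDensity (formAt ω₀ γ 1) e z :=
    integral_nonneg fun x z hz => mul_nonneg (logDefect_nonneg hε.1.le _)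
      (volumeDensity_nonneg ((hγ.mem 1 h1).2 _ (ha x) z hz))
  have hle : (integral fun e z => logDefect h S ε (e.symm z) * volumeDensity (formAt ω₀ γ 0) e z) ≤
      integral fun e z => logDefect h S 1 (e.symm z) * volumeDensity ω₀ e z := by
    have hd : ∀ e z, volumeDensity (formAt ω₀ γ 0) e z = volumeDensity ω₀ e z := fun e z => by
      rw [volumeDensity, formAt_zero hγ.zero, volumeDensity]
    simp only [hd]
    have hp : ∀ x : X, ∀ z ∈ (chartAt (Cn (m + 1)) x).target,
        0 ≤ volumeDensity ω₀ (chartAt (Cn (m + 1)) x) z := fun x z hz =>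
      volumeDensity_nonneg (hω₀.pos _ (ha x) z hz)
    exact integral_mono
      ((isLocallyIntegrable_logDefect hD zero_lt_one).isIntegrable hcont₀)
      (fun x z hz => mul_nonneg (logDefect_nonneg hε.1.le _) (hp x z hz))
      fun x z hz => mul_le_mul_of_nonneg_right (logDefect_mono hε.1.le hε.2 _) (hp x z hz)
  linarith

variable [IsManifold 𝓘(ℂ, Cn m) ω Y] [T2Space Y] [CompactSpace Y]

/-- By the Poincaré–Lelong formula, the difference of the two functionals is an integral of
`log (|S|² + ε) - log |S|²`. -/
lemma JEps_sub_JChi (hω₀ : IsKahlerForm ω₀) (hcurv : h.HasCurvature ω₀)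
    (hD : IsSmoothDivisor (m := m) S ι) (hε : 0 < ε) (hγ : IsPotentialPath ω₀ φ γ) :
    JEps ω₀ h S ε γ - JChi ι ω₀ γ =
      ((m + 1 : ℕ) : ℝ) * ∫ t in (0 : ℝ)..1, integral (topForm (logDefect h S ε)
        (Fin.cons (ddbar (velocity γ t)) fun _ : Fin m => formAt ω₀ γ t)) := by
  have ha := fun x : X => chart_mem_atlas (Cn (m + 1)) x
  have hone : IsLocallyIntegrable (m + 1) (fun _ : X => (1 : ℝ)) :=
    isLocallyIntegrable_of_smoothAt fun _ => smoothAt_const 1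
  set A : ℝ → ℝ := fun t => integral (topForm (velocity γ t)
    (Fin.cons (chiEps ω₀ h S ε) fun _ : Fin m => formAt ω₀ γ t)) with hA
  set B : ℝ → ℝ := fun t => integral (topForm (velocity γ t)
    fun _ : Fin (m + 1) => formAt ω₀ γ t) with hB
  set P : ℝ → ℝ := fun t => integral (topForm (logDefect h S ε)
    (Fin.cons (ddbar (velocity γ t)) fun _ : Fin m => formAt ω₀ γ t)) with hP
  set D : ℝ → ℝ := fun t => integral (topForm
    (fun y => velocity γ t (ι y)) fun _ : Fin m => pullback ι (formAt ω₀ γ t)) with hDd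
  have hconst : ∀ t, (fun _ : Fin (m + 1) => formAt ω₀ γ t) =
      Fin.cons (formAt ω₀ γ t) fun _ : Fin m => formAt ω₀ γ t := fun t => by
    ext1 i
    refine Fin.cases ?_ (fun i => ?_) i <;> simp
  have hvel : ∀ x : X, ContinuousOn (fun p : ℝ × Cn (m + 1) =>
      velocity γ p.1 ((chartAt (Cn (m + 1)) x).symm p.2))
      (Set.Icc 0 1 ×ˢ (chartAt (Cn (m + 1)) x).target) := fun x =>
    (hγ.contDiffOn_velocity (ha x)).continuousOn
  have hAi : IntervalIntegrable A volume 0 1 := by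
    have h1 := intervalIntegrable_integral hone
      (k := fun t e z => velocity γ t (e.symm z) *
        mixedDensity (chiEps ω₀ h S ε) (formAt ω₀ γ t) e z) fun x =>
      (hvel x).mul (hγ.continuousOn_mixedDensity hω₀ (ha x) (α := fun _ => chiEps ω₀ h S ε)
        fun j k => ((hasLocalPotentials_chiEps hω₀ hcurv hε).continuousOn (ha x) j k).comp
          continuousOn_snd fun _ hp => hp.2)
    simpa only [one_mul, hA, topForm_cons_eq_mixedDensity] using h1
  have hBi : IntervalIntegrable B volume 0 1 := by
    have h1 := intervalIntegrable_integral hone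
      (k := fun t e z => velocity γ t (e.symm z) *
        mixedDensity (formAt ω₀ γ t) (formAt ω₀ γ t) e z) fun x =>
      (hvel x).mul (hγ.continuousOn_mixedDensity hω₀ (ha x) (α := formAt ω₀ γ)
        (hγ.continuousOn_formAt hω₀ (ha x)))
    simpa only [one_mul, hB, hconst, topForm_cons_eq_mixedDensity] using h1
  have hPi : IntervalIntegrable P volume 0 1 := by
    have h1 := intervalIntegrable_integral (isLocallyIntegrable_logDefect (h := h) hD hε)
      (k := fun t => mixedDensity (ddbar (velocity γ t)) (formAt ω₀ γ t)) fun x =>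
      hγ.continuousOn_mixedDensity hω₀ (ha x)
        (α := fun t => ddbar (velocity γ t)) (hγ.continuousOn_ddbar_velocity (ha x))
    simpa only [hP, topForm_cons_eq_mixedDensity] using h1
  have hJ : ∫ t in (0 : ℝ)..1, integral (topForm (velocity γ t)
      (Fin.cons (chiEps ω₀ h S ε - formAt ω₀ γ t) fun _ : Fin m => formAt ω₀ γ t)) =
      (∫ t in (0 : ℝ)..1, A t) - ∫ t in (0 : ℝ)..1, B t := by
    rw [← intervalIntegral.integral_sub hAi hBi]
    refine intervalIntegral.integral_congr fun t ht => ?_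
    rw [Set.uIcc_of_le zero_le_one] at ht
    have hω := hγ.hasLocalPotentials_formAt hω₀ hcurv ht
    have hv := isLocallyIntegrable_of_smoothAt (hγ.smoothAt_velocity ht)
    simp only [hA, hB, hconst]
    rw [← integral_sub (isIntegrable_topForm_cons hv (hasLocalPotentials_chiEps hω₀ hcurv hε) hω)
      (isIntegrable_topForm_cons hv hω hω)]
    refine integral_congr fun x z _ => ?_
    simp only [topForm_cons, Pi.sub_apply, sub_mul, Matrix.trace_sub, Complex.sub_re]
    ring
  -- the integrability in time of the term on the divisor is that of the other two terms of the
  -- Poincaré–Lelong formula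
  have hPL : ∫ t in (0 : ℝ)..1, D t =
      (2 * Real.pi)⁻¹ * ((∫ t in (0 : ℝ)..1, A t) - ∫ t in (0 : ℝ)..1, P t) := by
    rw [← intervalIntegral.integral_sub hAi hPi, ← intervalIntegral.integral_const_mul]
    refine intervalIntegral.integral_congr fun t ht => ?_
    rw [Set.uIcc_of_le zero_le_one] at ht
    have h1 := integral_logDefect_ddbar (h := h) (S := S) hω₀ hcurv hD hε
      (hγ.hasLocalPotentials_formAt hω₀ hcurv ht) (hγ.smoothAt_velocity ht)
    simp only [hA, hP, hDd]
    rw [h1]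
    field_simp
    ring
  rw [JEps, JChi, hJ, hPL]
  field_simp
  ring

end Comparison

end TwistedEnergy

theorem lemma3p5 {m : ℕ} {X : Type*} [TopologicalSpace X] [ChartedSpace (Cn (m + 1)) X]
    [IsManifold 𝓘(ℂ, Cn (m + 1)) ω X] [T2Space X] [CompactSpace X] [ConnectedSpace X]
    {Y : Type*} [TopologicalSpace Y] [ChartedSpace (Cn m) Y]
    [IsManifold 𝓘(ℂ, Cn m) ω Y] [T2Space Y] [CompactSpace Y]
    (ω₀ : LocalForm (m + 1) X) (hω₀ : IsKahlerForm ω₀)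
    (h : AnticanonicalMetric (m + 1) X) (hcurv : h.HasCurvature ω₀)
    (S : AnticanonicalSection (m + 1) X) (ι : Y → X) (hD : IsSmoothDivisor (m := m) S ι) :
    ∃ C₃ : ℝ, 0 < C₃ ∧ ∀ ε ∈ Set.Ioc (0 : ℝ) 1, ∀ φ ∈ kahlerPotentials ω₀,
      ∀ γ : ℝ → X → ℝ, IsPotentialPath ω₀ φ γ →
        JEps ω₀ h S ε γ ≥ JChi ι ω₀ γ - C₃ ∧
        ∀ β ∈ Set.Ioc (0 : ℝ) 1,
          twistedKEnergyEps ω₀ h S β ε γ ≥ twistedKEnergy ι ω₀ β γ - C₃ := by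
  set I := integral (fun e z => logDefect h S 1 (e.symm z) * volumeDensity ω₀ e z) with hI
  have hI0 : 0 ≤ I := integral_nonneg fun x z hz => mul_nonneg (logDefect_nonneg zero_le_one _)
    (volumeDensity_nonneg (hω₀.pos _ (chart_mem_atlas _ x) z hz))
  have hn : (0 : ℝ) ≤ ((m + 1 : ℕ) : ℝ) := Nat.cast_nonneg _
  have hC : 0 < ((m + 1 : ℕ) : ℝ) * I + 1 := by positivity
  refine ⟨((m + 1 : ℕ) : ℝ) * I + 1, hC, fun ε hε φ _ γ hγ => ?_⟩
  have hJ : JEps ω₀ h S ε γ ≥ JChi ι ω₀ γ - (((m + 1 : ℕ) : ℝ) * I + 1) := by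
    have h1 := JEps_sub_JChi hω₀ hcurv hD hε.1 hγ
    have h2 := mul_le_mul_of_nonneg_left
      (neg_integral_le_integral_logDefect (h := h) hω₀ hD hε hγ) hn
    rw [← h1] at h2
    linarith
  refine ⟨hJ, fun β hβ => ?_⟩
  rw [twistedKEnergyEps, twistedKEnergy]
  -- `(1 - β) C₃ ≤ C₃`
  have h3 := mul_le_mul_of_nonneg_left hJ (sub_nonneg.2 hβ.2)
  have h4 := mul_nonneg hβ.1.le hC.le
  linarith
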